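/- Conventions. Languages are over finite alphabets (finite subsets of a fixed countable set of symbols). A full trio is a family of languages closed under homomorphism, inverse homomorphism and intersection with regular languages; a full AFL is a full trio closed also under union, concatenation and Kleene star. $\mathrm{NCM}$ is the family of languages accepted by one-way nondeterministic multicounter machines ($\lambda$-moves allowed, each counter can be tested for zero, incremented and decremented) for which there is a bound $l$ such that in every accepting computation each counter changes at most $l$ times between non-decreasing and non-increasing. $\hat{\mathcal F}_{\mathrm{NCM}}(\mathcal L)$ is the smallest full AFL that contains $\mathcal L$ and is closed under intersection with languages from $\mathrm{NCM}$. Let $\mathcal L$ be a full trio whose languages are given by finite descriptions. Suppose that $\mathcal L$ is effectively semilinear (there is an algorithm which, from a description of $L\in\mathcal L$, computes the constants and periods of finitely many linear sets whose union is the Parikh image of $L$), and that intersection with regular languages is effective in $\mathcal L$ (there is an algorithm which, from a description of $L \in\mathcal L$ and a finite automaton for $R$, computes a description of $L\cap R$). Describe languages by expressions built from descriptions of languages of $\mathcal L$ by means of homomorphisms, inverse homomorphisms, intersection with regular languages (given by finite automata), intersection with $\mathrm{NCM}$ languages (each given by a machine together with a reversal bound), union, concatenation and Kleene star. The languages described are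 exactly those of $\hat{\mathcal F}_{\mathrm{NCM}}(\mathcal L)$, and: 1. If inverse homomorphism is effective in $\mathcal L$ as well (there is an algorithm which, from a description of $L\in\mathcal L$ and a homomorphism $h$, computes a description of $h^{-1}(L)$), then the membership problem (given an expression and a word $w$, does $w$ belong to the language described?), the emptiness problem (given an expression, is the language described empty?) and the infiniteness problem (given an expression, is the language described infinite?) are decidable for $\hat{\mathcal F}_{\mathrm{NCM}}(\mathcal L)$. 2. $\hat{\mathcal F}_{\mathrm{NCM}}(\mathcal L)$ is a proper subset of the family of recursive languages (this does not need the additional assumption of part 1). -/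

import Mathlib

/-! Symbols are natural numbers, words are elements of `List ℕ`, and a language is a
`Language ℕ` all of whose words are over one finite alphabet. -/

open scoped Pointwise

namespace LangFam

/-! ### Alphabets and homomorphisms -/

/-- All words of `L` are over some finite alphabet. -/
def HasFiniteAlphabet (L : Language ℕ) : Prop :=
  ∃ S : Finset ℕ, ∀ w ∈ L, ∀ a ∈ w, a ∈ S

/-- The image of `L` under the homomorphism of free monoids sending the letter `a` to `f a`.
Only the values of `f` on the alphabet of `L` matter. -/
def homImage (f : ℕ → List ℕ) (L : Language ℕ) : Language ℕ :=
  {v | ∃ w ∈ L, v = w.flatMap f}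

/-- The inverse image of `L` under the homomorphism `S* → ℕ*` sending a letter `a ∈ S`
to `f a`. -/
def homPreimage (S : Finset ℕ) (f : ℕ → List ℕ) (L : Language ℕ) : Language ℕ :=
  {w | (∀ a ∈ w, a ∈ S) ∧ w.flatMap f ∈ L}

/-! ### Full trios and full AFLs -/

/-- A full trio: a family of languages closed under homomorphism, inverse homomorphism and
intersection with regular languages. (As every member has a finite alphabet, it makes no
difference that Mathlib's regular languages over `ℕ` may involve infinitely many letters.) -/
structure IsFullTrio (F : Set (Language ℕ)) : Prop where
  finite_alphabet : ∀ L ∈ F, HasFiniteAlphabet L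
  hom : ∀ L ∈ F, ∀ f : ℕ → List ℕ, homImage f L ∈ F
  invHom : ∀ L ∈ F, ∀ (S : Finset ℕ) (f : ℕ → List ℕ), homPreimage S f L ∈ F
  inter_regular : ∀ L ∈ F, ∀ R : Language ℕ, R.IsRegular → L ⊓ R ∈ F

/-- A full AFL: a full trio closed under union, concatenation and Kleene star. -/
structure IsFullAFL (F : Set (Language ℕ)) : Prop extends IsFullTrio F where
  union : ∀ L₁ ∈ F, ∀ L₂ ∈ F, L₁ + L₂ ∈ F
  concat : ∀ L₁ ∈ F, ∀ L₂ ∈ F, L₁ * L₂ ∈ F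
  star : ∀ L ∈ F, KStar.kstar L ∈ F

/-! ### Reversal-bounded multicounter machines -/

/-- A transition of a one-way multicounter machine. `label = none` is a `λ`-move. The `i`-th
entry `(b, o)` of `acts` concerns counter `i`: the transition may be taken only if the counter
is nonzero (`b = true`) resp. zero (`b = false`), and then the counter is incremented
(`o = some true`), decremented (`o = some false`) or left unchanged (`o = none`). -/
structure CounterTrans where
  src : ℕ
  label : Option ℕ
  acts : List (Bool × Option Bool)
  tgt : ℕ

/-- A one-way nondeterministic multicounter machine; states are natural numbers. -/
structure CounterMachine where
  counters : ℕ
  start : ℕ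
  final : List ℕ
  trans : List CounterTrans

/-- `x` may become `y` under the test and update `t`. -/
def CounterStep (t : Bool × Option Bool) (x y : ℕ) : Prop :=
  (t.1 = true ↔ x ≠ 0) ∧
    match t.2 with
    | none => y = x
    | some true => y = x + 1
    | some false => x = y + 1

/-- Number of positions at which a sequence of increments and decrements changes direction. -/
def alternations : List Bool → ℕ
  | [] => 0
  | [_] => 0
  | a :: b :: l => (if a = b then 0 else 1) + alternations (b :: l)

/-- The number of reversals of counter `i` along a sequence of transitions. -/
def reversals (i : ℕ) (ts : List CounterTrans) : ℕ :=
  alternations (ts.filterMap fun t => (t.acts[i]?).bind fun a => a.2)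

namespace CounterMachine

/-- `M.Run q c w ts q' c'`: the transitions `ts` lead `M` from state `q` and counter values `c`
to state `q'` and counter values `c'` while reading exactly `w`. -/
inductive Run (M : CounterMachine) :
    ℕ → (Fin M.counters → ℕ) → List ℕ → List CounterTrans → ℕ → (Fin M.counters → ℕ) → Prop
  | nil (q : ℕ) (c : Fin M.counters → ℕ) : Run M q c [] [] q c
  | cons (t : CounterTrans) (c c₁ c₂ : Fin M.counters → ℕ) (w : List ℕ)
      (ts : List CounterTrans) (q : ℕ) (ht : t ∈ M.trans)
      (hstep : ∀ i : Fin M.counters,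
        ∃ a, t.acts[(i : ℕ)]? = some a ∧ CounterStep a (c i) (c₁ i))
      (hrun : Run M t.tgt c₁ w ts q c₂) :
      Run M t.src c (t.label.toList ++ w) (t :: ts) q c₂

/-- `ts` is an accepting computation on `w`: it starts in the start state with all counters
zero, reads all of `w`, and ends in a final state. -/
def Accepting (M : CounterMachine) (w : List ℕ) (ts : List CounterTrans) : Prop :=
  ∃ q c, M.Run M.start (fun _ => 0) w ts q c ∧ q ∈ M.final

/-- The language accepted by `M`. -/
def language (M : CounterMachine) : Language ℕ :=
  {w | ∃ ts, M.Accepting w ts}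

/-- Every accepting computation makes at most `l` reversals on each counter. -/
def IsReversalBounded (M : CounterMachine) (l : ℕ) : Prop :=
  ∀ w ts, M.Accepting w ts → ∀ i < M.counters, reversals i ts ≤ l

end CounterMachine

/-- The family `NCM` of languages accepted by reversal-bounded multicounter machines. -/
def NCM : Set (Language ℕ) :=
  {L | ∃ (M : CounterMachine) (l : ℕ), M.IsReversalBounded l ∧ M.language = L}

/-- The smallest full AFL that contains `F` and is closed under intersection with languages
from `NCM`. -/
def fullAFLNCM (F : Set (Language ℕ)) : Set (Language ℕ) :=
  ⋂₀ {G | IsFullAFL G ∧ F ⊆ G ∧ ∀ L ∈ G, ∀ N ∈ NCM, L ⊓ N ∈ G}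

/-- The recursive languages (over finite alphabets). -/
def recursiveLanguages : Set (Language ℕ) :=
  {L | HasFiniteAlphabet L ∧ ComputablePred fun w : List ℕ => w ∈ L}

/-! ### Finite descriptions of homomorphisms, regular languages and semilinear sets -/

/-- A homomorphism with finite domain alphabet, as a table of letters and their images. -/
abbrev HomCode := List (ℕ × List ℕ)

namespace HomCode

/-- The domain alphabet. -/
def dom (h : HomCode) : Finset ℕ := (h.map Prod.fst).toFinset

/-- The image of a letter (the empty word for letters outside the domain). -/
def fn (h : HomCode) (a : ℕ) : List ℕ := (h.lookup a).getD []

end HomCode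

/-- A nondeterministic finite automaton as a finite object: start states, final states, and
transitions (source, letter, target). -/
structure NFACode where
  start : List ℕ
  final : List ℕ
  trans : List (ℕ × ℕ × ℕ)

/-- The regular language accepted by a finite automaton. -/
def NFACode.language (A : NFACode) : Language ℕ :=
  NFA.accepts
    { step := fun q a => {q' | (q, a, q') ∈ A.trans}
      start := {q | q ∈ A.start}
      accept := {q | q ∈ A.final} : NFA ℕ ℕ }

/-- A finite list of linear sets, each given by its constant and its periods; a vector is the
list of its coordinates `0, 1, 2, …`, the missing ones being zero. -/
abbrev SemilinearCode := List (List ℕ × List (List ℕ))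

/-- The vector with the given coordinates. -/
def vec (l : List ℕ) : ℕ → ℕ := fun i => l.getD i 0

/-- The semilinear set described by a list of constants and periods. -/
def SemilinearCode.toSet (s : SemilinearCode) : Set (ℕ → ℕ) :=
  ⋃ p ∈ s, vec p.1 +ᵥ (AddSubmonoid.closure {v | ∃ q ∈ p.2, v = vec q} : Set (ℕ → ℕ))

/-- The Parikh vector of a word, indexed by letters. -/
def parikh (w : List ℕ) : ℕ → ℕ := fun a => w.count a

/-- The Parikh image of a language. -/
def parikhImage (L : Language ℕ) : Set (ℕ → ℕ) := {v | ∃ w ∈ L, v = parikh w}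

instance : Primcodable CounterTrans :=
  Primcodable.ofEquiv (ℕ × Option ℕ × List (Bool × Option Bool) × ℕ)
    { toFun := fun t => (t.src, t.label, t.acts, t.tgt)
      invFun := fun p => ⟨p.1, p.2.1, p.2.2.1, p.2.2.2⟩
      left_inv := fun _ => rfl
      right_inv := fun _ => rfl }

instance : Primcodable CounterMachine :=
  Primcodable.ofEquiv (ℕ × ℕ × List ℕ × List CounterTrans)
    { toFun := fun M => (M.counters, M.start, M.final, M.trans)
      invFun := fun p => ⟨p.1, p.2.1, p.2.2.1, p.2.2.2⟩
      left_inv := fun _ => rfl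
      right_inv := fun _ => rfl }

instance : Primcodable NFACode :=
  Primcodable.ofEquiv (List ℕ × List ℕ × List (ℕ × ℕ × ℕ))
    { toFun := fun A => (A.start, A.final, A.trans)
      invFun := fun p => ⟨p.1, p.2.1, p.2.2⟩
      left_inv := fun _ => rfl
      right_inv := fun _ => rfl }

/-! ### Effective properties of a represented family

A family is represented by `ν : C → Language ℕ` on a set `D` of valid descriptions, which need
not be decidable. Algorithms have to halt and be correct on valid descriptions. -/

section Effective

/-- There is an algorithm that computes constants and periods for the Parikh image of a language
from a description of it. -/
def EffectivelySemilinear {C : Type*} [Primcodable C] (D : Set C) (ν : C → Language ℕ) : Prop :=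
  ∃ f : C →. SemilinearCode, Partrec f ∧
    ∀ c ∈ D, ∃ s ∈ f c, parikhImage (ν c) = s.toSet

/-- Intersection with regular languages is effective. -/
def EffectiveInterRegular {C : Type*} [Primcodable C] (D : Set C) (ν : C → Language ℕ) : Prop :=
  ∃ f : C × NFACode →. C, Partrec f ∧
    ∀ c ∈ D, ∀ A : NFACode, ∃ c' ∈ f (c, A), c' ∈ D ∧ ν c' = ν c ⊓ A.language

/-- Inverse homomorphism is effective. -/
def EffectiveInvHom {C : Type*} [Primcodable C] (D : Set C) (ν : C → Language ℕ) : Prop :=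
  ∃ f : C × HomCode →. C, Partrec f ∧
    ∀ c ∈ D, ∀ h : HomCode, ∃ c' ∈ f (c, h), c' ∈ D ∧ ν c' = homPreimage h.dom h.fn (ν c)

end Effective

/-! ### Descriptions of the languages of the full AFL -/

/-- Expressions built from descriptions of languages of the original family by the full AFL
operations and intersection with the language of a counter machine; a counter machine is given
together with its reversal bound. -/
inductive Expr (C : Type*) where
  | base (c : C)
  | hom (h : HomCode) (e : Expr C)
  | invHom (h : HomCode) (e : Expr C)
  | interReg (A : NFACode) (e : Expr C)
  | interNCM (M : CounterMachine) (l : ℕ) (e : Expr C)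
  | union (e₁ e₂ : Expr C)
  | concat (e₁ e₂ : Expr C)
  | star (e : Expr C)

namespace Expr

/-- The descriptions at the leaves are valid and the stated reversal bounds hold. -/
def Valid {C : Type*} (D : Set C) : Expr C → Prop
  | base c => c ∈ D
  | hom _ e => e.Valid D
  | invHom _ e => e.Valid D
  | interReg _ e => e.Valid D
  | interNCM M l e => M.IsReversalBounded l ∧ e.Valid D
  | union e₁ e₂ => e₁.Valid D ∧ e₂.Valid D
  | concat e₁ e₂ => e₁.Valid D ∧ e₂.Valid D
  | star e => e.Valid D

/-- The language denoted by an expression. -/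
def eval {C : Type*} (ν : C → Language ℕ) : Expr C → Language ℕ
  | base c => ν c
  | hom h e => homImage h.fn (e.eval ν)
  | invHom h e => homPreimage h.dom h.fn (e.eval ν)
  | interReg A e => e.eval ν ⊓ A.language
  | interNCM M _ e => e.eval ν ⊓ M.language
  | union e₁ e₂ => e₁.eval ν + e₂.eval ν
  | concat e₁ e₂ => e₁.eval ν * e₂.eval ν
  | star e => KStar.kstar (e.eval ν)

end Expr

/-- The symbols in which expressions are written: descriptions, homomorphisms, inverse
homomorphisms, automata, counter machines with reversal bound, and the three signs for union,
concatenation and star. -/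
abbrev Token (C : Type*) :=
  C ⊕ HomCode ⊕ HomCode ⊕ NFACode ⊕ (CounterMachine × ℕ) ⊕ Fin 3

/-- An expression written in postfix notation (uniquely readable). -/
def Expr.tokens {C : Type*} : Expr C → List (Token C)
  | .base c => [.inl c]
  | .hom h e => e.tokens ++ [.inr (.inl h)]
  | .invHom h e => e.tokens ++ [.inr (.inr (.inl h))]
  | .interReg A e => e.tokens ++ [.inr (.inr (.inr (.inl A)))]
  | .interNCM M l e => e.tokens ++ [.inr (.inr (.inr (.inr (.inl (M, l)))))]
  | .union e₁ e₂ => e₁.tokens ++ e₂.tokens ++ [.inr (.inr (.inr (.inr (.inr 0))))]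
  | .concat e₁ e₂ => e₁.tokens ++ e₂.tokens ++ [.inr (.inr (.inr (.inr (.inr 1))))]
  | .star e => e.tokens ++ [.inr (.inr (.inr (.inr (.inr 2))))]

/-- Given (the postfix form of) a valid expression and a word, it is decidable whether the word
belongs to the language of the expression. -/
def MembershipDecidable {C : Type*} [Primcodable C] (D : Set C) (ν : C → Language ℕ) : Prop :=
  ∃ f : List (Token C) × List ℕ →. Bool, Partrec f ∧
    ∀ e : Expr C, e.Valid D → ∀ w : List ℕ,
      ∃ b ∈ f (e.tokens, w), (b = true ↔ w ∈ e.eval ν)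

/-- Given a valid expression, it is decidable whether its language is empty. -/
def EmptinessDecidable {C : Type*} [Primcodable C] (D : Set C) (ν : C → Language ℕ) : Prop :=
  ∃ f : List (Token C) →. Bool, Partrec f ∧
    ∀ e : Expr C, e.Valid D →
      ∃ b ∈ f e.tokens, (b = true ↔ ∀ w : List ℕ, w ∉ e.eval ν)

/-- Given a valid expression, it is decidable whether its language is infinite. -/
def InfinitenessDecidable {C : Type*} [Primcodable C] (D : Set C) (ν : C → Language ℕ) : Prop :=
  ∃ f : List (Token C) →. Bool, Partrec f ∧
    ∀ e : Expr C, e.Valid D →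
      ∃ b ∈ f e.tokens, (b = true ↔ Set.Infinite {w : List ℕ | w ∈ e.eval ν})

end LangFam

/-! A Parikh image alone does not determine the Parikh images of intersections, so it cannot be
carried through an expression. What can be carried is the family of all sets `values A L`: for a
finite automaton `A` with λ-moves whose transitions bear weight vectors, the weights of the
accepting paths labelled by words of `L`. `Represents L d c` says that the program `c` answers each
such query of dimension at most `d` by a semilinear set, and names a finite alphabet of `L` as well.

Every operation turns programs for its operands into a program for its result. For homomorphisms and
inverse homomorphisms the automaton absorbs the map (`values_homImage`, `values_homPreimage`).
Intersection with a language defined by an automaton whose weights must satisfy k equations becomes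
a query to the product automaton with 2k further coordinates, followed by solving the equations in a
semilinear set (`values_inter_balanced`, `exists_solution`). Concatenation and star need the weights
between all pairs of states; one query gets them by recording both end points in two further
coordinates, and star is then state elimination (`toSet_concatCode`, `toSet_kstarCode`).

For a reversal-bounded machine, pass to sequences of transitions. There the states impose a regular
condition and each counter a separate one, and a single counter with boundedly many reversals is a
system of linear equations between numbers of increments and decrements, one for each phase
(`CounterRun.exists_run`, `exists_counterRun`). So intersection with an `NCM` language is composed
of the previous operations (`inter_counterMachine`).

For a language of the original family, spell each path of `A` as a word showing both labels and
weights. Then `values A L` is a linear image of the Parikh image of an inverse homomorphic image of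
`L` cut by a regular language (`values_eq_image`). If inverse homomorphism is effective, this is
uniform in the description, which gives part 1. Otherwise, for a fixed language and a fixed
dimension, one inverse image serves all queries, so a program still exists, though not uniformly;
this is why dimensions are bounded and tracked, and it suffices for recursiveness in part 2.

Membership of `w` is a query with an automaton for `w`; emptiness and infiniteness are queries about
the set of lengths. The inclusion in part 2 is proper because the recursive language of words of
square length has a set of lengths that is not semilinear. -/

namespace LangFam

/-! ### Primitive recursive functions, in compositional form -/

attribute [fun_prop] Primrec

namespace PrimrecComp

variable {α β γ σ : Type*} [Primcodable α] [Primcodable β] [Primcodable γ] [Primcodable σ]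

-- The closure properties of `Primrec` are put into fully applied form, so that `fun_prop` can show
-- by structural recursion that the constructions below are computable.
@[fun_prop] theorem id : Primrec (fun x : α => x) := Primrec.id

@[fun_prop] theorem const (c : σ) : Primrec (fun _ : α => c) := Primrec.const c

@[fun_prop] theorem comp {f : β → σ} {g : α → β} (hf : Primrec f) (hg : Primrec g) :
    Primrec (fun x => f (g x)) := hf.comp hg

@[fun_prop] theorem fst {f : α → β × γ} (hf : Primrec f) : Primrec (fun x => (f x).1) :=
  Primrec.fst.comp hf

@[fun_prop] theorem snd {f : α → β × γ} (hf : Primrec f) : Primrec (fun x => (f x).2) :=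
  Primrec.snd.comp hf

@[fun_prop] theorem pair {f : α → β} {g : α → γ} (hf : Primrec f) (hg : Primrec g) :
    Primrec (fun x => (f x, g x)) := hf.pair hg

@[fun_prop] theorem some {f : α → β} (hf : Primrec f) :
    Primrec (fun x => Option.some (f x)) := Primrec.option_some.comp hf

@[fun_prop] theorem cons {f : α → β} {g : α → List β} (hf : Primrec f) (hg : Primrec g) :
    Primrec (fun x => f x :: g x) := Primrec.list_cons.comp hf hg

@[fun_prop] theorem append {f g : α → List β} (hf : Primrec f) (hg : Primrec g) :
    Primrec (fun x => f x ++ g x) := Primrec.list_append.comp hf hg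

@[fun_prop] theorem length {f : α → List β} (hf : Primrec f) :
    Primrec (fun x => (f x).length) := Primrec.list_length.comp hf

@[fun_prop] theorem tail {f : α → List β} (hf : Primrec f) :
    Primrec (fun x => (f x).tail) := Primrec.list_tail.comp hf

@[fun_prop] theorem flatten {f : α → List (List β)} (hf : Primrec f) :
    Primrec (fun x => (f x).flatten) := Primrec.list_flatten.comp hf

@[fun_prop] theorem head? {f : α → List β} (hf : Primrec f) :
    Primrec (fun x => (f x).head?) := Primrec.list_head?.comp hf

@[fun_prop] theorem drop {f : α → ℕ} {g : α → List β} (hf : Primrec f) (hg : Primrec g) :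
    Primrec (fun x => (g x).drop (f x)) := Primrec.list_drop.comp hf hg

@[fun_prop] theorem listGetD {f : α → List β} {g : α → ℕ} (c : β) (hf : Primrec f)
    (hg : Primrec g) : Primrec (fun x => (f x).getD (g x) c) :=
  (Primrec.list_getD c).comp hf hg

@[fun_prop] theorem getElem? {f : α → List β} {g : α → ℕ} (hf : Primrec f)
    (hg : Primrec g) : Primrec (fun x => (f x)[g x]?) :=
  Primrec.list_getElem?.comp hf hg

@[fun_prop] theorem optionGetD {f : α → Option β} {g : α → β} (hf : Primrec f)
    (hg : Primrec g) : Primrec (fun x => (f x).getD (g x)) :=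
  Primrec.option_getD.comp hf hg

@[fun_prop] theorem toList {f : α → Option β} (hf : Primrec f) :
    Primrec (fun x => (f x).toList) := Primrec.optionToList.comp hf

@[fun_prop] theorem lookup [DecidableEq β] {f : α → β} {g : α → List (β × γ)}
    (hf : Primrec f) (hg : Primrec g) : Primrec (fun x => (g x).lookup (f x)) :=
  Primrec.listLookup.comp hf hg

@[fun_prop] theorem add {f g : α → ℕ} (hf : Primrec f) (hg : Primrec g) :
    Primrec (fun x => f x + g x) := Primrec.nat_add.comp hf hg

@[fun_prop] theorem sub {f g : α → ℕ} (hf : Primrec f) (hg : Primrec g) :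
    Primrec (fun x => f x - g x) := Primrec.nat_sub.comp hf hg

@[fun_prop] theorem mul {f g : α → ℕ} (hf : Primrec f) (hg : Primrec g) :
    Primrec (fun x => f x * g x) := Primrec.nat_mul.comp hf hg

@[fun_prop] theorem mod {f g : α → ℕ} (hf : Primrec f) (hg : Primrec g) :
    Primrec (fun x => f x % g x) := Primrec.nat_mod.comp hf hg

@[fun_prop] theorem div {f g : α → ℕ} (hf : Primrec f) (hg : Primrec g) :
    Primrec (fun x => f x / g x) := Primrec.nat_div.comp hf hg

@[fun_prop] theorem natPair {f g : α → ℕ} (hf : Primrec f) (hg : Primrec g) :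
    Primrec (fun x => Nat.pair (f x) (g x)) := Primrec₂.natPair.comp hf hg

@[fun_prop] theorem encode {f : α → β} (hf : Primrec f) :
    Primrec (fun x => Encodable.encode (f x)) := Primrec.encode.comp hf

@[fun_prop] theorem range {f : α → ℕ} (hf : Primrec f) :
    Primrec (fun x => List.range (f x)) := Primrec.list_range.comp hf

@[fun_prop] theorem flatMap {f : α → List β} {g : α → β → List σ} (hf : Primrec f)
    (hg : Primrec (fun p : α × β => g p.1 p.2)) : Primrec (fun x => (f x).flatMap (g x)) :=
  Primrec.list_flatMap hf hg

@[fun_prop] theorem map {f : α → List β} {g : α → β → σ} (hf : Primrec f)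
    (hg : Primrec (fun p : α × β => g p.1 p.2)) : Primrec (fun x => (f x).map (g x)) :=
  Primrec.list_map hf hg

@[fun_prop] theorem foldr {f : α → List β} {g : α → σ} {h : α → β → σ → σ} (hf : Primrec f)
    (hg : Primrec g) (hh : Primrec (fun p : α × β × σ => h p.1 p.2.1 p.2.2)) :
    Primrec (fun x => (f x).foldr (h x) (g x)) :=
  Primrec.list_foldr (h := fun a p => h a p.1 p.2) hf hg hh

@[fun_prop] theorem foldl {f : α → List β} {g : α → σ} {h : α → σ → β → σ} (hf : Primrec f)
    (hg : Primrec g) (hh : Primrec (fun p : α × σ × β => h p.1 p.2.1 p.2.2)) :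
    Primrec (fun x => (f x).foldl (h x) (g x)) :=
  Primrec.list_foldl (h := fun a p => h a p.1 p.2) hf hg hh

@[fun_prop] theorem iterate {f : α → ℕ} {g : α → β} {h : α → β → β} (hf : Primrec f)
    (hg : Primrec g) (hh : Primrec (fun p : α × β => h p.1 p.2)) :
    Primrec (fun x => (h x)^[f x] (g x)) := Primrec.nat_iterate hf hg hh

@[fun_prop] theorem ite_eq [DecidableEq γ] {u v : α → γ} {f g : α → β} (hu : Primrec u)
    (hv : Primrec v) (hf : Primrec f) (hg : Primrec g) :
    Primrec (fun x => if u x = v x then f x else g x) :=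
  Primrec.ite (Primrec.eq.comp hu hv) hf hg

@[fun_prop] theorem ite_le {u v : α → ℕ} {f g : α → β} (hu : Primrec u)
    (hv : Primrec v) (hf : Primrec f) (hg : Primrec g) :
    Primrec (fun x => if u x ≤ v x then f x else g x) :=
  Primrec.ite (Primrec.nat_le.comp hu hv) hf hg

@[fun_prop] theorem ite_lt {u v : α → ℕ} {f g : α → β} (hu : Primrec u)
    (hv : Primrec v) (hf : Primrec f) (hg : Primrec g) :
    Primrec (fun x => if u x < v x then f x else g x) :=
  Primrec.ite (Primrec.nat_lt.comp hu hv) hf hg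

@[fun_prop] theorem cond {u : α → Bool} {f g : α → β} (hu : Primrec u)
    (hf : Primrec f) (hg : Primrec g) : Primrec (fun x => bif u x then f x else g x) :=
  Primrec.cond hu hf hg

-- Because of this rule and the next one, the constructions below branch with `elim` instead of
-- pattern matching.
@[fun_prop] theorem optionElim {o : α → Option β} {f : α → σ} {g : α → β → σ}
    (ho : Primrec o) (hf : Primrec f) (hg : Primrec (fun p : α × β => g p.1 p.2)) :
    Primrec (fun x => (o x).elim (f x) (g x)) :=
  (Primrec.option_casesOn ho hf hg).of_eq fun x => by cases o x <;> rfl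

@[fun_prop] theorem sumElim {o : α → β ⊕ γ} {f : α → β → σ} {g : α → γ → σ}
    (ho : Primrec o) (hf : Primrec (fun p : α × β => f p.1 p.2))
    (hg : Primrec (fun p : α × γ => g p.1 p.2)) :
    Primrec (fun x => (o x).elim (f x) (g x)) :=
  (Primrec.sumCasesOn ho hf hg).of_eq fun x => by cases o x <;> rfl

/-- An automaton as a tuple. -/
def nfaEquiv : NFACode ≃ List ℕ × List ℕ × List (ℕ × ℕ × ℕ) where
  toFun := fun A => (A.start, A.final, A.trans)
  invFun := fun p => ⟨p.1, p.2.1, p.2.2⟩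
  left_inv := fun _ => rfl
  right_inv := fun _ => rfl

/-- A counter machine as a tuple. -/
def machineEquiv : CounterMachine ≃ ℕ × ℕ × List ℕ × List CounterTrans where
  toFun := fun M => (M.counters, M.start, M.final, M.trans)
  invFun := fun p => ⟨p.1, p.2.1, p.2.2.1, p.2.2.2⟩
  left_inv := fun _ => rfl
  right_inv := fun _ => rfl

/-- A transition as a tuple. -/
def transEquiv : CounterTrans ≃ ℕ × Option ℕ × List (Bool × Option Bool) × ℕ where
  toFun := fun t => (t.src, t.label, t.acts, t.tgt)
  invFun := fun p => ⟨p.1, p.2.1, p.2.2.1, p.2.2.2⟩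
  left_inv := fun _ => rfl
  right_inv := fun _ => rfl

theorem nfaTuple : Primrec fun A : NFACode => (A.start, A.final, A.trans) :=
  Primrec.of_equiv (e := nfaEquiv)

theorem machineTuple :
    Primrec fun M : CounterMachine => (M.counters, M.start, M.final, M.trans) :=
  Primrec.of_equiv (e := machineEquiv)

theorem transTuple : Primrec fun t : CounterTrans => (t.src, t.label, t.acts, t.tgt) :=
  Primrec.of_equiv (e := transEquiv)

@[fun_prop] theorem nfaMk {f g : α → List ℕ} {h : α → List (ℕ × ℕ × ℕ)} (hf : Primrec f)
    (hg : Primrec g) (hh : Primrec h) : Primrec (fun x => NFACode.mk (f x) (g x) (h x)) := by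
  have h1 : Primrec nfaEquiv.symm := Primrec.of_equiv_symm (e := nfaEquiv)
  exact h1.comp (hf.pair (hg.pair hh))

@[fun_prop] theorem nfaStart {f : α → NFACode} (hf : Primrec f) :
    Primrec (fun x => (f x).start) := Primrec.fst.comp (nfaTuple.comp hf)

@[fun_prop] theorem nfaFinal {f : α → NFACode} (hf : Primrec f) :
    Primrec (fun x => (f x).final) := Primrec.fst.comp (Primrec.snd.comp (nfaTuple.comp hf))

@[fun_prop] theorem nfaTrans {f : α → NFACode} (hf : Primrec f) :
    Primrec (fun x => (f x).trans) := Primrec.snd.comp (Primrec.snd.comp (nfaTuple.comp hf))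

@[fun_prop] theorem machineCounters {f : α → CounterMachine} (hf : Primrec f) :
    Primrec (fun x => (f x).counters) := Primrec.fst.comp (machineTuple.comp hf)

@[fun_prop] theorem machineStart {f : α → CounterMachine} (hf : Primrec f) :
    Primrec (fun x => (f x).start) := Primrec.fst.comp (Primrec.snd.comp (machineTuple.comp hf))

@[fun_prop] theorem machineFinal {f : α → CounterMachine} (hf : Primrec f) :
    Primrec (fun x => (f x).final) := Primrec.fst.comp (Primrec.snd.comp (Primrec.snd.comp (machineTuple.comp hf)))

@[fun_prop] theorem machineTrans {f : α → CounterMachine} (hf : Primrec f) :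
    Primrec (fun x => (f x).trans) := Primrec.snd.comp (Primrec.snd.comp (Primrec.snd.comp (machineTuple.comp hf)))

@[fun_prop] theorem transSrc {f : α → CounterTrans} (hf : Primrec f) :
    Primrec (fun x => (f x).src) := Primrec.fst.comp (transTuple.comp hf)

@[fun_prop] theorem transLabel {f : α → CounterTrans} (hf : Primrec f) :
    Primrec (fun x => (f x).label) := Primrec.fst.comp (Primrec.snd.comp (transTuple.comp hf))

@[fun_prop] theorem transActs {f : α → CounterTrans} (hf : Primrec f) :
    Primrec (fun x => (f x).acts) := Primrec.fst.comp (Primrec.snd.comp (Primrec.snd.comp (transTuple.comp hf)))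

@[fun_prop] theorem transTgt {f : α → CounterTrans} (hf : Primrec f) :
    Primrec (fun x => (f x).tgt) := Primrec.snd.comp (Primrec.snd.comp (Primrec.snd.comp (transTuple.comp hf)))

end PrimrecComp

/-! ### Weighted automata and queries -/

/-- Transitions with source, label (`none` for a `λ`-move), weight vector and target. -/
abbrev WTrans := List (ℕ × Option ℕ × List ℕ × ℕ)

/-- A weighted automaton: start state, final state, transitions. -/
abbrev WAut := ℕ × ℕ × WTrans

/-- `WRun T q w v r`: there is a path from `q` to `r` with label `w` and weight `v`. -/
inductive WRun (T : WTrans) : ℕ → List ℕ → (ℕ → ℕ) → ℕ → Prop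
  | nil (q : ℕ) : WRun T q [] 0 q
  | cons {q : ℕ} {a : Option ℕ} {u : List ℕ} {q' : ℕ} {w : List ℕ} {v : ℕ → ℕ} {r : ℕ}
      (ht : (q, a, u, q') ∈ T) (hr : WRun T q' w v r) :
      WRun T q (a.toList ++ w) (vec u + v) r

/-- The weights of the accepting paths of `A` whose labels are in `L`. -/
def values (A : WAut) (L : Language ℕ) : Set (ℕ → ℕ) :=
  {v | ∃ w ∈ L, WRun A.2.2 A.1 w v A.2.1}

/-- The answer to a query: an alphabet and a semilinear set. -/
abbrev Answer := List ℕ × SemilinearCode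

open Nat.Partrec (Code)

/-- The partial function from automata to answers computed by a program. -/
def query (c : Code) (A : WAut) : Part Answer :=
  (c.eval (Encodable.encode A)).bind fun n => (Encodable.decode (α := Answer) n : Part Answer)

theorem partrec_query : Partrec₂ query := by
  have h : Partrec fun p : Code × WAut => p.1.eval (Encodable.encode p.2) :=
    Nat.Partrec.Code.eval_part.comp Computable.fst (Computable.encode.comp Computable.snd)
  have h2 : Partrec₂ fun (_ : Code × WAut) (n : ℕ) =>
      (Encodable.decode (α := Answer) n : Part Answer) :=
    (Computable.decode.comp Computable.snd).ofOption
  exact h.bind h2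

/-- The `s-m-n` theorem for queries. -/
theorem exists_code {δ : Type*} [Primcodable δ] {f : δ × WAut →. Answer} (hf : Partrec f) :
    ∃ G : δ → Code, Primrec G ∧ ∀ x A, query (G x) A = f (x, A) := by
  obtain ⟨c, hc⟩ := Nat.Partrec.Code.exists_code.1 hf
  refine ⟨fun x => c.curry (Encodable.encode x),
    Nat.Partrec.Code.primrec₂_curry.comp (Primrec.const c) Primrec.encode, fun x A => ?_⟩
  have h : c.eval (Nat.pair (Encodable.encode x) (Encodable.encode A)) =
      (f (x, A)).map Encodable.encode := by
    rw [hc, ← Encodable.encode_prod_val]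
    simp only [Encodable.encodek, Part.coe_some, Part.bind_some]
  rw [query, Nat.Partrec.Code.eval_curry, h]
  rw [Part.bind_map]
  simp only [Encodable.encodek, Part.coe_some, Part.bind_some_right]

/-- `c` answers all queries of dimension at most `d` about the language `L`. -/
def Represents (L : Language ℕ) (d : ℕ) (c : Code) : Prop :=
  ∀ A : WAut, (∀ t ∈ A.2.2, t.2.2.1.length ≤ d) →
    ∃ r ∈ query c A, (∀ w ∈ L, ∀ a ∈ w, a ∈ r.1) ∧ r.2.toSet = values A L

/-- `G` combines programs: it asks one query to each of two programs. -/
def AsksTwo {δ : Type*} (pre₁ : δ × WAut → WAut) (pre₂ : (δ × WAut) × Answer → WAut)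
    (post : ((δ × WAut) × Answer) × Answer → Answer) (G : δ × Code × Code → Code) : Prop :=
  ∀ x c₁ c₂ A, query (G (x, c₁, c₂)) A =
    (query c₁ (pre₁ (x, A))).bind fun r₁ => (query c₂ (pre₂ ((x, A), r₁))).map fun r₂ =>
      post (((x, A), r₁), r₂)

/-- Programs that ask one query to each of two given programs. -/
theorem exists_code_two {δ : Type*} [Primcodable δ] {pre₁ : δ × WAut → WAut}
    {pre₂ : (δ × WAut) × Answer → WAut} {post : ((δ × WAut) × Answer) × Answer → Answer}
    (h₁ : Primrec pre₁) (h₂ : Primrec pre₂) (h₃ : Primrec post) :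
    ∃ G : δ × Code × Code → Code, Primrec G ∧ AsksTwo pre₁ pre₂ post G := by
  have h : Partrec fun p : (δ × Code × Code) × WAut =>
      (query p.1.2.1 (pre₁ (p.1.1, p.2))).bind fun r₁ =>
        (query p.1.2.2 (pre₂ ((p.1.1, p.2), r₁))).map fun r₂ =>
          post (((p.1.1, p.2), r₁), r₂) := by
    refine Partrec.bind (partrec_query.comp (by
      exact Primrec.to_comp (by fun_prop)) (by exact Primrec.to_comp (by fun_prop))) ?_
    refine Partrec.map (partrec_query.comp (by
      exact Primrec.to_comp (by fun_prop)) (by exact Primrec.to_comp (by fun_prop))) ?_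
    exact Primrec.to_comp (by fun_prop)
  obtain ⟨G, hG, hG'⟩ := exists_code h
  exact ⟨G, hG, fun x c₁ c₂ A => hG' _ _⟩

/-! ### Operations on semilinear sets -/

/-- A linear set: constant and periods. -/
abbrev LinearCode := List ℕ × List (List ℕ)

/-- The submonoid generated by a list of periods. -/
def periodSpan (P : List (List ℕ)) : AddSubmonoid (ℕ → ℕ) :=
  AddSubmonoid.closure {v | ∃ q ∈ P, v = vec q}

/-- The linear set with given constant and periods. -/
def LinearCode.toSet (p : LinearCode) : Set (ℕ → ℕ) :=
  {v | ∃ u ∈ periodSpan p.2, v = vec p.1 + u}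

theorem mem_toSet {s : SemilinearCode} {v : ℕ → ℕ} :
    v ∈ s.toSet ↔ ∃ p ∈ s, v ∈ LinearCode.toSet p := by
  simp only [SemilinearCode.toSet, Set.mem_iUnion, Set.mem_vadd_set, LinearCode.toSet,
    Set.mem_ofPred_eq, exists_prop, periodSpan, vadd_eq_add, SetLike.mem_coe, eq_comm]

@[simp] theorem toSet_nil : SemilinearCode.toSet [] = ∅ := by
  ext v; simp [mem_toSet]

theorem toSet_append (s t : SemilinearCode) :
    SemilinearCode.toSet (s ++ t) = s.toSet ∪ t.toSet := by
  ext v; simp [mem_toSet, or_and_right, exists_or]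

/-- A linear set contains its constant, so emptiness can be read off the code. The decision
procedures rest on this. -/
theorem toSet_eq_empty {s : SemilinearCode} : s.toSet = ∅ ↔ s = [] := by
  refine ⟨fun h => ?_, fun h => by simp [h]⟩
  rcases s with _ | ⟨p, s⟩
  · rfl
  · exact absurd (h ▸ mem_toSet.2 ⟨p, by simp, 0, zero_mem _, by simp⟩ :
      vec p.1 ∈ (∅ : Set (ℕ → ℕ))) (by simp)

theorem vec_mem_periodSpan {P : List (List ℕ)} {q : List ℕ} (h : q ∈ P) :
    vec q ∈ periodSpan P := AddSubmonoid.subset_closure ⟨q, h, rfl⟩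

theorem periodSpan_append (P Q : List (List ℕ)) :
    periodSpan (P ++ Q) = periodSpan P ⊔ periodSpan Q := by
  rw [periodSpan, periodSpan, periodSpan, ← AddSubmonoid.closure_union]
  congr 1
  ext v
  simp [or_and_right, exists_or]

theorem periodSpan_cons (q : List ℕ) (P : List (List ℕ)) :
    periodSpan (q :: P) = AddSubmonoid.multiples (vec q) ⊔ periodSpan P := by
  rw [← List.singleton_append, periodSpan_append, AddSubmonoid.multiples_eq_closure]
  congr 1
  rw [periodSpan]
  congr 1
  ext v
  simp

theorem mem_periodSpan_cons {q : List ℕ} {P : List (List ℕ)} {v : ℕ → ℕ} :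
    v ∈ periodSpan (q :: P) ↔ ∃ n : ℕ, ∃ u ∈ periodSpan P, v = n • vec q + u := by
  rw [periodSpan_cons, AddSubmonoid.mem_sup]
  simp only [AddSubmonoid.mem_multiples_iff]
  constructor
  · rintro ⟨_, ⟨n, rfl⟩, u, hu, rfl⟩
    exact ⟨n, u, hu, rfl⟩
  · rintro ⟨n, u, hu, rfl⟩
    exact ⟨_, ⟨n, rfl⟩, u, hu, rfl⟩

@[simp] theorem periodSpan_nil : periodSpan [] = ⊥ := by
  simp [periodSpan]

/-- The multiset keeps the multiplicities of the periods, on which the argument about minimal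
solutions counts. -/
theorem mem_periodSpan_iff_multiset {P : List (List ℕ)} {v : ℕ → ℕ} :
    v ∈ periodSpan P ↔ ∃ l : Multiset (List ℕ), (∀ q ∈ l, q ∈ P) ∧ v = (l.map vec).sum := by
  constructor
  · intro h
    induction h using AddSubmonoid.closure_induction with
    | mem x hx => obtain ⟨q, hq, rfl⟩ := hx; exact ⟨{q}, by simpa using hq, by simp⟩
    | zero => exact ⟨0, by simp, by simp⟩
    | add x y _ _ hx hy =>
      obtain ⟨l, hl, rfl⟩ := hx
      obtain ⟨m, hm, rfl⟩ := hy
      refine ⟨l + m, fun q hq => ?_, by simp⟩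
      rcases Multiset.mem_add.1 hq with h | h
      exacts [hl q h, hm q h]
  · rintro ⟨l, hl, rfl⟩
    refine AddSubmonoid.multiset_sum_mem _ _ fun x hx => ?_
    obtain ⟨q, hq, rfl⟩ := Multiset.mem_map.1 hx
    exact vec_mem_periodSpan (hl q hq)

/-- Sum of vectors. -/
def vecAdd (a b : List ℕ) : List ℕ :=
  (List.range (a.length + b.length)).map fun i => a.getD i 0 + b.getD i 0

theorem vec_vecAdd (a b : List ℕ) : vec (vecAdd a b) = vec a + vec b := by
  funext i
  simp only [vec, vecAdd, Pi.add_apply]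
  by_cases h : i < a.length + b.length
  · rw [List.getD_eq_getElem _ _ (by simpa using h)]
    simp
  · rw [List.getD_eq_default _ _ (by simp; omega), List.getD_eq_default _ _ (by omega),
      List.getD_eq_default _ _ (by omega)]

/-- Multiple of a vector. -/
def vecSMul (n : ℕ) (a : List ℕ) : List ℕ := a.map fun x => n * x

theorem vec_vecSMul (n : ℕ) (a : List ℕ) : vec (vecSMul n a) = n • vec a := by
  funext i
  simp only [vec, vecSMul, Pi.smul_apply, smul_eq_mul]
  by_cases h : i < a.length
  · rw [List.getD_eq_getElem _ _ (by simpa using h), List.getD_eq_getElem _ _ h]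
    simp
  · rw [List.getD_eq_default _ _ (by simp; omega), List.getD_eq_default _ _ (by omega),
      mul_zero]

@[simp] theorem vec_nil : vec [] = 0 := by funext i; simp [vec]

/-- Sum of linear sets. -/
def linAdd (p q : LinearCode) : LinearCode := (vecAdd p.1 q.1, p.2 ++ q.2)

theorem mem_linAdd {p q : LinearCode} {v : ℕ → ℕ} :
    v ∈ (linAdd p q).toSet ↔ ∃ x ∈ p.toSet, ∃ y ∈ q.toSet, v = x + y := by
  simp only [LinearCode.toSet, linAdd, Set.mem_ofPred_eq, periodSpan_append, AddSubmonoid.mem_sup,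
    vec_vecAdd]
  constructor
  · rintro ⟨_, ⟨x, hx, y, hy, rfl⟩, rfl⟩
    exact ⟨_, ⟨x, hx, rfl⟩, _, ⟨y, hy, rfl⟩, by abel⟩
  · rintro ⟨_, ⟨x, hx, rfl⟩, _, ⟨y, hy, rfl⟩, rfl⟩
    exact ⟨_, ⟨x, hx, y, hy, rfl⟩, by abel⟩

/-- Sum of semilinear sets. -/
def sumCode (s t : SemilinearCode) : SemilinearCode :=
  s.flatMap fun p => t.map fun q => linAdd p q

theorem toSet_sumCode (s t : SemilinearCode) :
    (sumCode s t).toSet = s.toSet + t.toSet := by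
  ext v
  simp only [mem_toSet, sumCode, List.mem_flatMap, List.mem_map, Set.mem_add]
  constructor
  · rintro ⟨_, ⟨p, hp, q, hq, rfl⟩, hv⟩
    obtain ⟨x, hx, y, hy, rfl⟩ := mem_linAdd.1 hv
    exact ⟨x, ⟨p, hp, hx⟩, y, ⟨q, hq, hy⟩, rfl⟩
  · rintro ⟨x, ⟨p, hp, hx⟩, y, ⟨q, hq, hy⟩, rfl⟩
    exact ⟨_, ⟨p, hp, q, hq, rfl⟩, mem_linAdd.2 ⟨x, hx, y, hy, rfl⟩⟩

/-- A sum of n + 1 elements of c + ⟨P⟩ is c plus n copies of c plus an element of ⟨P⟩; so c joins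
the periods, and only the empty sum needs a separate linear set. -/
theorem closure_linear (p : LinearCode) :
    (SemilinearCode.toSet [([], []), (p.1, p.1 :: p.2)]) =
      (AddSubmonoid.closure p.toSet : Set (ℕ → ℕ)) := by
  ext v
  simp only [mem_toSet, List.mem_cons, List.not_mem_nil, or_false, exists_eq_or_imp,
    exists_eq_left, SetLike.mem_coe]
  constructor
  · rintro (⟨u, hu, rfl⟩ | ⟨u, hu, rfl⟩)
    · simp only [periodSpan_nil, AddSubmonoid.mem_bot] at hu
      simp [hu]
    · obtain ⟨n, w, hw, rfl⟩ := mem_periodSpan_cons.1 hu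
      have h1 : vec p.1 ∈ AddSubmonoid.closure p.toSet :=
        AddSubmonoid.subset_closure ⟨0, zero_mem _, by simp⟩
      have h2 : vec p.1 + w ∈ AddSubmonoid.closure p.toSet :=
        AddSubmonoid.subset_closure ⟨w, hw, rfl⟩
      have := add_mem (nsmul_mem h1 n) h2
      convert this using 1
      dsimp only
      abel
  · intro hv
    induction hv using AddSubmonoid.closure_induction with
    | mem x hx =>
      obtain ⟨u, hu, rfl⟩ := hx
      exact Or.inr ⟨u, mem_periodSpan_cons.2 ⟨0, u, hu, by simp⟩, rfl⟩
    | zero => exact Or.inl ⟨0, zero_mem _, by simp⟩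
    | add x y _ _ hx hy =>
      rcases hx with ⟨u, hu, rfl⟩ | ⟨u, hu, rfl⟩
      · simp only [periodSpan_nil, AddSubmonoid.mem_bot] at hu
        simpa [hu] using hy
      rcases hy with ⟨u', hu', rfl⟩ | ⟨u', hu', rfl⟩
      · simp only [periodSpan_nil, AddSubmonoid.mem_bot] at hu'
        refine Or.inr ⟨u, hu, by simp [hu']⟩
      · refine Or.inr ⟨u + (vec p.1 + u'),
          add_mem hu (add_mem (vec_mem_periodSpan (by simp)) hu'), ?_⟩
        dsimp only
        abel

/-- The submonoid generated by a semilinear set. -/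
def starCode (s : SemilinearCode) : SemilinearCode :=
  s.foldr (fun p acc => sumCode [([], []), (p.1, p.1 :: p.2)] acc) [([], [])]

/-- By commutativity, the submonoid generated by a union is the sum of the submonoids generated by
the parts. -/
theorem toSet_starCode (s : SemilinearCode) :
    (starCode s).toSet = (AddSubmonoid.closure s.toSet : Set (ℕ → ℕ)) := by
  induction s with
  | nil =>
    ext v
    simp [starCode, mem_toSet, LinearCode.toSet]
  | cons p s ih =>
    have h : SemilinearCode.toSet (p :: s) =
        LinearCode.toSet p ∪ SemilinearCode.toSet s := by
      ext v
      simp [mem_toSet]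
    rw [h, AddSubmonoid.closure_union, AddSubmonoid.coe_sup, ← ih, ← closure_linear,
      ← toSet_sumCode]
    rfl

/-- Image of a semilinear set. -/
def mapCode (f : List ℕ → List ℕ) (s : SemilinearCode) : SemilinearCode :=
  s.map fun p => (f p.1, p.2.map f)

theorem mem_toSet_map {f : List ℕ → List ℕ} {φ : (ℕ → ℕ) →+ (ℕ → ℕ)}
    (h : ∀ l, vec (f l) = φ (vec l)) {p : LinearCode} {v : ℕ → ℕ} :
    v ∈ LinearCode.toSet (f p.1, p.2.map f) ↔ ∃ u ∈ p.toSet, v = φ u := by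
  have h2 : periodSpan (p.2.map f) = (periodSpan p.2).map φ := by
    rw [periodSpan, periodSpan, AddMonoidHom.map_mclosure]
    congr 1
    ext v
    simp only [List.mem_map, Set.mem_ofPred_eq, Set.mem_image]
    constructor
    · rintro ⟨_, ⟨q, hq, rfl⟩, rfl⟩
      exact ⟨_, ⟨q, hq, rfl⟩, (h q).symm⟩
    · rintro ⟨_, ⟨q, hq, rfl⟩, rfl⟩
      exact ⟨_, ⟨q, hq, rfl⟩, (h q).symm⟩
  simp only [LinearCode.toSet, Set.mem_ofPred_eq, h2, AddSubmonoid.mem_map, h]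
  constructor
  · rintro ⟨_, ⟨u, hu, rfl⟩, rfl⟩
    exact ⟨_, ⟨u, hu, rfl⟩, by simp⟩
  · rintro ⟨_, ⟨u, hu, rfl⟩, rfl⟩
    exact ⟨_, ⟨u, hu, rfl⟩, by simp⟩

theorem toSet_mapCode {f : List ℕ → List ℕ} {φ : (ℕ → ℕ) →+ (ℕ → ℕ)}
    (h : ∀ l, vec (f l) = φ (vec l)) (s : SemilinearCode) :
    (mapCode f s).toSet = φ '' s.toSet := by
  ext v
  simp only [mem_toSet, mapCode, List.mem_map, Set.mem_image]
  constructor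
  · rintro ⟨_, ⟨p, hp, rfl⟩, hv⟩
    obtain ⟨u, hu, rfl⟩ := (mem_toSet_map h).1 hv
    exact ⟨u, ⟨p, hp, hu⟩, rfl⟩
  · rintro ⟨u, ⟨p, hp, hu⟩, rfl⟩
    exact ⟨_, ⟨p, hp, rfl⟩, (mem_toSet_map h).2 ⟨u, hu, rfl⟩⟩

/-! ### Solving one linear equation -/

theorem card_le_of_count_le {α : Type*} [DecidableEq α] {l : Multiset α} {P : Finset α}
    (hl : ∀ x ∈ l, x ∈ P) {M : ℕ} (h : ∀ x ∈ l, l.count x ≤ M) : l.card ≤ P.card * M := by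
  rw [← Multiset.toFinset_sum_count_eq]
  calc ∑ a ∈ l.toFinset, l.count a ≤ ∑ _a ∈ l.toFinset, M :=
        Finset.sum_le_sum fun a ha => h a (Multiset.mem_toFinset.1 ha)
    _ = l.toFinset.card * M := by simp
    _ ≤ P.card * M := Nat.mul_le_mul_right _ (Finset.card_le_card fun x hx =>
        hl x (Multiset.mem_toFinset.1 hx))

/-- Elements with b < a number at most |P|·M, hence add at most |P|·M·M to the left side. Each other
element makes the right side gain at least one on the left side, so there are at most M + |P|·M·M of
them. -/
theorem card_le_of_balanced {α : Type*} [DecidableEq α] {l : Multiset α} {P : Finset α}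
    (hl : ∀ x ∈ l, x ∈ P) {a b : α → ℕ} (hne : ∀ x ∈ l, a x ≠ b x) {c d M : ℕ}
    (heq : c + (l.map a).sum = d + (l.map b).sum) (hM : ∀ x ∈ P, a x ≤ M) (hc : c ≤ M)
    (hpos : ∀ x ∈ l, b x < a x → l.count x ≤ M) :
    l.card ≤ P.card * M + (M + P.card * M * M) := by
  have hcount : (l.filter fun x => b x < a x).card ≤ P.card * M := by
    refine card_le_of_count_le (fun x hx => hl x (Multiset.mem_of_mem_filter hx)) fun x hx => ?_
    obtain ⟨h1, h2⟩ := Multiset.mem_filter.1 hx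
    exact (Multiset.count_le_of_le _ (Multiset.filter_le _ _)).trans (hpos x h1 h2)
  have hsplit := Multiset.filter_add_not (fun x => b x < a x) l
  have h1 : ((l.filter fun x => b x < a x).map a).sum ≤
      (l.filter fun x => b x < a x).card * M := by
    have := Multiset.sum_le_card_nsmul ((l.filter fun x => b x < a x).map a) M (by
      intro y hy
      obtain ⟨x, hx, rfl⟩ := Multiset.mem_map.1 hy
      exact hM x (hl x (Multiset.mem_of_mem_filter hx)))
    simpa using this
  have h2 : (l.filter fun x => ¬ b x < a x).card + ((l.filter fun x => ¬ b x < a x).map a).sum ≤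
      ((l.filter fun x => ¬ b x < a x).map b).sum := by
    have := Multiset.sum_map_le_sum_map (s := l.filter fun x => ¬ b x < a x)
      (fun x => 1 + a x) b (by
        intro x hx
        obtain ⟨h1, h2⟩ := Multiset.mem_filter.1 hx
        have := hne x h1
        omega)
    simpa [Multiset.sum_map_add] using this
  have h3 : (l.map a).sum = ((l.filter fun x => b x < a x).map a).sum +
      ((l.filter fun x => ¬ b x < a x).map a).sum := by
    conv_lhs => rw [← hsplit]
    simp
  have h4 : (l.map b).sum = ((l.filter fun x => b x < a x).map b).sum +
      ((l.filter fun x => ¬ b x < a x).map b).sum := by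
    conv_lhs => rw [← hsplit]
    simp
  have h5 : l.card = (l.filter fun x => b x < a x).card +
      (l.filter fun x => ¬ b x < a x).card := by
    conv_lhs => rw [← hsplit]
    simp
  have h6 : (l.filter fun x => b x < a x).card * M ≤ P.card * M * M :=
    Nat.mul_le_mul_right _ hcount
  omega

/-- All sums of `c` and at most `n` periods. -/
def candidates (P : List (List ℕ)) (n : ℕ) (c : List ℕ) : List (List ℕ) :=
  (fun L : List (List ℕ) => L ++ L.flatMap fun x => P.map fun q => vecAdd x q)^[n] [c]

theorem candidates_succ (P : List (List ℕ)) (n : ℕ) (c : List ℕ) :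
    candidates P (n + 1) c =
      candidates P n c ++ (candidates P n c).flatMap fun x => P.map fun q => vecAdd x q := by
  rw [candidates, Function.iterate_succ_apply']
  rfl

theorem exists_candidate {P : List (List ℕ)} {c : List ℕ} {l : Multiset (List ℕ)}
    (hl : ∀ q ∈ l, q ∈ P) {n : ℕ} (hn : l.card ≤ n) :
    ∃ x ∈ candidates P n c, vec x = vec c + (l.map vec).sum := by
  induction n generalizing l with
  | zero =>
    obtain rfl : l = 0 := by simpa using hn
    exact ⟨c, by simp [candidates], by simp⟩
  | succ n ih =>
    rw [candidates_succ]
    induction l using Multiset.induction with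
    | empty =>
      obtain ⟨x, hx, h⟩ := ih (l := 0) (by simp) (by simp)
      exact ⟨x, by simp [hx], h⟩
    | cons q l _ =>
      obtain ⟨x, hx, h⟩ := ih (l := l) (fun r hr => hl r (by simp [hr])) (by simpa using hn)
      refine ⟨vecAdd x q, List.mem_append_right _ (List.mem_flatMap.2
        ⟨x, hx, List.mem_map.2 ⟨q, hl q (by simp), rfl⟩⟩), ?_⟩
      rw [vec_vecAdd, h]
      simp only [Multiset.map_cons, Multiset.sum_cons]
      abel

theorem candidates_sound {P : List (List ℕ)} {c : List ℕ} {n : ℕ} {x : List ℕ}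
    (hx : x ∈ candidates P n c) : vec x ∈ LinearCode.toSet (c, P) := by
  induction n generalizing x with
  | zero =>
    obtain rfl : x = c := by simpa [candidates] using hx
    exact ⟨0, zero_mem _, by simp⟩
  | succ n ih =>
    rw [candidates_succ, List.mem_append, List.mem_flatMap] at hx
    rcases hx with hx | ⟨y, hy, hx⟩
    · exact ih hx
    · obtain ⟨q, hq, rfl⟩ := List.mem_map.1 hx
      obtain ⟨u, hu, h⟩ := ih hy
      refine ⟨u + vec q, add_mem hu (vec_mem_periodSpan hq), ?_⟩
      rw [vec_vecAdd, h]
      abel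

/-- Periods of the set of solutions of the equation between the first two coordinates. -/
def rays (P : List (List ℕ)) : List (List ℕ) :=
  (P.flatMap fun p => if p.getD 0 0 = p.getD 1 0 then [p] else []) ++
    P.flatMap fun p => P.flatMap fun q =>
      if p.getD 1 0 < p.getD 0 0 then
        if q.getD 0 0 < q.getD 1 0 then
          [vecAdd (vecSMul (q.getD 1 0 - q.getD 0 0) p) (vecSMul (p.getD 0 0 - p.getD 1 0) q)]
        else []
      else []

theorem mem_rays {P : List (List ℕ)} {r : List ℕ} :
    r ∈ rays P ↔ (r ∈ P ∧ r.getD 0 0 = r.getD 1 0) ∨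
      ∃ p ∈ P, ∃ q ∈ P, p.getD 1 0 < p.getD 0 0 ∧ q.getD 0 0 < q.getD 1 0 ∧
        r = vecAdd (vecSMul (q.getD 1 0 - q.getD 0 0) p)
          (vecSMul (p.getD 0 0 - p.getD 1 0) q) := by
  simp only [rays, List.mem_append, List.mem_flatMap]
  refine or_congr ⟨?_, ?_⟩ ⟨?_, ?_⟩
  · rintro ⟨p, hp, h⟩
    split_ifs at h with h1
    · obtain rfl := List.mem_singleton.1 h
      exact ⟨hp, h1⟩
    · simp at h
  · rintro ⟨hp, h⟩
    exact ⟨r, hp, by rw [if_pos h]; simp⟩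
  · rintro ⟨p, hp, q, hq, h⟩
    split_ifs at h with h1 h2
    · exact ⟨p, hp, q, hq, h1, h2, List.mem_singleton.1 h⟩
    · simp at h
    · simp at h
  · rintro ⟨p, hp, q, hq, h1, h2, rfl⟩
    exact ⟨p, hp, q, hq, by rw [if_pos h1, if_pos h2]; simp⟩

/-- In a mixed ray, p has surplus p₀ − p₁ and is taken q₁ − q₀ times, q has deficit q₁ − q₀ and is
taken p₀ − p₁ times; these cancel. -/
theorem periodSpan_rays {P : List (List ℕ)} {u : ℕ → ℕ} (hu : u ∈ periodSpan (rays P)) :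
    u ∈ periodSpan P ∧ u 0 = u 1 := by
  induction hu using AddSubmonoid.closure_induction with
  | mem x hx =>
    obtain ⟨r, hr, rfl⟩ := hx
    rcases mem_rays.1 hr with ⟨h1, h2⟩ | ⟨p, hp, q, hq, h1, h2, rfl⟩
    · exact ⟨vec_mem_periodSpan h1, h2⟩
    · rw [vec_vecAdd, vec_vecSMul, vec_vecSMul]
      refine ⟨add_mem (nsmul_mem (vec_mem_periodSpan hp) _)
        (nsmul_mem (vec_mem_periodSpan hq) _), ?_⟩
      simp only [Pi.add_apply, Pi.smul_apply, smul_eq_mul, vec]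
      obtain ⟨m, hm⟩ := Nat.exists_eq_add_of_lt h1
      obtain ⟨n, hn⟩ := Nat.exists_eq_add_of_lt h2
      rw [hm, hn, show ∀ a b : ℕ, a + b + 1 - a = b + 1 by intros; omega,
        show ∀ a b : ℕ, a + b + 1 - a = b + 1 by intros; omega]
      ring
  | zero => simp
  | add x y _ _ hx hy => exact ⟨add_mem hx.1 hy.1, by simp [hx.2, hy.2]⟩

/-- A bound for the number of periods needed in a minimal solution. -/
def solutionBound (p : LinearCode) : ℕ :=
  let M := p.2.foldr (fun q m => q.getD 0 0 + q.getD 1 0 + m) (p.1.getD 0 0 + p.1.getD 1 0)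
  p.2.length * M + (M + p.2.length * M * M)

theorem le_foldr_bound (P : List (List ℕ)) (k : ℕ) :
    k ≤ P.foldr (fun q m => q.getD 0 0 + q.getD 1 0 + m) k ∧
      ∀ q ∈ P, q.getD 0 0 + q.getD 1 0 ≤
        P.foldr (fun q m => q.getD 0 0 + q.getD 1 0 + m) k := by
  induction P with
  | nil => simp
  | cons p P ih =>
    simp only [List.foldr_cons, List.mem_cons, forall_eq_or_imp]
    refine ⟨by omega, by omega, fun q hq => ?_⟩
    have := ih.2 q hq
    omega

/-- Rays contained in the multiset are split off until none is left. In what remains, no period is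
balanced, and periods with surplus and periods with deficit cannot both have large multiplicity, as
otherwise they would form a ray; so `card_le_of_balanced` bounds its size, and its sum with the
constant is a candidate. -/
theorem exists_solution (p : LinearCode) (l : Multiset (List ℕ)) (hl : ∀ q ∈ l, q ∈ p.2)
    (heq : (vec p.1 + (l.map vec).sum) 0 = (vec p.1 + (l.map vec).sum) 1) :
    ∃ x ∈ candidates p.2 (solutionBound p) p.1, x.getD 0 0 = x.getD 1 0 ∧
      ∃ u ∈ periodSpan (rays p.2), vec p.1 + (l.map vec).sum = vec x + u := by
  induction hn : l.card using Nat.strong_induction_on generalizing l with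
  | _ n ih =>
  -- A nonempty part `r` whose sum lies in the span of the rays may be removed: the equation
  -- persists for `m`, and the induction hypothesis applies.
  have key : ∀ m r, l = m + r → r ≠ 0 → (r.map vec).sum ∈ periodSpan (rays p.2) →
      ∃ x ∈ candidates p.2 (solutionBound p) p.1, x.getD 0 0 = x.getD 1 0 ∧
        ∃ u ∈ periodSpan (rays p.2), vec p.1 + (l.map vec).sum = vec x + u := by
    rintro m r rfl hr hspan
    have hr' : 0 < r.card := Multiset.card_pos.2 hr
    have h01 := (periodSpan_rays hspan).2
    obtain ⟨x, hx, hx', u, hu, h⟩ := ih m.card (by simp at hn; omega) m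
      (fun q hq => hl q (by simp [hq])) (by
        simp only [Multiset.map_add, Multiset.sum_add, Pi.add_apply] at heq ⊢
        omega) rfl
    refine ⟨x, hx, hx', u + (r.map vec).sum, add_mem hu hspan, ?_⟩
    rw [Multiset.map_add, Multiset.sum_add, ← add_assoc, h, add_assoc]
  by_cases h0 : ∃ q ∈ l, q.getD 0 0 = q.getD 1 0
  · obtain ⟨q, hq, h⟩ := h0
    obtain ⟨m, rfl⟩ := Multiset.exists_cons_of_mem hq
    refine key m {q} (by rw [add_comm, Multiset.singleton_add]) (by simp) ?_
    simpa using vec_mem_periodSpan (mem_rays.2 (Or.inl ⟨hl q hq, h⟩))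
  push Not at h0
  by_cases h1 : ∃ a ∈ l, ∃ b ∈ l, a.getD 1 0 < a.getD 0 0 ∧ b.getD 0 0 < b.getD 1 0 ∧
      b.getD 1 0 - b.getD 0 0 ≤ l.count a ∧ a.getD 0 0 - a.getD 1 0 ≤ l.count b
  · obtain ⟨a, ha, b, hb, hab, hba, hca, hcb⟩ := h1
    have hne : a ≠ b := by rintro rfl; omega
    have hsub : Multiset.replicate (b.getD 1 0 - b.getD 0 0) a +
        Multiset.replicate (a.getD 0 0 - a.getD 1 0) b ≤ l := by
      rw [Multiset.le_iff_count]
      intro x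
      rw [Multiset.count_add, Multiset.count_replicate, Multiset.count_replicate]
      by_cases hxa : a = x
      · subst hxa
        simpa [hne.symm] using hca
      · by_cases hxb : b = x
        · subst hxb
          simpa [hne] using hcb
        · simp [hxa, hxb]
    obtain ⟨m, hm⟩ := Multiset.le_iff_exists_add.1 hsub
    refine key m _ (by rw [hm, add_comm]) (fun h => ?_) ?_
    · have := congrArg Multiset.card h
      rw [Multiset.card_add, Multiset.card_replicate, Multiset.card_replicate,
        Multiset.card_zero] at this
      omega
    · have := vec_mem_periodSpan (mem_rays.2 (Or.inr ⟨a, hl a ha, b, hl b hb, hab, hba, rfl⟩))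
      rw [vec_vecAdd, vec_vecSMul, vec_vecSMul] at this
      simpa using this
  push Not at h1
  obtain ⟨hb1, hb2⟩ := le_foldr_bound p.2 (p.1.getD 0 0 + p.1.getD 1 0)
  set M := p.2.foldr (fun q m => q.getD 0 0 + q.getD 1 0 + m) (p.1.getD 0 0 + p.1.getD 1 0)
    with hM
  have happ : ∀ i, (vec p.1 + (l.map vec).sum) i =
      p.1.getD i 0 + (l.map fun q => q.getD i 0).sum := by
    intro i
    rw [Pi.add_apply]
    congr 1
    have := map_multiset_sum (Pi.evalAddMonoidHom (fun _ : ℕ => ℕ) i) (l.map vec)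
    simpa [Multiset.map_map, Function.comp_def, vec] using this
  rw [happ, happ] at heq
  have hP : p.2.toFinset.card ≤ p.2.length := List.toFinset_card_le _
  have hcard : l.card ≤ p.2.toFinset.card * M + (M + p.2.toFinset.card * M * M) := by
    -- Either every surplus period has multiplicity at most M, or some `x` exceeds M; in the latter
    -- case, as no ray fits into `l`, every deficit period has multiplicity at most M, and the bound
    -- is used with the two sides exchanged.
    by_cases hp : ∀ x ∈ l, x.getD 1 0 < x.getD 0 0 → l.count x ≤ M
    · exact card_le_of_balanced (a := fun q => q.getD 0 0) (b := fun q => q.getD 1 0)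
        (fun x hx => by simpa using hl x hx) h0 heq
        (fun x hx => by have := hb2 x (by simpa using hx); omega) (by omega) hp
    · push Not at hp
      obtain ⟨x, hx, hx1, hx2⟩ := hp
      refine card_le_of_balanced (a := fun q => q.getD 1 0) (b := fun q => q.getD 0 0)
        (fun x hx => by simpa using hl x hx) (fun y hy => (h0 y hy).symm) heq.symm
        (fun x hx => by have := hb2 x (by simpa using hx); omega) (by omega) ?_
      intro y hy hlt
      have h2 := h1 x hx y hy hx1 hlt
      have h3 := hb2 y (hl y hy)
      have h4 := hb2 x (hl x hx)
      have h5 := h2 (by omega)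
      omega
  have hle : l.card ≤ solutionBound p := by
    refine hcard.trans ?_
    rw [solutionBound, ← hM]
    gcongr
  obtain ⟨x, hx, h⟩ := exists_candidate (c := p.1) hl hle
  refine ⟨x, hx, ?_, 0, zero_mem _, by simp [h]⟩
  have e0 := congrFun h 0
  have e1 := congrFun h 1
  rw [happ] at e0 e1
  simp only [vec] at e0 e1
  omega

/-- Solutions of the equation between the first two coordinates. -/
def solveCode (s : SemilinearCode) : SemilinearCode :=
  s.flatMap fun p => (candidates p.2 (solutionBound p) p.1).flatMap fun c =>
    if c.getD 0 0 = c.getD 1 0 then [(c, rays p.2)] else []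

theorem toSet_solveCode (s : SemilinearCode) :
    (solveCode s).toSet = {v ∈ s.toSet | v 0 = v 1} := by
  ext v
  simp only [mem_toSet, solveCode, List.mem_flatMap, Set.mem_ofPred_eq]
  constructor
  · rintro ⟨_, ⟨p, hp, c, hc, h⟩, hv⟩
    split_ifs at h with h01
    · obtain rfl := List.mem_singleton.1 h
      obtain ⟨u, hu, rfl⟩ := hv
      obtain ⟨w, hw, hcw⟩ := candidates_sound hc
      have := periodSpan_rays hu
      refine ⟨⟨p, hp, w + u, add_mem hw this.1, ?_⟩, ?_⟩
      · dsimp only at *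
        rw [hcw, add_assoc]
      · simp only [Pi.add_apply, this.2, vec, h01]
    · simp at h
  · rintro ⟨⟨p, hp, u, hu, rfl⟩, h01⟩
    obtain ⟨l, hl, rfl⟩ := mem_periodSpan_iff_multiset.1 hu
    obtain ⟨x, hx, hx', w, hw, h⟩ := exists_solution p l hl h01
    exact ⟨(x, rays p.2), ⟨p, hp, x, hx, by rw [if_pos hx']; simp⟩, w, hw, h⟩

/-- Removal of the first `k` coordinates. -/
def dropHom (k : ℕ) : (ℕ → ℕ) →+ (ℕ → ℕ) where
  toFun v := fun i => v (k + i)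
  map_zero' := rfl
  map_add' _ _ := rfl

@[simp] theorem dropHom_apply (k : ℕ) (v : ℕ → ℕ) (i : ℕ) : dropHom k v i = v (k + i) := rfl

theorem vec_drop (k : ℕ) (l : List ℕ) : vec (l.drop k) = dropHom k (vec l) := by
  funext i
  simp [vec, List.getD_eq_getElem?_getD]

/-- Elimination of `k` pairs of coordinates that have to be equal. -/
def eliminate (k : ℕ) (s : SemilinearCode) : SemilinearCode :=
  (fun s => mapCode (List.drop 2) (solveCode s))^[k] s

/-- A solved pair of coordinates is dropped, which moves the next pair to positions 0 and 1, where
`solveCode` works. -/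
theorem toSet_eliminate (k : ℕ) (s : SemilinearCode) :
    (eliminate k s).toSet =
      {v | ∃ u ∈ s.toSet, (∀ j < k, u (2 * j) = u (2 * j + 1)) ∧ v = dropHom (2 * k) u} := by
  induction k generalizing s with
  | zero =>
    ext v
    simp [eliminate, funext_iff]
    constructor
    · intro h; exact ⟨v, h, fun _ => rfl⟩
    · rintro ⟨u, hu, h⟩
      rwa [show v = u from funext h]
  | succ k ih =>
    rw [eliminate, Function.iterate_succ_apply]
    change (eliminate k _).toSet = _
    rw [ih, toSet_mapCode (vec_drop 2), toSet_solveCode]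
    ext v
    simp only [Set.mem_ofPred_eq, Set.mem_image]
    constructor
    · rintro ⟨_, ⟨u, ⟨hu, h01⟩, rfl⟩, h, rfl⟩
      refine ⟨u, hu, fun j hj => ?_, ?_⟩
      · rcases j with _ | j
        · exact h01
        · have := h j (by omega)
          simp only [dropHom_apply] at this
          rw [show 2 * (j + 1) = 2 + 2 * j by ring, this]
          congr 1
      · funext i
        simp only [dropHom_apply]
        congr 1
        ring
    · rintro ⟨u, hu, h, rfl⟩
      refine ⟨_, ⟨u, ⟨hu, h 0 (by omega)⟩, rfl⟩, fun j hj => ?_, ?_⟩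
      · have := h (j + 1) (by omega)
        simp only [dropHom_apply]
        rw [show 2 + 2 * j = 2 * (j + 1) by ring, this]
        congr 1
        ring
      · funext i
        simp only [dropHom_apply]
        congr 1
        ring

/-! ### Computability of the operations on semilinear sets -/

namespace PrimrecComp

variable {α β γ σ : Type*} [Primcodable α] [Primcodable β] [Primcodable γ] [Primcodable σ]

@[fun_prop] theorem vecAdd {f g : α → List ℕ} (hf : Primrec f) (hg : Primrec g) :
    Primrec (fun x => vecAdd (f x) (g x)) := by
  unfold LangFam.vecAdd; fun_prop

@[fun_prop] theorem vecSMul {f : α → ℕ} {g : α → List ℕ} (hf : Primrec f) (hg : Primrec g) :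
    Primrec (fun x => vecSMul (f x) (g x)) := by
  unfold LangFam.vecSMul; fun_prop

@[fun_prop] theorem linAdd {f g : α → LinearCode} (hf : Primrec f) (hg : Primrec g) :
    Primrec (fun x => linAdd (f x) (g x)) := by
  unfold LangFam.linAdd; fun_prop

@[fun_prop] theorem sumCode {f g : α → SemilinearCode} (hf : Primrec f) (hg : Primrec g) :
    Primrec (fun x => sumCode (f x) (g x)) := by
  unfold LangFam.sumCode; fun_prop

@[fun_prop] theorem starCode {f : α → SemilinearCode} (hf : Primrec f) :
    Primrec (fun x => starCode (f x)) := by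
  unfold LangFam.starCode; fun_prop

@[fun_prop] theorem candidates {f : α → List (List ℕ)} {g : α → ℕ} {h : α → List ℕ}
    (hf : Primrec f) (hg : Primrec g) (hh : Primrec h) :
    Primrec (fun x => candidates (f x) (g x) (h x)) := by
  unfold LangFam.candidates; fun_prop

@[fun_prop] theorem rays {f : α → List (List ℕ)} (hf : Primrec f) :
    Primrec (fun x => rays (f x)) := by
  unfold LangFam.rays; fun_prop

@[fun_prop] theorem solutionBound {f : α → LinearCode} (hf : Primrec f) :
    Primrec (fun x => solutionBound (f x)) := by
  unfold LangFam.solutionBound; fun_prop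

@[fun_prop] theorem solveCode {f : α → SemilinearCode} (hf : Primrec f) :
    Primrec (fun x => solveCode (f x)) := by
  unfold LangFam.solveCode; fun_prop

@[fun_prop] theorem mapCode {f : α → SemilinearCode} {g : α → List ℕ → List ℕ} (hf : Primrec f)
    (hg : Primrec (fun p : α × List ℕ => g p.1 p.2)) :
    Primrec (fun x => mapCode (g x) (f x)) := by
  unfold LangFam.mapCode; fun_prop

@[fun_prop] theorem eliminate {f : α → SemilinearCode} {k : α → ℕ} (hf : Primrec f)
    (hk : Primrec k) : Primrec (fun x => eliminate (k x) (f x)) := by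
  unfold LangFam.eliminate; fun_prop

end PrimrecComp

/-! ### Paths of weighted automata -/

namespace WRun

variable {T : WTrans}

theorem append {q r s : ℕ} {w w' : List ℕ} {v v' : ℕ → ℕ} (h : WRun T q w v r)
    (h' : WRun T r w' v' s) : WRun T q (w ++ w') (v + v') s := by
  induction h with
  | nil q => simpa using h'
  | cons ht _ ih =>
    rw [List.append_assoc, add_assoc]
    exact cons ht (ih h')

theorem single {q : ℕ} {a : Option ℕ} {u : List ℕ} {q' : ℕ} (h : (q, a, u, q') ∈ T) :
    WRun T q a.toList (vec u) q' := by
  simpa using cons h (nil q')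

/-- Prefix a path with a `λ`-move. -/
theorem step {q : ℕ} {u : List ℕ} {q' : ℕ} {w : List ℕ} {v : ℕ → ℕ} {r : ℕ}
    (ht : (q, none, u, q') ∈ T) (hr : WRun T q' w v r) : WRun T q w (vec u + v) r :=
  cons ht hr

/-- Prefix a path with a move that reads a letter. -/
theorem read {q a : ℕ} {u : List ℕ} {q' : ℕ} {w : List ℕ} {v : ℕ → ℕ} {r : ℕ}
    (ht : (q, some a, u, q') ∈ T) (hr : WRun T q' w v r) : WRun T q (a :: w) (vec u + v) r :=
  cons ht hr

theorem split {q r : ℕ} {w₁ w₂ : List ℕ} {v : ℕ → ℕ} (h : WRun T q (w₁ ++ w₂) v r) :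
    ∃ s v₁ v₂, WRun T q w₁ v₁ s ∧ WRun T s w₂ v₂ r ∧ v = v₁ + v₂ := by
  generalize hw : w₁ ++ w₂ = w at h
  induction h generalizing w₁ with
  | nil q =>
    obtain ⟨rfl, rfl⟩ := List.append_eq_nil_iff.1 hw
    exact ⟨q, 0, 0, nil q, nil q, by simp⟩
  | @cons q a u q' w v r ht hr ih =>
    rcases a with _ | a
    · obtain ⟨s, v₁, v₂, h1, h2, rfl⟩ := ih hw
      exact ⟨s, vec u + v₁, v₂, step ht h1, h2, by rw [add_assoc]⟩
    · rcases w₁ with _ | ⟨b, w₁⟩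
      · exact ⟨q, 0, vec u + v, nil q, by
          rw [List.nil_append] at hw; subst hw; exact read ht hr, by simp⟩
      · simp only [List.cons_append, Option.toList_some, List.nil_append, List.cons.injEq] at hw
        obtain ⟨rfl, hw⟩ := hw
        obtain ⟨s, v₁, v₂, h1, h2, rfl⟩ := ih hw
        exact ⟨s, vec u + v₁, v₂, read ht h1, h2, by rw [add_assoc]⟩

theorem mem_targets {q r : ℕ} {w : List ℕ} {v : ℕ → ℕ} (h : WRun T q w v r) :
    r = q ∨ r ∈ T.map (fun t => t.2.2.2) := by
  induction h with
  | nil => exact Or.inl rfl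
  | cons ht _ ih =>
    rcases ih with rfl | h
    · exact Or.inr (List.mem_map.2 ⟨_, ht, rfl⟩)
    · exact Or.inr h

end WRun

/-- The start state and the targets of transitions. -/
def states (A : WAut) : List ℕ := A.1 :: A.2.2.map fun t => t.2.2.2

theorem mem_states_of_trans {A : WAut} {q : ℕ} {a : Option ℕ} {u : List ℕ} {q' : ℕ}
    (h : (q, a, u, q') ∈ A.2.2) : q' ∈ states A :=
  List.mem_cons_of_mem _ (List.mem_map.2 ⟨_, h, rfl⟩)

theorem mem_states_of_run {A : WAut} {q r : ℕ} {w : List ℕ} {v : ℕ → ℕ} (hq : q ∈ states A)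
    (h : WRun A.2.2 q w v r) : r ∈ states A := by
  rcases h.mem_targets with rfl | h
  · exact hq
  · exact List.mem_cons_of_mem _ h

/-! ### Homomorphisms -/

/-- The pair of a state and a word as a state. -/
def pairState (q : ℕ) (u : List ℕ) : ℕ := Nat.pair q (Encodable.encode u)

theorem pairState_inj {q q' : ℕ} {u u' : List ℕ} :
    pairState q u = pairState q' u' ↔ q = q' ∧ u = u' := by
  simp [pairState, Nat.pair_eq_pair]

/-- All suffixes of the words in a list. -/
def suffixList (l : List (List ℕ)) : List (List ℕ) :=
  [] :: l.flatMap fun u => (List.range (u.length + 1)).map fun i => u.drop i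

theorem mem_suffixList {l : List (List ℕ)} {u : List ℕ} :
    u ∈ suffixList l ↔ u = [] ∨ ∃ v ∈ l, u <:+ v := by
  simp only [suffixList, List.mem_cons, List.mem_flatMap, List.mem_map, List.mem_range]
  refine or_congr_right (exists_congr fun v => and_congr_right fun _ => ⟨?_, fun h => ?_⟩)
  · rintro ⟨i, _, rfl⟩
    exact List.drop_suffix _ _
  · exact ⟨v.length - u.length, by omega, (List.suffix_iff_eq_drop.1 h).symm⟩

theorem suffixList_tail {l : List (List ℕ)} {x : ℕ} {u : List ℕ}
    (h : x :: u ∈ suffixList l) : u ∈ suffixList l := by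
  rw [mem_suffixList] at h ⊢
  rcases h with h | ⟨v, hv, h⟩
  · simp at h
  · exact Or.inr ⟨v, hv, (List.suffix_cons x u).trans h⟩

/-- The automaton that reads a word over `S` and simulates `A` on its image under `h`. -/
def homAut (S : List ℕ) (h : ℕ → List ℕ) (A : WAut) : WAut :=
  (pairState A.1 [], pairState A.2.1 [],
    ((states A).flatMap fun q => S.map fun a => (pairState q [], some a, [], pairState q (h a))) ++
    A.2.2.flatMap fun t => (suffixList (S.map h)).flatMap fun u =>
      t.2.1.elim [(pairState t.1 u, none, t.2.2.1, pairState t.2.2.2 u)] fun x =>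
        if u.head? = some x then
          [(pairState t.1 u, none, t.2.2.1, pairState t.2.2.2 u.tail)]
        else [])

theorem mem_homAut {S : List ℕ} {h : ℕ → List ℕ} {A : WAut} {e : ℕ × Option ℕ × List ℕ × ℕ} :
    e ∈ (homAut S h A).2.2 ↔
      (∃ q ∈ states A, ∃ a ∈ S, e = (pairState q [], some a, [], pairState q (h a))) ∨
      (∃ q wt q', (q, none, wt, q') ∈ A.2.2 ∧ ∃ u ∈ suffixList (S.map h),
        e = (pairState q u, none, wt, pairState q' u)) ∨
      (∃ q x wt q', (q, some x, wt, q') ∈ A.2.2 ∧ ∃ u, x :: u ∈ suffixList (S.map h) ∧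
        e = (pairState q (x :: u), none, wt, pairState q' u)) := by
  simp only [homAut, List.mem_append, List.mem_flatMap, List.mem_map]
  refine or_congr ⟨?_, ?_⟩ ⟨?_, ?_⟩
  · rintro ⟨q, hq, a, ha, rfl⟩
    exact ⟨q, hq, a, ha, rfl⟩
  · rintro ⟨q, hq, a, ha, rfl⟩
    exact ⟨q, hq, a, ha, rfl⟩
  · rintro ⟨⟨q, a, wt, q'⟩, ht, u, hu, h⟩
    rcases a with _ | x
    · exact Or.inl ⟨q, wt, q', ht, u, hu, by simpa using h⟩
    · simp only [Option.elim_some] at h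
      split_ifs at h with hx
      · rcases u with _ | ⟨y, u⟩
        · simp at hx
        · obtain rfl : y = x := by simpa using hx
          exact Or.inr ⟨q, y, wt, q', ht, u, hu, by simpa using h⟩
      · simp at h
  · rintro (⟨q, wt, q', ht, u, hu, rfl⟩ | ⟨q, x, wt, q', ht, u, hu, rfl⟩)
    · exact ⟨_, ht, u, hu, by simp⟩
    · exact ⟨_, ht, _, hu, by simp⟩

/-- The second component of a state is a buffer: the part of the image of the last letter that `A`
has yet to read. Reading a letter requires an empty buffer, so the label seen by `A` is the buffer
followed by the image of `w`. -/
theorem homAut_sound {S : List ℕ} {h : ℕ → List ℕ} {A : WAut} {p p' : ℕ} {w : List ℕ}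
    {v : ℕ → ℕ} (hr : WRun (homAut S h A).2.2 p w v p') {q : ℕ} {u : List ℕ} {f : ℕ}
    (hp : p = pairState q u) (hp' : p' = pairState f []) :
    WRun A.2.2 q (u ++ w.flatMap h) v f := by
  induction hr generalizing q u with
  | nil =>
    subst hp
    obtain ⟨rfl, rfl⟩ := pairState_inj.1 hp'
    exact WRun.nil _
  | cons ht _ ih =>
    rcases mem_homAut.1 ht with ⟨q₀, _, a, _, he⟩ | ⟨q₀, wt, q', ht', u', hu', he⟩ |
      ⟨q₀, x, wt, q', ht', u', hu', he⟩
    · simp only [Prod.mk.injEq] at he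
      obtain ⟨rfl, rfl, rfl, rfl⟩ := he
      obtain ⟨rfl, rfl⟩ := pairState_inj.1 hp
      simpa using ih rfl hp'
    · simp only [Prod.mk.injEq] at he
      obtain ⟨rfl, rfl, rfl, rfl⟩ := he
      obtain ⟨rfl, rfl⟩ := pairState_inj.1 hp
      exact WRun.step ht' (ih rfl hp')
    · simp only [Prod.mk.injEq] at he
      obtain ⟨rfl, rfl, rfl, rfl⟩ := he
      obtain ⟨rfl, rfl⟩ := pairState_inj.1 hp
      exact WRun.read ht' (ih rfl hp')

/-- The induction follows the path of `A`. Letters with empty image correspond to no move of `A` and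
are read by inner inductions on `w`. -/
theorem homAut_complete {S : List ℕ} {h : ℕ → List ℕ} {A : WAut} {q f : ℕ} {y : List ℕ}
    {v : ℕ → ℕ} (hr : WRun A.2.2 q y v f) {u w : List ℕ} (hq : q ∈ states A)
    (hu : u ∈ suffixList (S.map h)) (hw : ∀ a ∈ w, a ∈ S) (hy : y = u ++ w.flatMap h) :
    WRun (homAut S h A).2.2 (pairState q u) w v (pairState f []) := by
  have hread : ∀ {q : ℕ}, q ∈ states A → ∀ {a r : ℕ} {w : List ℕ} {v : ℕ → ℕ}, a ∈ S →
      WRun (homAut S h A).2.2 (pairState q (h a)) w v r →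
      WRun (homAut S h A).2.2 (pairState q []) (a :: w) v r := by
    intro q hq a r w v ha hrun
    have := WRun.read (mem_homAut.2 (Or.inl ⟨q, hq, a, ha, rfl⟩)) hrun
    simpa using this
  have hmem : ∀ {a : ℕ}, a ∈ S → h a ∈ suffixList (S.map h) := fun ha =>
    mem_suffixList.2 (Or.inr ⟨_, List.mem_map.2 ⟨_, ha, rfl⟩, List.suffix_rfl⟩)
  induction hr generalizing u w with
  | nil q =>
    obtain ⟨rfl, hy'⟩ := List.append_eq_nil_iff.1 hy.symm
    -- The path of `A` is over, so all remaining letters have empty image and are read one by one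
    -- with an empty buffer.
    clear hu hy
    induction w with
    | nil => exact WRun.nil _
    | cons a w ih =>
      rw [List.flatMap_cons, List.append_eq_nil_iff] at hy'
      refine hread hq (hw a (by simp)) ?_
      rw [hy'.1]
      exact ih (fun b hb => hw b (by simp [hb])) hy'.2
  | @cons q a wt q' y v f ht hr ih =>
    rcases a with _ | x
    · exact WRun.step (mem_homAut.2 (Or.inr (Or.inl ⟨_, _, _, ht, u, hu, rfl⟩)))
        (ih (mem_states_of_trans ht) hu hw hy)
    · have hcase : ∀ {u w}, x :: u ∈ suffixList (S.map h) → (∀ a ∈ w, a ∈ S) →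
          y = u ++ w.flatMap h →
          WRun (homAut S h A).2.2 (pairState q (x :: u)) w (vec wt + v) (pairState f []) :=
        fun hu hw hy => WRun.step (mem_homAut.2 (Or.inr (Or.inr ⟨_, _, _, _, ht, _, hu, rfl⟩)))
          (ih (mem_states_of_trans ht) (suffixList_tail hu) hw hy)
      rcases u with _ | ⟨z, u⟩
      · clear hu
        -- The buffer is empty and `A` wants a letter: letters of `w` are read until one has a
        -- nonempty image, whose first letter must be `x`.
        induction w with
        | nil => simp at hy
        | cons a w ihw =>
          refine hread hq (hw a (by simp)) ?_
          have hha := hmem (hw a (by simp))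
          rw [List.flatMap_cons] at hy
          rcases hh : h a with _ | ⟨z, u⟩
          · exact ihw (fun b hb => hw b (by simp [hb])) (by simpa [hh] using hy)
          · rw [hh] at hy hha
            simp only [Option.toList_some, List.nil_append, List.cons_append,
              List.cons.injEq] at hy
            obtain ⟨rfl, hy⟩ := hy
            exact hcase hha (fun b hb => hw b (by simp [hb])) hy
      · simp only [Option.toList_some, List.cons_append, List.nil_append,
          List.cons.injEq] at hy
        obtain ⟨rfl, hy⟩ := hy
        exact hcase hu hw hy

/-- The constructed automaton needs one move per letter of `L`, so an alphabet must be known; this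
is why answers to queries include one. -/
theorem values_homImage {S : List ℕ} {h : ℕ → List ℕ} {A : WAut} {L : Language ℕ}
    (hL : ∀ w ∈ L, ∀ a ∈ w, a ∈ S) : values A (homImage h L) = values (homAut S h A) L := by
  ext v
  constructor
  · rintro ⟨_, ⟨w, hw, rfl⟩, hr⟩
    exact ⟨w, hw, homAut_complete (u := []) hr (by simp [states]) (by simp [suffixList])
      (hL w hw) rfl⟩
  · rintro ⟨w, hw, hr⟩
    exact ⟨_, ⟨w, hw, rfl⟩, homAut_sound (u := []) hr rfl rfl⟩

/-! ### Inverse homomorphisms -/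

/-- The automaton that reads `h`-images of words accepted by `A`. -/
def invHomAut (h : HomCode) (A : WAut) : WAut :=
  (pairState A.1 [], pairState A.2.1 [],
    (A.2.2.flatMap fun t =>
      t.2.1.elim [(pairState t.1 [], none, t.2.2.1, pairState t.2.2.2 [])] fun a =>
        (h.lookup a).elim [] fun u =>
          [(pairState t.1 [], none, t.2.2.1, pairState t.2.2.2 u)]) ++
    (states A).flatMap fun q => (suffixList (h.map fun e => e.2)).flatMap fun u =>
      u.head?.elim [] fun x => [(pairState q u, some x, [], pairState q u.tail)])

theorem mem_invHomAut {h : HomCode} {A : WAut} {e : ℕ × Option ℕ × List ℕ × ℕ} :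
    e ∈ (invHomAut h A).2.2 ↔
      (∃ q wt q', (q, none, wt, q') ∈ A.2.2 ∧
        e = (pairState q [], none, wt, pairState q' [])) ∨
      (∃ q a wt q', (q, some a, wt, q') ∈ A.2.2 ∧ ∃ u, h.lookup a = some u ∧
        e = (pairState q [], none, wt, pairState q' u)) ∨
      (∃ q ∈ states A, ∃ x u, x :: u ∈ suffixList (h.map fun e => e.2) ∧
        e = (pairState q (x :: u), some x, [], pairState q u)) := by
  rw [← or_assoc]
  simp only [invHomAut, List.mem_append, List.mem_flatMap]
  refine or_congr ⟨?_, ?_⟩ ⟨?_, ?_⟩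
  · rintro ⟨⟨q, a, wt, q'⟩, ht, h'⟩
    rcases a with _ | x
    · exact Or.inl ⟨q, wt, q', ht, by simpa using h'⟩
    · simp only [Option.elim_some] at h'
      rcases hu : h.lookup x with _ | u
      · simp [hu] at h'
      · exact Or.inr ⟨q, x, wt, q', ht, u, hu, by simpa [hu] using h'⟩
  · rintro (⟨q, wt, q', ht, rfl⟩ | ⟨q, x, wt, q', ht, u, hu, rfl⟩)
    · exact ⟨_, ht, by simp⟩
    · exact ⟨_, ht, by simp [hu]⟩
  · rintro ⟨q, hq, u, hu, h'⟩
    rcases u with _ | ⟨x, u⟩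
    · simp at h'
    · exact ⟨q, hq, x, u, hu, by simpa using h'⟩
  · rintro ⟨q, hq, x, u, hu, rfl⟩
    exact ⟨q, hq, _, hu, by simp⟩

theorem lookup_eq_some_mem {h : HomCode} {a : ℕ} {u : List ℕ} (hu : h.lookup a = some u) :
    (a, u) ∈ h := by
  induction h with
  | nil => simp at hu
  | cons e h ih =>
    rw [List.lookup_cons] at hu
    split at hu
    · next heq =>
      simp only [Option.some.injEq] at hu
      simp only [beq_iff_eq] at heq
      subst hu heq
      simp
    · exact List.mem_cons_of_mem _ (ih hu)

theorem mem_dom_iff {h : HomCode} {a : ℕ} :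
    a ∈ h.dom ↔ ∃ u, h.lookup a = some u := by
  simp only [HomCode.dom, List.mem_toFinset]
  constructor
  · intro ha
    induction h with
    | nil => simp at ha
    | cons e h ih =>
      rw [List.lookup_cons]
      split
      · exact ⟨_, rfl⟩
      · next heq =>
        simp only [List.map_cons, List.mem_cons] at ha
        rcases ha with rfl | ha
        · simp at heq
        · exact ih ha
  · rintro ⟨u, hu⟩
    exact List.mem_map.2 ⟨_, lookup_eq_some_mem hu, rfl⟩

/-- Here `A` moves first: its letter `a` is read by a λ-move that puts the image of `a` into the
buffer, and the buffer is emptied by reading before `A` moves again. The word `w` is recovered from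
the λ-moves that filled the buffer. -/
theorem invHomAut_sound {h : HomCode} {A : WAut} {p p' : ℕ} {y : List ℕ}
    {v : ℕ → ℕ} (hr : WRun (invHomAut h A).2.2 p y v p') {q : ℕ} {u : List ℕ} {f : ℕ}
    (hp : p = pairState q u) (hp' : p' = pairState f []) :
    ∃ w, (∀ a ∈ w, a ∈ h.dom) ∧ y = u ++ w.flatMap h.fn ∧ WRun A.2.2 q w v f := by
  induction hr generalizing q u with
  | nil =>
    subst hp
    obtain ⟨rfl, rfl⟩ := pairState_inj.1 hp'
    exact ⟨[], by simp, by simp, WRun.nil _⟩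
  | cons ht _ ih =>
    rcases mem_invHomAut.1 ht with ⟨q₀, wt, q', ht', he⟩ | ⟨q₀, a, wt, q', ht', u', hu', he⟩ |
      ⟨q₀, _, x, u', _, he⟩
    · simp only [Prod.mk.injEq] at he
      obtain ⟨rfl, rfl, rfl, rfl⟩ := he
      obtain ⟨rfl, rfl⟩ := pairState_inj.1 hp
      obtain ⟨w, hw, hy, hrun⟩ := ih rfl hp'
      exact ⟨w, hw, by simp [hy], WRun.step ht' hrun⟩
    · simp only [Prod.mk.injEq] at he
      obtain ⟨rfl, rfl, rfl, rfl⟩ := he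
      obtain ⟨rfl, rfl⟩ := pairState_inj.1 hp
      obtain ⟨w, hw, hy, hrun⟩ := ih rfl hp'
      refine ⟨a :: w, ?_, ?_, WRun.read ht' hrun⟩
      · simp only [List.mem_cons, forall_eq_or_imp]
        exact ⟨mem_dom_iff.2 ⟨_, hu'⟩, hw⟩
      · simp [hy, HomCode.fn, hu']
    · simp only [Prod.mk.injEq] at he
      obtain ⟨rfl, rfl, rfl, rfl⟩ := he
      obtain ⟨rfl, rfl⟩ := pairState_inj.1 hp
      obtain ⟨w, hw, hy, hrun⟩ := ih rfl hp'
      exact ⟨w, hw, by simp [hy], by simpa using hrun⟩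

theorem invHomAut_read {h : HomCode} {A : WAut} {q : ℕ} (hq : q ∈ states A) {u : List ℕ}
    (hu : u ∈ suffixList (h.map fun e => e.2)) :
    WRun (invHomAut h A).2.2 (pairState q u) u 0 (pairState q []) := by
  induction u with
  | nil => exact WRun.nil _
  | cons x u ih =>
    have := WRun.read (mem_invHomAut.2 (Or.inr (Or.inr ⟨q, hq, x, u, hu, rfl⟩)))
      (ih (suffixList_tail hu))
    simpa using this

theorem invHomAut_complete {h : HomCode} {A : WAut} {q f : ℕ} {w : List ℕ}
    {v : ℕ → ℕ} (hr : WRun A.2.2 q w v f) (hw : ∀ a ∈ w, a ∈ h.dom) :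
    WRun (invHomAut h A).2.2 (pairState q []) (w.flatMap h.fn) v (pairState f []) := by
  induction hr with
  | nil q => exact WRun.nil _
  | @cons q a wt q' w v f ht hr ih =>
    rcases a with _ | a
    · exact WRun.step (mem_invHomAut.2 (Or.inl ⟨_, _, _, ht, rfl⟩)) (ih hw)
    · simp only [Option.toList_some, List.cons_append, List.nil_append, List.mem_cons,
        forall_eq_or_imp] at hw
      obtain ⟨u, hu⟩ := mem_dom_iff.1 hw.1
      have h1 := invHomAut_read (h := h) (mem_states_of_trans ht) (u := u)
        (mem_suffixList.2 (Or.inr ⟨u, List.mem_map.2 ⟨_, lookup_eq_some_mem hu, rfl⟩,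
          List.suffix_rfl⟩))
      have h2 := WRun.step (mem_invHomAut.2 (Or.inr (Or.inl ⟨_, _, _, _, ht, u, hu, rfl⟩)))
        (h1.append (ih hw.2))
      simpa [HomCode.fn, hu] using h2

theorem values_homPreimage {h : HomCode} {A : WAut} {L : Language ℕ} :
    values A (homPreimage h.dom h.fn L) = values (invHomAut h A) L := by
  ext v
  constructor
  · rintro ⟨w, ⟨hw, hwL⟩, hr⟩
    exact ⟨_, hwL, invHomAut_complete hr hw⟩
  · rintro ⟨y, hy, hr⟩
    obtain ⟨w, hw, rfl, hrun⟩ := invHomAut_sound (u := []) hr rfl rfl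
    exact ⟨w, ⟨hw, by simpa using hy⟩, hrun⟩

/-! ### Intersection with languages of weighted automata -/

/-- The words accepted by `N` with a weight whose first `k` pairs of coordinates are balanced. -/
def balancedLanguage (k : ℕ) (N : WAut) : Language ℕ :=
  {w | ∃ u, WRun N.2.2 N.1 w u N.2.1 ∧ ∀ j < k, u (2 * j) = u (2 * j + 1)}

/-- The first `n` coordinates of `u` followed by those of `v`. -/
def glue (n : ℕ) (u v : ℕ → ℕ) : ℕ → ℕ := fun i => if i < n then u i else v (i - n)

theorem glue_add (n : ℕ) (u v u' v' : ℕ → ℕ) :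
    glue n (u + u') (v + v') = glue n u v + glue n u' v' := by
  funext i
  simp only [glue, Pi.add_apply]
  split_ifs <;> rfl

@[simp] theorem glue_zero (n : ℕ) : glue n 0 0 = 0 := by
  funext i
  simp [glue]

theorem dropHom_glue (n : ℕ) (u v : ℕ → ℕ) : dropHom n (glue n u v) = v := by
  funext i
  simp [glue]

/-- The list of the first `n` coordinates. -/
def padTo (n : ℕ) (u : List ℕ) : List ℕ := (List.range n).map fun i => u.getD i 0

theorem vec_padTo_append (n : ℕ) (u v : List ℕ) :
    vec (padTo n u ++ v) = glue n (vec u) (vec v) := by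
  funext i
  simp only [vec, glue]
  split_ifs with h
  · rw [List.getD_append _ _ _ _ (by simpa [padTo] using h)]
    rw [List.getD_eq_getElem _ _ (by simpa [padTo] using h)]
    simp [padTo]
  · rw [List.getD_append_right _ _ _ _ (by simpa [padTo] using h)]
    simp [padTo]

/-- The product of two weighted automata; weights are juxtaposed. -/
def prodAut (n : ℕ) (N A : WAut) : WAut :=
  (Nat.pair A.1 N.1, Nat.pair A.2.1 N.2.1,
    (A.2.2.flatMap fun t =>
      t.2.1.elim
        ((states N).map fun p =>
          (Nat.pair t.1 p, none, padTo n [] ++ t.2.2.1, Nat.pair t.2.2.2 p))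
        fun a => N.2.2.flatMap fun s => if s.2.1 = some a then
          [(Nat.pair t.1 s.1, some a, padTo n s.2.2.1 ++ t.2.2.1, Nat.pair t.2.2.2 s.2.2.2)]
          else []) ++
    N.2.2.flatMap fun s => s.2.1.elim
      ((states A).map fun q => (Nat.pair q s.1, none, padTo n s.2.2.1 ++ [], Nat.pair q s.2.2.2))
      fun _ => [])

theorem mem_prodAut {n : ℕ} {N A : WAut} {e : ℕ × Option ℕ × List ℕ × ℕ} :
    e ∈ (prodAut n N A).2.2 ↔
      (∃ q wt q', (q, none, wt, q') ∈ A.2.2 ∧ ∃ p ∈ states N,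
        e = (Nat.pair q p, none, padTo n [] ++ wt, Nat.pair q' p)) ∨
      (∃ a q wt q', (q, some a, wt, q') ∈ A.2.2 ∧ ∃ p wt' p', (p, some a, wt', p') ∈ N.2.2 ∧
        e = (Nat.pair q p, some a, padTo n wt' ++ wt, Nat.pair q' p')) ∨
      (∃ p wt p', (p, none, wt, p') ∈ N.2.2 ∧ ∃ q ∈ states A,
        e = (Nat.pair q p, none, padTo n wt ++ [], Nat.pair q p')) := by
  rw [← or_assoc]
  simp only [prodAut, List.mem_append, List.mem_flatMap]
  refine or_congr ⟨?_, ?_⟩ ⟨?_, ?_⟩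
  · rintro ⟨⟨q, a, wt, q'⟩, ht, h'⟩
    rcases a with _ | a
    · simp only [Option.elim_none, List.mem_map] at h'
      obtain ⟨p, hp, rfl⟩ := h'
      exact Or.inl ⟨q, wt, q', ht, p, hp, rfl⟩
    · simp only [Option.elim_some, List.mem_flatMap] at h'
      obtain ⟨⟨p, b, wt', p'⟩, hs, h'⟩ := h'
      split_ifs at h' with hb
      · dsimp only at hb
        subst hb
        exact Or.inr ⟨a, q, wt, q', ht, p, wt', p', hs, by simpa using h'⟩
      · simp at h'
  · rintro (⟨q, wt, q', ht, p, hp, rfl⟩ | ⟨a, q, wt, q', ht, p, wt', p', hs, rfl⟩)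
    · exact ⟨_, ht, List.mem_map.2 ⟨p, hp, rfl⟩⟩
    · exact ⟨_, ht, List.mem_flatMap.2 ⟨_, hs, by simp⟩⟩
  · rintro ⟨⟨p, b, wt, p'⟩, hs, h'⟩
    rcases b with _ | b
    · simp only [Option.elim_none, List.mem_map] at h'
      obtain ⟨q, hq, rfl⟩ := h'
      exact ⟨p, wt, p', hs, q, hq, rfl⟩
    · simp at h'
  · rintro ⟨p, wt, p', hs, q, hq, rfl⟩
    exact ⟨_, hs, List.mem_map.2 ⟨q, hq, rfl⟩⟩

/-- Letters are read jointly and λ-moves are made separately. `glue` cuts the weight of `N` off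
after `n` coordinates, which is harmless because the equations concern only these. -/
theorem prodAut_sound {n : ℕ} {N A : WAut} {r r' : ℕ} {w : List ℕ} {z : ℕ → ℕ}
    (hr : WRun (prodAut n N A).2.2 r w z r') {q p q' p' : ℕ} (h : r = Nat.pair q p)
    (h' : r' = Nat.pair q' p') :
    ∃ u v, WRun A.2.2 q w v q' ∧ WRun N.2.2 p w u p' ∧ z = glue n u v := by
  induction hr generalizing q p with
  | nil =>
    subst h
    obtain ⟨rfl, rfl⟩ := Nat.pair_eq_pair.1 h'
    exact ⟨0, 0, WRun.nil _, WRun.nil _, by simp⟩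
  | cons ht _ ih =>
    rcases mem_prodAut.1 ht with ⟨q₀, wt, q₁, ht', p₀, _, he⟩ |
      ⟨a, q₀, wt, q₁, ht', p₀, wt', p₁, hs, he⟩ | ⟨p₀, wt, p₁, hs, q₀, _, he⟩
    all_goals
      simp only [Prod.mk.injEq] at he
      obtain ⟨rfl, rfl, rfl, rfl⟩ := he
      obtain ⟨rfl, rfl⟩ := Nat.pair_eq_pair.1 h
      obtain ⟨u, v, h1, h2, rfl⟩ := ih rfl h'
      rw [vec_padTo_append]
    · exact ⟨u, vec wt + v, WRun.step ht' h1, h2, by rw [← glue_add]; simp⟩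
    · exact ⟨vec wt' + u, vec wt + v, WRun.read ht' h1, WRun.read hs h2, by rw [← glue_add]⟩
    · exact ⟨vec wt + u, v, h1, WRun.step hs h2, by rw [← glue_add]; simp⟩

/-- The two paths are interleaved by following `A`; the λ-moves of `N` are made when `A` is about to
read a letter or has finished. -/
theorem prodAut_complete {n : ℕ} {N A : WAut} {q q' : ℕ} {w : List ℕ} {v : ℕ → ℕ}
    (hA : WRun A.2.2 q w v q') {p p' : ℕ} {u : ℕ → ℕ} (hN : WRun N.2.2 p w u p')
    (hq : q ∈ states A) (hp : p ∈ states N) :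
    WRun (prodAut n N A).2.2 (Nat.pair q p) w (glue n u v) (Nat.pair q' p') := by
  have hlam : ∀ {q p₀ wt p₁ w u v r}, q ∈ states A → (p₀, none, wt, p₁) ∈ N.2.2 →
      WRun (prodAut n N A).2.2 (Nat.pair q p₁) w (glue n u v) r →
      WRun (prodAut n N A).2.2 (Nat.pair q p₀) w (glue n (vec wt + u) v) r := by
    intro q p₀ wt p₁ w u v r hq hs hrun
    have := WRun.step (mem_prodAut.2 (Or.inr (Or.inr ⟨_, _, _, hs, q, hq, rfl⟩))) hrun
    rw [vec_padTo_append, ← glue_add] at this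
    simpa using this
  induction hA generalizing p u with
  | nil q =>
    generalize hw : ([] : List ℕ) = w at hN
    induction hN with
    | nil => rw [glue_zero]; exact WRun.nil _
    | @cons p a wt p₁ w u p' hs _ ih =>
      rcases a with _ | a
      · exact hlam hq hs (ih (mem_states_of_trans hs) hw)
      · simp at hw
  | @cons q a wt q₁ w v q' ht _ ih =>
    rcases a with _ | a
    · have := WRun.step (mem_prodAut.2 (Or.inl ⟨_, _, _, ht, p, hp, rfl⟩))
        (ih hN (mem_states_of_trans ht) hp)
      rw [vec_padTo_append, ← glue_add] at this
      simpa using this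
    · generalize hw : (some a).toList ++ w = w' at hN
      -- The inner induction makes the λ-moves of `N` up to its next letter, which is the one that
      -- `A` reads.
      induction hN with
      | nil => simp at hw
      | @cons p b wt' p₁ w' u p' hs hN ihN =>
        rcases b with _ | b
        · exact hlam hq hs (ihN ih (mem_states_of_trans hs) hw)
        · simp only [Option.toList_some, List.cons_append, List.nil_append,
            List.cons.injEq] at hw
          obtain ⟨rfl, rfl⟩ := hw
          have := WRun.read (mem_prodAut.2 (Or.inr (Or.inl ⟨_, _, _, _, ht, _, _, _, hs, rfl⟩)))
            (ih hN (mem_states_of_trans ht) (mem_states_of_trans hs))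
          rw [vec_padTo_append, ← glue_add] at this
          exact this

/-- The condition defining the second language becomes k equations between the new coordinates of a
query about `L` alone; this is the reason for considering weights at all. -/
theorem values_inter_balanced {k : ℕ} {N A : WAut} {L : Language ℕ} :
    values A (L ⊓ balancedLanguage k N) =
      {v | ∃ z ∈ values (prodAut (2 * k) N A) L, (∀ j < k, z (2 * j) = z (2 * j + 1)) ∧
        v = dropHom (2 * k) z} := by
  ext v
  constructor
  · rintro ⟨w, ⟨hw, u, hN, hu⟩, hr⟩
    refine ⟨_, ⟨w, hw, prodAut_complete (n := 2 * k) hr hN (by simp [states])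
      (by simp [states])⟩, fun j hj => ?_, by rw [dropHom_glue]⟩
    rw [glue, if_pos (by omega), glue, if_pos (by omega), hu j hj]
  · rintro ⟨z, ⟨w, hw, hr⟩, hz, rfl⟩
    obtain ⟨u, v, h1, h2, rfl⟩ := prodAut_sound hr rfl rfl
    refine ⟨w, ⟨hw, u, h2, fun j hj => ?_⟩, by rwa [dropHom_glue]⟩
    have := hz j hj
    rwa [glue, if_pos (by omega), glue, if_pos (by omega)] at this

/-! ### Union, concatenation and star -/

theorem values_add {A : WAut} {L₁ L₂ : Language ℕ} :
    values A (L₁ + L₂) = values A L₁ ∪ values A L₂ := by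
  ext v
  constructor
  · rintro ⟨w, hw | hw, hr⟩
    exacts [Or.inl ⟨w, hw, hr⟩, Or.inr ⟨w, hw, hr⟩]
  · rintro (⟨w, hw, hr⟩ | ⟨w, hw, hr⟩)
    exacts [⟨w, Or.inl hw, hr⟩, ⟨w, Or.inr hw, hr⟩]

theorem mem_values_mul {s f : ℕ} {T : WTrans} {L₁ L₂ : Language ℕ} {v : ℕ → ℕ} :
    v ∈ values (s, f, T) (L₁ * L₂) ↔ ∃ q ∈ states (s, f, T), ∃ v₁ ∈ values (s, q, T) L₁,
      ∃ v₂ ∈ values (q, f, T) L₂, v = v₁ + v₂ := by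
  constructor
  · rintro ⟨w, hw, hr⟩
    obtain ⟨a, ha, b, hb, rfl⟩ := Language.mem_mul.1 hw
    obtain ⟨q, v₁, v₂, h1, h2, rfl⟩ := WRun.split hr
    exact ⟨q, mem_states_of_run (A := (s, f, T)) (by simp [states]) h1, v₁, ⟨a, ha, h1⟩, v₂,
      ⟨b, hb, h2⟩, rfl⟩
  · rintro ⟨q, _, v₁, ⟨a, ha, h1⟩, v₂, ⟨b, hb, h2⟩, rfl⟩
    exact ⟨_, Language.mem_mul.2 ⟨a, ha, b, hb, rfl⟩, h1.append h2⟩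

theorem zero_mem_values_kstar {q : ℕ} {T : WTrans} {L : Language ℕ} :
    (0 : ℕ → ℕ) ∈ values (q, q, T) (KStar.kstar L) :=
  ⟨[], Language.nil_mem_kstar L, WRun.nil q⟩

theorem values_subset_kstar {A : WAut} {L : Language ℕ} :
    values A L ⊆ values A (KStar.kstar L) := by
  rintro v ⟨w, hw, hr⟩
  exact ⟨w, Language.mem_kstar.2 ⟨[w], by simp, by simpa using hw⟩, hr⟩

theorem values_kstar_add {s q f : ℕ} {T : WTrans} {L : Language ℕ} {u v : ℕ → ℕ}
    (hu : u ∈ values (s, q, T) (KStar.kstar L)) (hv : v ∈ values (q, f, T) (KStar.kstar L)) :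
    u + v ∈ values (s, f, T) (KStar.kstar L) := by
  obtain ⟨a, ha, h1⟩ := hu
  obtain ⟨b, hb, h2⟩ := hv
  obtain ⟨x, rfl, hx⟩ := Language.mem_kstar.1 ha
  obtain ⟨y, rfl, hy⟩ := Language.mem_kstar.1 hb
  refine ⟨_, Language.mem_kstar.2 ⟨x ++ y, rfl, fun z hz => ?_⟩, by
    rw [List.flatten_append]; exact h1.append h2⟩
  rcases List.mem_append.1 hz with h | h
  exacts [hx z h, hy z h]

theorem lambda_mem_values_kstar {q q' : ℕ} {u : List ℕ} {T : WTrans} {L : Language ℕ}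
    (h : (q, none, u, q') ∈ T) : vec u ∈ values (q, q', T) (KStar.kstar L) :=
  ⟨[], Language.nil_mem_kstar L, WRun.single h⟩

/-- Induction from the end of a path: cut it at the borders of the factors of its label. Each factor
contributes a segment with label in `L`, and when no factor is left only λ-moves can remain. -/
theorem values_kstar_induction {s f : ℕ} {T : WTrans} {L : Language ℕ}
    {R : ℕ → (ℕ → ℕ) → Prop} (h0 : R f 0)
    (hlam : ∀ i m u, (i, none, u, m) ∈ T → m ∈ states (s, f, T) → ∀ v, R m v → R i (vec u + v))
    (hstep : ∀ i ∈ states (s, f, T), ∀ m ∈ states (s, f, T), ∀ u ∈ values (i, m, T) L,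
      ∀ v, R m v → R i (u + v))
    {v : ℕ → ℕ} (hv : v ∈ values (s, f, T) (KStar.kstar L)) : R s v := by
  obtain ⟨w, hw, hr⟩ := hv
  obtain ⟨x, rfl, hx⟩ := Language.mem_kstar.1 hw
  have hs : s ∈ states (s, f, T) := by simp [states]
  dsimp only at hr
  clear hw
  -- The current state is detached from `s`, so that the list of states stays fixed during the
  -- induction.
  generalize hq : s = q at hr
  have hqs : q ∈ states (s, f, T) := hq ▸ hs
  clear hq
  induction x generalizing q v with
  | nil =>
    generalize hw : ([] : List (List ℕ)).flatten = w at hr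
    induction hr with
    | nil => exact h0
    | @cons q a u q' w v f ht _ ih =>
      rcases a with _ | a
      · have hq' := mem_states_of_trans (A := (s, f, T)) ht
        exact hlam _ _ _ ht hq' _ (ih h0 hlam hstep hs hq' hw)
      · simp at hw
  | cons a x ih =>
    rw [List.flatten_cons] at hr
    obtain ⟨q', v₁, v₂, h1, h2, rfl⟩ := WRun.split hr
    have hq' := mem_states_of_run (A := (s, f, T)) hqs h1
    exact hstep q hqs q' hq' v₁ ⟨a, hx a (by simp), h1⟩ v₂
      (ih (fun y hy => hx y (by simp [hy])) _ h2 hq')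

/-! ### Recording the end points of paths -/

/-- The automaton whose weights record start and end point of the paths of `A` in two new
coordinates. -/
def endpointAut (A : WAut) : WAut :=
  (0, 1, ((states A).map fun i => (0, none, [i], i + 2)) ++
    ((states A).map fun j => (j + 2, none, [0, j], 1)) ++
    A.2.2.map fun t => (t.1 + 2, t.2.1, 0 :: 0 :: t.2.2.1, t.2.2.2 + 2))

/-- Two coordinates followed by a vector. -/
def consVec (i j : ℕ) (v : ℕ → ℕ) : ℕ → ℕ
  | 0 => i
  | 1 => j
  | n + 2 => v n

theorem vec_cons_cons (i j : ℕ) (l : List ℕ) : vec (i :: j :: l) = consVec i j (vec l) := by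
  funext n
  rcases n with _ | _ | n <;> simp [vec, consVec]

theorem consVec_add (i j i' j' : ℕ) (v v' : ℕ → ℕ) :
    consVec i j v + consVec i' j' v' = consVec (i + i') (j + j') (v + v') := by
  funext n
  rcases n with _ | _ | n <;> rfl

theorem consVec_eta (z : ℕ → ℕ) : consVec (z 0) (z 1) (dropHom 2 z) = z := by
  funext n
  rcases n with _ | _ | n
  · rfl
  · rfl
  · rw [consVec, dropHom_apply, add_comm]

@[simp] theorem dropHom_consVec (i j : ℕ) (v : ℕ → ℕ) : dropHom 2 (consVec i j v) = v := by
  funext n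
  simp [add_comm 2 n, consVec]

theorem vec_singleton (i : ℕ) : vec [i] = consVec i 0 0 := by
  funext n
  rcases n with _ | _ | n <;> simp [vec, consVec]

theorem mem_endpointAut {A : WAut} {e : ℕ × Option ℕ × List ℕ × ℕ} :
    e ∈ (endpointAut A).2.2 ↔ (∃ i ∈ states A, e = (0, none, [i], i + 2)) ∨
      (∃ j ∈ states A, e = (j + 2, none, [0, j], 1)) ∨
      ∃ q a u q', (q, a, u, q') ∈ A.2.2 ∧ e = (q + 2, a, 0 :: 0 :: u, q' + 2) := by
  simp only [endpointAut, List.mem_append, List.mem_map, or_assoc, Prod.exists, eq_comm]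

/-- State 0 guesses the start point, state 1 is the end, and `q + 2` is a copy of `q`; the three
claims treat the three kinds of states together. Coordinate 0 is written on leaving state 0,
coordinate 1 on entering state 1. -/
theorem endpointAut_sound {A : WAut} {p r : ℕ} {w : List ℕ} {z : ℕ → ℕ}
    (h : WRun (endpointAut A).2.2 p w z r) (hr : r = 1) :
    (p = 1 → w = [] ∧ z = 0) ∧
    (∀ q, p = q + 2 → ∃ j ∈ states A, ∃ v, WRun A.2.2 q w v j ∧ z = consVec 0 j v) ∧
    (p = 0 → ∃ i ∈ states A, ∃ j ∈ states A, ∃ v, WRun A.2.2 i w v j ∧ z = consVec i j v) := by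
  induction h with
  | nil => exact ⟨fun _ => ⟨rfl, rfl⟩, fun q h => by omega, fun h => by omega⟩
  | cons ht _ ih =>
    obtain ⟨ih1, ih2, ih3⟩ := ih hr
    rcases mem_endpointAut.1 ht with ⟨i, hi, he⟩ | ⟨j, hj, he⟩ | ⟨q, a, u, q', ht', he⟩
    · simp only [Prod.mk.injEq] at he
      obtain ⟨rfl, rfl, rfl, rfl⟩ := he
      refine ⟨fun h => by omega, fun q h => by omega, fun _ => ?_⟩
      obtain ⟨j, hj, v, hv, rfl⟩ := ih2 i rfl
      refine ⟨i, hi, j, hj, v, hv, ?_⟩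
      rw [vec_singleton, consVec_add]
      simp
    · simp only [Prod.mk.injEq] at he
      obtain ⟨rfl, rfl, rfl, rfl⟩ := he
      refine ⟨fun h => by omega, fun q h => ?_, fun h => by omega⟩
      obtain ⟨rfl, rfl⟩ := ih1 rfl
      obtain rfl : j = q := by omega
      refine ⟨j, hj, 0, WRun.nil _, ?_⟩
      rw [vec_cons_cons]
      simp
    · simp only [Prod.mk.injEq] at he
      obtain ⟨rfl, rfl, rfl, rfl⟩ := he
      refine ⟨fun h => by omega, fun q₀ h => ?_, fun h => by omega⟩
      obtain rfl : q = q₀ := by omega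
      obtain ⟨j, hj, v, hv, rfl⟩ := ih2 q' rfl
      refine ⟨j, hj, _, WRun.cons ht' hv, ?_⟩
      rw [vec_cons_cons, consVec_add]
      simp

theorem endpointAut_complete {A : WAut} {q j : ℕ} {w : List ℕ} {v : ℕ → ℕ}
    (h : WRun A.2.2 q w v j) (hj : j ∈ states A) :
    WRun (endpointAut A).2.2 (q + 2) w (consVec 0 j v) 1 := by
  induction h with
  | nil q =>
    have := WRun.step (mem_endpointAut.2 (Or.inr (Or.inl ⟨q, hj, rfl⟩))) (WRun.nil 1)
    rwa [vec_cons_cons, vec_nil, add_zero] at this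
  | cons ht _ ih =>
    have := WRun.cons (mem_endpointAut.2 (Or.inr (Or.inr ⟨_, _, _, _, ht, rfl⟩))) (ih hj)
    simpa only [vec_cons_cons, consVec_add, zero_add] using this

/-- A single query thus covers all pairs of states, whose number depends on `A`, while a combined
program asks each operand only once. -/
theorem mem_values_endpointAut {A : WAut} {L : Language ℕ} {z : ℕ → ℕ} :
    z ∈ values (endpointAut A) L ↔ z 0 ∈ states A ∧ z 1 ∈ states A ∧
      dropHom 2 z ∈ values (z 0, z 1, A.2.2) L := by
  constructor
  · rintro ⟨w, hw, hr⟩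
    obtain ⟨i, hi, j, hj, v, hv, rfl⟩ := (endpointAut_sound hr rfl).2.2 rfl
    exact ⟨hi, hj, w, hw, by rw [dropHom_consVec]; exact hv⟩
  · rintro ⟨hi, hj, w, hw, hr⟩
    refine ⟨w, hw, ?_⟩
    have := WRun.step (mem_endpointAut.2 (Or.inl ⟨_, hi, rfl⟩)) (endpointAut_complete hr hj)
    rw [vec_singleton, consVec_add, zero_add, zero_add, add_zero, consVec_eta] at this
    exact this

/-- Linear sets of weights of paths between two states. -/
abbrev PathTable := List ((ℕ × ℕ) × LinearCode)

/-- The first two coordinates as end points. -/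
def toPathTable (s : SemilinearCode) : PathTable :=
  s.map fun p => ((p.1.getD 0 0, p.1.getD 1 0), (p.1.drop 2, p.2.map fun q => q.drop 2))

/-- Each linear set in the answer has constant end points: a period that is nonzero in coordinate 0
or 1 could be repeated until the coordinate exceeds every state. Hence the end points can be read
off the constant. -/
theorem toPathTable_sound {s : SemilinearCode} {A : WAut} {L : Language ℕ}
    (h : s.toSet = values (endpointAut A) L) {e : (ℕ × ℕ) × LinearCode} (he : e ∈ toPathTable s)
    {v : ℕ → ℕ} (hv : v ∈ e.2.toSet) :
    e.1.1 ∈ states A ∧ e.1.2 ∈ states A ∧ v ∈ values (e.1.1, e.1.2, A.2.2) L := by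
  obtain ⟨p, hp, rfl⟩ := List.mem_map.1 he
  obtain ⟨_, ⟨u, hu, rfl⟩, rfl⟩ := (mem_toSet_map (vec_drop 2)).1 hv
  have hmem : ∀ n : ℕ, vec p.1 + n • u ∈ values (endpointAut A) L := fun n =>
    h ▸ mem_toSet.2 ⟨p, hp, n • u, nsmul_mem hu n, rfl⟩
  have hle : ∀ x ∈ states A, x ≤ (states A).sum := fun x hx => List.le_sum_of_mem hx
  have hz : ∀ i : ℕ, (∀ n : ℕ, (vec p.1 + n • u) i ∈ states A) → u i = 0 := by
    intro i hi
    by_contra hne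
    -- With this many repetitions the coordinate exceeds the sum of all states, hence each of them.
    have h1 := hle _ (hi ((states A).sum + 1))
    simp only [Pi.add_apply, Pi.smul_apply, smul_eq_mul] at h1
    have h2 : (states A).sum + 1 ≤ ((states A).sum + 1) * u i :=
      Nat.le_mul_of_pos_right _ (Nat.pos_of_ne_zero hne)
    omega
  have h0 := hz 0 fun n => (mem_values_endpointAut.1 (hmem n)).1
  have h1 := hz 1 fun n => (mem_values_endpointAut.1 (hmem n)).2.1
  have := mem_values_endpointAut.1 (hmem 1)
  simp only [Pi.add_apply, one_smul, h0, h1, add_zero] at this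
  exact this

theorem toPathTable_complete {s : SemilinearCode} {A : WAut} {L : Language ℕ}
    (h : s.toSet = values (endpointAut A) L) {i j : ℕ} (hi : i ∈ states A) (hj : j ∈ states A)
    {v : ℕ → ℕ} (hv : v ∈ values (i, j, A.2.2) L) :
    ∃ l, ((i, j), l) ∈ toPathTable s ∧ v ∈ LinearCode.toSet l := by
  have hz : consVec i j v ∈ s.toSet := by
    rw [h, mem_values_endpointAut, dropHom_consVec]
    exact ⟨hi, hj, hv⟩
  obtain ⟨p, hp, hz⟩ := mem_toSet.1 hz
  have hv' := (mem_toSet_map (vec_drop 2)).2 ⟨_, hz, (dropHom_consVec i j v).symm⟩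
  have he : ((p.1.getD 0 0, p.1.getD 1 0), (p.1.drop 2, p.2.map fun q => q.drop 2)) ∈
      toPathTable s := List.mem_map.2 ⟨p, hp, rfl⟩
  have hlin : vec p.1 ∈ values (endpointAut A) L :=
    h ▸ mem_toSet.2 ⟨p, hp, 0, zero_mem _, by simp⟩
  obtain ⟨u, hu, hzu⟩ := hz
  have hall := toPathTable_sound h he hv'
  have hle : ∀ x ∈ states A, x ≤ (states A).sum := fun x hx => List.le_sum_of_mem hx
  have hmem : ∀ n : ℕ, vec p.1 + n • u ∈ values (endpointAut A) L := fun n =>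
    h ▸ mem_toSet.2 ⟨p, hp, n • u, nsmul_mem hu n, rfl⟩
  have hz0 : ∀ i : ℕ, (∀ n : ℕ, (vec p.1 + n • u) i ∈ states A) → u i = 0 := by
    intro i hi
    by_contra hne
    have h1 := hle _ (hi ((states A).sum + 1))
    simp only [Pi.add_apply, Pi.smul_apply, smul_eq_mul] at h1
    have h2 : (states A).sum + 1 ≤ ((states A).sum + 1) * u i :=
      Nat.le_mul_of_pos_right _ (Nat.pos_of_ne_zero hne)
    omega
  have h0 := hz0 0 fun n => (mem_values_endpointAut.1 (hmem n)).1
  have h1 := hz0 1 fun n => (mem_values_endpointAut.1 (hmem n)).2.1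
  have e0 := congrFun hzu 0
  have e1 := congrFun hzu 1
  simp only [Pi.add_apply, h0, h1, add_zero, consVec, vec] at e0 e1
  rw [← e0, ← e1] at he
  exact ⟨_, he, hv'⟩

/-- Weights of paths that are concatenations of two paths. -/
def concatCode (s f : ℕ) (U V : PathTable) : SemilinearCode :=
  U.flatMap fun e => if e.1.1 = s then
    V.flatMap fun e' => if e.1.2 = e'.1.1 then if e'.1.2 = f then [linAdd e.2 e'.2] else []
      else []
    else []

theorem mem_concatCode {s f : ℕ} {U V : PathTable} {l : LinearCode} :
    l ∈ concatCode s f U V ↔ ∃ q l₁ l₂, ((s, q), l₁) ∈ U ∧ ((q, f), l₂) ∈ V ∧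
      l = linAdd l₁ l₂ := by
  simp only [concatCode, List.mem_flatMap]
  constructor
  · rintro ⟨⟨⟨i, j⟩, l₁⟩, h1, h⟩
    split_ifs at h with hi
    · obtain ⟨⟨⟨i', j'⟩, l₂⟩, h2, h'⟩ := List.mem_flatMap.1 h
      split_ifs at h' with hj hk
      · dsimp only at hi hj hk
        subst hi hj hk
        exact ⟨j, l₁, l₂, h1, h2, by simpa using h'⟩
      · simp at h'
      · simp at h'
    · simp at h
  · rintro ⟨q, l₁, l₂, h1, h2, rfl⟩
    refine ⟨_, h1, ?_⟩
    rw [if_pos rfl]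
    exact List.mem_flatMap.2 ⟨_, h2, by simp⟩

theorem toSet_concatCode {A : WAut} {L₁ L₂ : Language ℕ} {s t : SemilinearCode}
    (hs : s.toSet = values (endpointAut A) L₁) (ht : t.toSet = values (endpointAut A) L₂) :
    (concatCode A.1 A.2.1 (toPathTable s) (toPathTable t)).toSet = values A (L₁ * L₂) := by
  ext v
  rw [mem_toSet, mem_values_mul (s := A.1) (f := A.2.1)]
  constructor
  · rintro ⟨_, hl, hv⟩
    obtain ⟨q, l₁, l₂, h1, h2, rfl⟩ := mem_concatCode.1 hl
    obtain ⟨x, hx, y, hy, rfl⟩ := mem_linAdd.1 hv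
    have h1' := toPathTable_sound hs h1 hx
    have h2' := toPathTable_sound ht h2 hy
    exact ⟨q, h1'.2.1, x, h1'.2.2, y, h2'.2.2, rfl⟩
  · rintro ⟨q, hq, x, hx, y, hy, rfl⟩
    have hf : A.2.1 ∈ states A := by
      obtain ⟨w, _, hr⟩ := hy
      exact mem_states_of_run hq hr
    obtain ⟨l₁, h1, h1'⟩ := toPathTable_complete hs (by simp [states]) hq hx
    obtain ⟨l₂, h2, h2'⟩ := toPathTable_complete ht hq hf hy
    exact ⟨_, mem_concatCode.2 ⟨q, l₁, l₂, h1, h2, rfl⟩, mem_linAdd.2 ⟨x, h1', y, h2', rfl⟩⟩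

/-! ### State elimination -/

/-- The entries between two given states. -/
def tableEntry (U : PathTable) (i j : ℕ) : SemilinearCode :=
  U.flatMap fun e => if e.1 = (i, j) then [e.2] else []

theorem mem_tableEntry {U : PathTable} {i j : ℕ} {l : LinearCode} :
    l ∈ tableEntry U i j ↔ ((i, j), l) ∈ U := by
  simp only [tableEntry, List.mem_flatMap]
  constructor
  · rintro ⟨⟨p, l'⟩, h, h'⟩
    split_ifs at h' with hp
    · dsimp only at hp
      subst hp
      obtain rfl := List.mem_singleton.1 h'
      exact h
    · simp at h'
  · exact fun h => ⟨_, h, by simp⟩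

/-- Adds the paths that pass through the state `k`. -/
def eliminateState (U : PathTable) (k : ℕ) : PathTable :=
  U ++ U.flatMap fun e => if e.1.2 = k then
    U.flatMap fun e' => if e'.1.1 = k then
      (starCode (tableEntry U k k)).map fun l => ((e.1.1, e'.1.2), linAdd (linAdd e.2 l) e'.2)
      else []
    else []

theorem mem_eliminateState {U : PathTable} {k i j : ℕ} {l : LinearCode} :
    ((i, j), l) ∈ eliminateState U k ↔ ((i, j), l) ∈ U ∨
      ∃ l₁ l₂ l₃, ((i, k), l₁) ∈ U ∧ l₂ ∈ starCode (tableEntry U k k) ∧ ((k, j), l₃) ∈ U ∧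
        l = linAdd (linAdd l₁ l₂) l₃ := by
  simp only [eliminateState, List.mem_append, List.mem_flatMap]
  refine or_congr_right ⟨?_, ?_⟩
  · rintro ⟨⟨⟨i₁, j₁⟩, l₁⟩, h1, h⟩
    split_ifs at h with hk
    · obtain ⟨⟨⟨i₃, j₃⟩, l₃⟩, h3, h'⟩ := List.mem_flatMap.1 h
      split_ifs at h' with hk'
      · obtain ⟨l₂, h2, he⟩ := List.mem_map.1 h'
        dsimp only at hk hk'
        subst hk hk'
        simp only [Prod.mk.injEq] at he
        obtain ⟨⟨rfl, rfl⟩, rfl⟩ := he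
        exact ⟨l₁, l₂, l₃, h1, h2, h3, rfl⟩
      · simp at h'
    · simp at h
  · rintro ⟨l₁, l₂, l₃, h1, h2, h3, rfl⟩
    refine ⟨_, h1, ?_⟩
    rw [if_pos rfl]
    refine List.mem_flatMap.2 ⟨_, h3, ?_⟩
    rw [if_pos rfl]
    exact List.mem_map.2 ⟨l₂, h2, rfl⟩

/-- The weights of the paths from `i` to `j` in a table. -/
def tableSet (U : PathTable) (i j : ℕ) : Set (ℕ → ℕ) := (tableEntry U i j).toSet

theorem mem_tableSet {U : PathTable} {i j : ℕ} {v : ℕ → ℕ} :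
    v ∈ tableSet U i j ↔ ∃ l, ((i, j), l) ∈ U ∧ v ∈ LinearCode.toSet l := by
  simp only [tableSet, mem_toSet, mem_tableEntry]

theorem mem_tableSet_eliminateState {U : PathTable} {k i j : ℕ} {v : ℕ → ℕ} :
    v ∈ tableSet (eliminateState U k) i j ↔ v ∈ tableSet U i j ∨
      ∃ a ∈ tableSet U i k, ∃ b ∈ AddSubmonoid.closure (tableSet U k k),
        ∃ c ∈ tableSet U k j, v = a + b + c := by
  have hstar : ∀ b, b ∈ AddSubmonoid.closure (tableSet U k k) ↔
      ∃ l ∈ starCode (tableEntry U k k), b ∈ LinearCode.toSet l := by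
    intro b
    rw [← mem_toSet, toSet_starCode]
    rfl
  simp only [mem_tableSet, mem_eliminateState, hstar]
  constructor
  · rintro ⟨l, h | ⟨l₁, l₂, l₃, h1, h2, h3, rfl⟩, hv⟩
    · exact Or.inl ⟨l, h, hv⟩
    · obtain ⟨x, hx, c, hc, rfl⟩ := mem_linAdd.1 hv
      obtain ⟨a, ha, b, hb, rfl⟩ := mem_linAdd.1 hx
      exact Or.inr ⟨a, ⟨l₁, h1, ha⟩, b, ⟨l₂, h2, hb⟩, c, ⟨l₃, h3, hc⟩, rfl⟩
  · rintro (⟨l, h, hv⟩ | ⟨a, ⟨l₁, h1, ha⟩, b, ⟨l₂, h2, hb⟩, c, ⟨l₃, h3, hc⟩, rfl⟩)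
    · exact ⟨l, Or.inl h, hv⟩
    · exact ⟨_, Or.inr ⟨l₁, l₂, l₃, h1, h2, h3, rfl⟩, mem_linAdd.2
        ⟨_, mem_linAdd.2 ⟨a, ha, b, hb, rfl⟩, c, hc, rfl⟩⟩

/-- Adds the paths that pass through the states in `Q`. -/
def closeTable (Q : List ℕ) (U : PathTable) : PathTable :=
  Q.foldl (fun U k => eliminateState U k) U

/-- No notion of a path in the table is needed: any family of sets closed under composition that
contains the table contains its closure. -/
theorem closeTable_sound {R : ℕ → ℕ → Set (ℕ → ℕ)} (h0 : ∀ i, 0 ∈ R i i)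
    (hadd : ∀ i j k, ∀ u ∈ R i j, ∀ v ∈ R j k, u + v ∈ R i k) {Q : List ℕ} {U : PathTable}
    (hU : ∀ i j, tableSet U i j ⊆ R i j) (i j : ℕ) : tableSet (closeTable Q U) i j ⊆ R i j := by
  induction Q generalizing U with
  | nil => exact hU i j
  | cons k Q ih =>
    refine ih fun i j v hv => ?_
    rcases mem_tableSet_eliminateState.1 hv with hv | ⟨a, ha, b, hb, c, hc, rfl⟩
    · exact hU i j hv
    · refine hadd i k j _ (hadd i k k _ (hU _ _ ha) _ ?_) _ (hU _ _ hc)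
      clear hv
      induction hb using AddSubmonoid.closure_induction with
      | mem x hx => exact hU _ _ hx
      | zero => exact h0 k
      | add x y _ _ hx hy => exact hadd k k k _ hx _ hy

theorem closeTable_mono {Q : List ℕ} {U : PathTable} (i j : ℕ) :
    tableSet U i j ⊆ tableSet (closeTable Q U) i j := by
  induction Q generalizing U with
  | nil => exact subset_rfl
  | cons k Q ih => exact fun v hv => ih (mem_tableSet_eliminateState.2 (Or.inl hv))

/-- Eliminating k makes composition at k possible and keeps it possible at every m where it already
was. For m = k, the adjoining parts are absorbed by the loops at k; for other m, two detours through
k that meet in m yield, where they meet, one more loop at k. -/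
theorem eliminateState_transitive {U : PathTable} {k m : ℕ}
    (h : m = k ∨ ∀ i j, ∀ u ∈ tableSet U i m, ∀ v ∈ tableSet U m j, u + v ∈ tableSet U i j)
    {i j : ℕ} {u v : ℕ → ℕ} (hu : u ∈ tableSet (eliminateState U k) i m)
    (hv : v ∈ tableSet (eliminateState U k) m j) :
    u + v ∈ tableSet (eliminateState U k) i j := by
  rw [mem_tableSet_eliminateState] at hu hv ⊢
  have hcl : ∀ {x}, x ∈ tableSet U k k → x ∈ AddSubmonoid.closure (tableSet U k k) :=
    fun h => AddSubmonoid.subset_closure h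
  rcases h with rfl | h
  · have hu' : ∃ a ∈ tableSet U i m, ∃ b ∈ AddSubmonoid.closure (tableSet U m m), u = a + b := by
      rcases hu with hu | ⟨a, ha, b, hb, c, hc, rfl⟩
      · exact ⟨u, hu, 0, zero_mem _, by simp⟩
      · exact ⟨a, ha, b + c, add_mem hb (hcl hc), by abel⟩
    have hv' : ∃ b ∈ AddSubmonoid.closure (tableSet U m m), ∃ c ∈ tableSet U m j, v = b + c := by
      rcases hv with hv | ⟨a, ha, b, hb, c, hc, rfl⟩
      · exact ⟨0, zero_mem _, v, hv, by simp⟩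
      · exact ⟨a + b, add_mem (hcl ha) hb, c, hc, by abel⟩
    obtain ⟨a, ha, b, hb, rfl⟩ := hu'
    obtain ⟨b', hb', c, hc, rfl⟩ := hv'
    exact Or.inr ⟨a, ha, b + b', add_mem hb hb', c, hc, by abel⟩
  · rcases hu with hu | ⟨a, ha, b, hb, c, hc, rfl⟩ <;>
      rcases hv with hv | ⟨a', ha', b', hb', c', hc', rfl⟩
    · exact Or.inl (h i j u hu v hv)
    · exact Or.inr ⟨u + a', h _ _ _ hu _ ha', b', hb', c', hc', by abel⟩
    · exact Or.inr ⟨a, ha, b, hb, c + v, h _ _ _ hc _ hv, by abel⟩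
    · exact Or.inr ⟨a, ha, b + (c + a') + b',
        add_mem (add_mem hb (hcl (h _ _ _ hc _ ha'))) hb', c', hc', by abel⟩

/-- Composition at m becomes possible when m is eliminated and stays so afterwards. This is all that
completeness requires of the closure. -/
theorem closeTable_transitive {Q : List ℕ} {U : PathTable} {m : ℕ}
    (h : m ∈ Q ∨ ∀ i j, ∀ u ∈ tableSet U i m, ∀ v ∈ tableSet U m j, u + v ∈ tableSet U i j)
    {i j : ℕ} {u v : ℕ → ℕ} (hu : u ∈ tableSet (closeTable Q U) i m)
    (hv : v ∈ tableSet (closeTable Q U) m j) : u + v ∈ tableSet (closeTable Q U) i j := by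
  induction Q generalizing U with
  | nil =>
    rcases h with h | h
    · simp at h
    · exact h i j u hu v hv
  | cons k Q ih =>
    refine ih ?_ hu hv
    by_cases hm : m ∈ Q
    · exact Or.inl hm
    · refine Or.inr fun i j u hu v hv => eliminateState_transitive ?_ hu hv
      exact h.imp_left fun h => by simpa [hm] using h

/-- The `λ`-moves of an automaton. -/
def lambdaTable (T : WTrans) : PathTable :=
  T.flatMap fun t => t.2.1.elim [((t.1, t.2.2.2), (t.2.2.1, []))] fun _ => []

theorem mem_lambdaTable {T : WTrans} {i j : ℕ} {l : LinearCode} :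
    ((i, j), l) ∈ lambdaTable T ↔ ∃ u, (i, none, u, j) ∈ T ∧ l = (u, []) := by
  simp only [lambdaTable, List.mem_flatMap]
  constructor
  · rintro ⟨⟨q, a, u, q'⟩, ht, h⟩
    rcases a with _ | a
    · simp only [Option.elim_none, List.mem_singleton, Prod.mk.injEq] at h
      obtain ⟨⟨rfl, rfl⟩, rfl⟩ := h
      exact ⟨u, ht, rfl⟩
    · simp at h
  · rintro ⟨u, ht, rfl⟩
    exact ⟨_, ht, by simp⟩

/-- Weights of paths whose label is a concatenation of labels of paths in the table. -/
def kstarCode (A : WAut) (s : SemilinearCode) : SemilinearCode :=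
  (if A.1 = A.2.1 then [([], [])] else []) ++
    tableEntry (closeTable (states A) (toPathTable s ++ lambdaTable A.2.2)) A.1 A.2.1

/-- The table of single factors is supplemented by the λ-moves of `A`, which paths may make when no
factor is left. The closure composes nonempty sequences of entries, so the empty path is added
separately when start and end coincide. -/
theorem toSet_kstarCode {A : WAut} {L : Language ℕ} {s : SemilinearCode}
    (hs : s.toSet = values (endpointAut A) L) :
    (kstarCode A s).toSet = values A (KStar.kstar L) := by
  obtain ⟨q₀, f, T⟩ := A
  have h1 : (SemilinearCode.toSet (if q₀ = f then [([], [])] else [])) =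
      {v | q₀ = f ∧ v = 0} := by
    ext v
    split_ifs with h
    · simp [mem_toSet, LinearCode.toSet, h]
    · simp [h]
  rw [kstarCode, toSet_append]
  dsimp only
  rw [h1]
  set U := toPathTable s ++ lambdaTable T with hU
  ext v
  constructor
  · rintro (⟨rfl, rfl⟩ | hv)
    · exact zero_mem_values_kstar
    · refine closeTable_sound (R := fun i j => values (i, j, T) (KStar.kstar L))
        (fun i => zero_mem_values_kstar) (fun i j k u hu v hv => values_kstar_add hu hv)
        (fun i j v hv => ?_) _ _ hv
      obtain ⟨l, hl, hv⟩ := mem_tableSet.1 hv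
      rcases List.mem_append.1 hl with hl | hl
      · exact values_subset_kstar (toPathTable_sound hs hl hv).2.2
      · obtain ⟨u, hu, rfl⟩ := mem_lambdaTable.1 hl
        obtain ⟨x, hx, rfl⟩ := hv
        rw [periodSpan_nil, AddSubmonoid.mem_bot] at hx
        rw [hx, add_zero]
        exact lambda_mem_values_kstar hu
  · intro hv
    set W := closeTable (states (q₀, f, T)) U with hW
    -- The invariant lists the empty path separately, since the closed table need not contain 0
    -- between `f` and itself.
    refine values_kstar_induction (R := fun i v => (i = f ∧ v = 0) ∨ v ∈ tableSet W i f)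
      (Or.inl ⟨rfl, rfl⟩) ?_ ?_ hv
    · rintro i m u hu hm v (⟨rfl, rfl⟩ | hv)
      all_goals
        have hu' : vec u ∈ tableSet W i m := closeTable_mono _ _ (mem_tableSet.2
          ⟨(u, []), List.mem_append_right _ (mem_lambdaTable.2 ⟨u, hu, rfl⟩),
            0, zero_mem _, by simp⟩)
      · exact Or.inr (by simpa using hu')
      · exact Or.inr (closeTable_transitive (Or.inl hm) hu' hv)
    · rintro i hi m hm u hu v (⟨rfl, rfl⟩ | hv)
      all_goals
        obtain ⟨l, hl, hul⟩ := toPathTable_complete hs hi hm hu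
        have hu' : u ∈ tableSet W i _ := closeTable_mono _ _ (mem_tableSet.2
          ⟨l, List.mem_append_left _ hl, hul⟩)
      · exact Or.inr (by simpa using hu')
      · exact Or.inr (closeTable_transitive (Or.inl hm) hu' hv)

/-! ### Programs for the operations -/

namespace PrimrecComp

variable {α β γ σ : Type*} [Primcodable α] [Primcodable β] [Primcodable γ] [Primcodable σ]

@[fun_prop] theorem states {f : α → WAut} (hf : Primrec f) : Primrec (fun x => states (f x)) := by
  unfold LangFam.states; fun_prop

@[fun_prop] theorem suffixList {f : α → List (List ℕ)} (hf : Primrec f) :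
    Primrec (fun x => suffixList (f x)) := by
  unfold LangFam.suffixList; fun_prop

@[fun_prop] theorem pairState {f : α → ℕ} {g : α → List ℕ} (hf : Primrec f) (hg : Primrec g) :
    Primrec (fun x => pairState (f x) (g x)) := by
  unfold LangFam.pairState; fun_prop

@[fun_prop] theorem homFn {f : α → HomCode} {g : α → ℕ} (hf : Primrec f) (hg : Primrec g) :
    Primrec (fun x => (f x).fn (g x)) := by
  unfold HomCode.fn; fun_prop

@[fun_prop] theorem homAut {f : α → List ℕ} {g : α → ℕ → List ℕ} {h : α → WAut}
    (hf : Primrec f) (hg : Primrec (fun p : α × ℕ => g p.1 p.2)) (hh : Primrec h) :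
    Primrec (fun x => homAut (f x) (g x) (h x)) := by
  unfold LangFam.homAut; fun_prop

@[fun_prop] theorem invHomAut {g : α → HomCode} {h : α → WAut}
    (hg : Primrec g) (hh : Primrec h) : Primrec (fun x => invHomAut (g x) (h x)) := by
  unfold LangFam.invHomAut; fun_prop

@[fun_prop] theorem padTo {f : α → ℕ} {g : α → List ℕ} (hf : Primrec f) (hg : Primrec g) :
    Primrec (fun x => padTo (f x) (g x)) := by
  unfold LangFam.padTo; fun_prop

@[fun_prop] theorem prodAut {f : α → ℕ} {g h : α → WAut}
    (hf : Primrec f) (hg : Primrec g) (hh : Primrec h) :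
    Primrec (fun x => prodAut (f x) (g x) (h x)) := by
  unfold LangFam.prodAut; fun_prop

@[fun_prop] theorem endpointAut {h : α → WAut} (hh : Primrec h) :
    Primrec (fun x => endpointAut (h x)) := by
  unfold LangFam.endpointAut; fun_prop

@[fun_prop] theorem toPathTable {h : α → SemilinearCode} (hh : Primrec h) :
    Primrec (fun x => toPathTable (h x)) := by
  unfold LangFam.toPathTable; fun_prop

@[fun_prop] theorem concatCode {f g : α → ℕ} {h k : α → PathTable} (hf : Primrec f)
    (hg : Primrec g) (hh : Primrec h) (hk : Primrec k) :
    Primrec (fun x => concatCode (f x) (g x) (h x) (k x)) := by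
  unfold LangFam.concatCode; fun_prop

@[fun_prop] theorem tableEntry {f g : α → ℕ} {h : α → PathTable} (hf : Primrec f)
    (hg : Primrec g) (hh : Primrec h) :
    Primrec (fun x => tableEntry (h x) (f x) (g x)) := by
  unfold LangFam.tableEntry; fun_prop

@[fun_prop] theorem eliminateState {f : α → ℕ} {h : α → PathTable} (hf : Primrec f)
    (hh : Primrec h) : Primrec (fun x => eliminateState (h x) (f x)) := by
  unfold LangFam.eliminateState; fun_prop

@[fun_prop] theorem closeTable {f : α → List ℕ} {h : α → PathTable} (hf : Primrec f)
    (hh : Primrec h) : Primrec (fun x => closeTable (f x) (h x)) := by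
  unfold LangFam.closeTable; fun_prop

@[fun_prop] theorem lambdaTable {h : α → WTrans} (hh : Primrec h) :
    Primrec (fun x => lambdaTable (h x)) := by
  unfold LangFam.lambdaTable; fun_prop

@[fun_prop] theorem kstarCode {f : α → WAut} {h : α → SemilinearCode} (hf : Primrec f)
    (hh : Primrec h) : Primrec (fun x => kstarCode (f x) (h x)) := by
  unfold LangFam.kstarCode; fun_prop

end PrimrecComp

theorem AsksTwo.mem {δ : Type*} {pre₁ : δ × WAut → WAut}
    {pre₂ : (δ × WAut) × Answer → WAut} {post : ((δ × WAut) × Answer) × Answer → Answer}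
    {G : δ × Code × Code → Code} (hG : AsksTwo pre₁ pre₂ post G) {x : δ} {c₁ c₂ : Code}
    {A : WAut} {r₁ r₂ : Answer}
    (h₁ : r₁ ∈ query c₁ (pre₁ (x, A))) (h₂ : r₂ ∈ query c₂ (pre₂ ((x, A), r₁))) :
    post (((x, A), r₁), r₂) ∈ query (G (x, c₁, c₂)) A := by
  rw [hG]
  exact Part.mem_bind h₁ (Part.mem_map (fun r => post (((x, A), r₁), r)) h₂)

/-- The weights of `A` have length at most `d`. -/
def WAut.HasDim (A : WAut) (d : ℕ) : Prop := ∀ t ∈ A.2.2, t.2.2.1.length ≤ d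

/-- Growth of dimension is tracked because, without effective inverse homomorphisms, the program for
a language of the original family is chosen for a given dimension. -/
theorem WAut.HasDim.homAut {A : WAut} {d : ℕ} (h : A.HasDim d) (S : List ℕ) (f : ℕ → List ℕ) :
    (homAut S f A).HasDim d := by
  intro t hmem
  rcases mem_homAut.1 hmem with ⟨q, _, a, _, rfl⟩ | ⟨q, wt, q', ht, u, _, rfl⟩ |
    ⟨q, x, wt, q', ht, u, _, rfl⟩
  exacts [Nat.zero_le _, h (q, _, wt, q') ht, h (q, _, wt, q') ht]

theorem WAut.HasDim.invHomAut {A : WAut} {d : ℕ} (h : A.HasDim d) (f : HomCode) :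
    (invHomAut f A).HasDim d := by
  intro t hmem
  rcases mem_invHomAut.1 hmem with ⟨q, wt, q', ht, rfl⟩ | ⟨q, a, wt, q', ht, u, _, rfl⟩ |
    ⟨q, _, x, u, _, rfl⟩
  exacts [h (q, _, wt, q') ht, h (q, _, wt, q') ht, Nat.zero_le _]

theorem WAut.HasDim.prodAut {A : WAut} {d : ℕ} (h : A.HasDim d) (n : ℕ) (N : WAut) :
    (prodAut n N A).HasDim (d + n) := by
  intro t hmem
  rcases mem_prodAut.1 hmem with ⟨q, wt, q', ht, p, _, rfl⟩ |
    ⟨a, q, wt, q', ht, p, wt', p', _, rfl⟩ | ⟨p, wt, p', _, q, _, rfl⟩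
  · have := h _ ht
    simp only [List.length_append, padTo, List.length_map, List.length_range] at this ⊢
    omega
  · have := h _ ht
    simp only [List.length_append, padTo, List.length_map, List.length_range] at this ⊢
    omega
  · simp [padTo]

theorem WAut.HasDim.endpointAut {A : WAut} {d : ℕ} (h : A.HasDim d) :
    (endpointAut A).HasDim (d + 2) := by
  intro t hmem
  rcases mem_endpointAut.1 hmem with ⟨i, _, rfl⟩ | ⟨j, _, rfl⟩ | ⟨q, a, u, q', ht, rfl⟩
  · simp
  · simp
  · simpa using h _ ht

/-- The first query serves only to learn the alphabet, from which the second query is built. -/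
theorem exists_hom_code : ∃ G : HomCode × Code → Code, Primrec G ∧
    ∀ h c L d, Represents L d c → Represents (homImage h.fn L) d (G (h, c)) := by
  obtain ⟨G, hG, hq⟩ := exists_code_two (δ := HomCode) (pre₁ := fun p => (p.2.1, p.2.2))
    (pre₂ := fun p => homAut p.2.1 (fun a => p.1.1.fn a) p.1.2)
    (post := fun p => (p.1.2.1.flatMap fun a => p.1.1.1.fn a, p.2.2))
    (by fun_prop) (by fun_prop) (by fun_prop)
  refine ⟨fun p => G (p.1, p.2, p.2), by fun_prop, fun h c L d hc A hA => ?_⟩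
  obtain ⟨r₁, h₁, hS, -⟩ := hc A hA
  obtain ⟨r₂, h₂, -, h₂'⟩ := hc (homAut r₁.1 (fun a => h.fn a) A) (WAut.HasDim.homAut hA _ _)
  refine ⟨_, hq.mem h₁ h₂, ?_, ?_⟩
  · rintro _ ⟨w, hw, rfl⟩ a ha
    obtain ⟨b, hb, ha⟩ := List.mem_flatMap.1 ha
    exact List.mem_flatMap.2 ⟨b, hS w hw b hb, ha⟩
  · rw [values_homImage hS]
    exact h₂'

theorem exists_invHom_code : ∃ G : HomCode × Code → Code, Primrec G ∧
    ∀ h c L d, Represents L d c → Represents (homPreimage h.dom h.fn L) d (G (h, c)) := by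
  -- One query is enough here; it is asked twice to fit the scheme for two programs.
  obtain ⟨G, hG, hq⟩ := exists_code_two (δ := HomCode) (pre₁ := fun p => invHomAut p.1 p.2)
    (pre₂ := fun p => invHomAut p.1.1 p.1.2)
    (post := fun p => (p.1.1.1.map fun e => e.1, p.2.2))
    (by fun_prop) (by fun_prop) (by fun_prop)
  refine ⟨fun p => G (p.1, p.2, p.2), by fun_prop, fun h c L d hc A hA => ?_⟩
  obtain ⟨r, hr, -, hr'⟩ := hc (invHomAut h A) (WAut.HasDim.invHomAut hA _)
  refine ⟨_, hq.mem hr hr, ?_, ?_⟩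
  · rintro w ⟨hw, -⟩ a ha
    have := hw a ha
    rwa [HomCode.dom, List.mem_toFinset] at this
  · rw [values_homPreimage]
    exact hr'

theorem exists_balanced_code : ∃ G : (ℕ × WAut) × Code → Code, Primrec G ∧
    ∀ k N c L d, Represents L (d + 2 * k) c →
      Represents (L ⊓ balancedLanguage k N) d (G ((k, N), c)) := by
  obtain ⟨G, hG, hq⟩ := exists_code_two (δ := ℕ × WAut)
    (pre₁ := fun p => prodAut (2 * p.1.1) p.1.2 p.2)
    (pre₂ := fun p => prodAut (2 * p.1.1.1) p.1.1.2 p.1.2)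
    (post := fun p => (p.2.1, eliminate p.1.1.1.1 p.2.2))
    (by fun_prop) (by fun_prop) (by fun_prop)
  refine ⟨fun p => G (p.1, p.2, p.2), by fun_prop, fun k N c L d hc A hA => ?_⟩
  obtain ⟨r, hr, hS, hr'⟩ := hc (prodAut (2 * k) N A) (WAut.HasDim.prodAut hA _ _)
  refine ⟨_, hq.mem hr hr, fun w hw => hS w hw.1, ?_⟩
  rw [values_inter_balanced, toSet_eliminate, hr']

theorem exists_union_code : ∃ G : Code × Code → Code, Primrec G ∧
    ∀ c₁ c₂ L₁ L₂ d, Represents L₁ d c₁ → Represents L₂ d c₂ →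
      Represents (L₁ + L₂) d (G (c₁, c₂)) := by
  obtain ⟨G, hG, hq⟩ := exists_code_two (δ := Unit) (pre₁ := fun p => (p.2.1, p.2.2))
    (pre₂ := fun p => (p.1.2.1, p.1.2.2))
    (post := fun p => (p.1.2.1 ++ p.2.1, p.1.2.2 ++ p.2.2))
    (by fun_prop) (by fun_prop) (by fun_prop)
  refine ⟨fun p => G ((), p.1, p.2), by fun_prop, fun c₁ c₂ L₁ L₂ d h₁ h₂ A hA => ?_⟩
  obtain ⟨r₁, hr₁, hS₁, hr₁'⟩ := h₁ A hA
  obtain ⟨r₂, hr₂, hS₂, hr₂'⟩ := h₂ A hA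
  refine ⟨_, hq.mem hr₁ hr₂, ?_, ?_⟩
  · rintro w (hw | hw) a ha
    · exact List.mem_append_left _ (hS₁ w hw a ha)
    · exact List.mem_append_right _ (hS₂ w hw a ha)
  · rw [toSet_append, values_add]
    exact congrArg₂ _ hr₁' hr₂'

theorem exists_concat_code : ∃ G : Code × Code → Code, Primrec G ∧
    ∀ c₁ c₂ L₁ L₂ d, Represents L₁ (d + 2) c₁ → Represents L₂ (d + 2) c₂ →
      Represents (L₁ * L₂) d (G (c₁, c₂)) := by
  obtain ⟨G, hG, hq⟩ := exists_code_two (δ := Unit) (pre₁ := fun p => endpointAut p.2)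
    (pre₂ := fun p => endpointAut p.1.2)
    (post := fun p => (p.1.2.1 ++ p.2.1,
      concatCode p.1.1.2.1 p.1.1.2.2.1 (toPathTable p.1.2.2) (toPathTable p.2.2)))
    (by fun_prop) (by fun_prop) (by fun_prop)
  refine ⟨fun p => G ((), p.1, p.2), by fun_prop, fun c₁ c₂ L₁ L₂ d h₁ h₂ A hA => ?_⟩
  obtain ⟨r₁, hr₁, hS₁, hr₁'⟩ := h₁ _ (WAut.HasDim.endpointAut hA)
  obtain ⟨r₂, hr₂, hS₂, hr₂'⟩ := h₂ _ (WAut.HasDim.endpointAut hA)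
  refine ⟨_, hq.mem hr₁ hr₂, ?_, ?_⟩
  · intro w hw a ha
    obtain ⟨x, hx, y, hy, rfl⟩ := Language.mem_mul.1 hw
    rcases List.mem_append.1 ha with ha | ha
    · exact List.mem_append_left _ (hS₁ x hx a ha)
    · exact List.mem_append_right _ (hS₂ y hy a ha)
  · exact toSet_concatCode hr₁' hr₂'

theorem exists_star_code : ∃ G : Code → Code, Primrec G ∧
    ∀ c L d, Represents L (d + 2) c → Represents (KStar.kstar L) d (G c) := by
  obtain ⟨G, hG, hq⟩ := exists_code_two (δ := Unit) (pre₁ := fun p => endpointAut p.2)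
    (pre₂ := fun p => endpointAut p.1.2)
    (post := fun p => (p.2.1, kstarCode p.1.1.2 p.2.2))
    (by fun_prop) (by fun_prop) (by fun_prop)
  refine ⟨fun c => G ((), c, c), by fun_prop, fun c L d h A hA => ?_⟩
  obtain ⟨r, hr, hS, hr'⟩ := h _ (WAut.HasDim.endpointAut hA)
  refine ⟨_, hq.mem hr hr, ?_, toSet_kstarCode hr'⟩
  intro w hw a ha
  obtain ⟨x, rfl, hx⟩ := Language.mem_kstar.1 hw
  obtain ⟨y, hy, ha⟩ := List.mem_flatten.1 ha
  exact hS y (hx y hy) a ha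

/-! ### Finite automata -/

/-- The weighted automaton of a nondeterministic finite automaton. -/
def nfaAut (A : NFACode) : WAut :=
  (0, 1, (A.start.map fun q => (0, none, [], q + 2)) ++
    (A.final.map fun q => (q + 2, none, [], 1)) ++
    A.trans.map fun t => (t.1 + 2, some t.2.1, [], t.2.2 + 2))

theorem mem_nfaAut {A : NFACode} {e : ℕ × Option ℕ × List ℕ × ℕ} :
    e ∈ (nfaAut A).2.2 ↔ (∃ q ∈ A.start, e = (0, none, [], q + 2)) ∨
      (∃ q ∈ A.final, e = (q + 2, none, [], 1)) ∨
      ∃ q a q', (q, a, q') ∈ A.trans ∧ e = (q + 2, some a, [], q' + 2) := by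
  simp only [nfaAut, List.mem_append, List.mem_map, or_assoc, Prod.exists, eq_comm]

/-- Paths of a finite automaton. -/
inductive NFAPath (A : NFACode) : ℕ → List ℕ → ℕ → Prop
  | nil (q : ℕ) : NFAPath A q [] q
  | cons {q a q' r : ℕ} {w : List ℕ} (h : (q, a, q') ∈ A.trans) (hr : NFAPath A q' w r) :
      NFAPath A q (a :: w) r

theorem mem_nfa_language {A : NFACode} {w : List ℕ} :
    w ∈ A.language ↔ ∃ s ∈ A.start, ∃ f ∈ A.final, NFAPath A s w f := by
  rw [NFACode.language, NFA.accepts_iff_exists_path]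
  set M : NFA ℕ ℕ := { step := fun q a => {q' | (q, a, q') ∈ A.trans}
                       start := {q | q ∈ A.start}
                       accept := {q | q ∈ A.final} } with hM
  have h : ∀ q w r, Nonempty (M.Path q r w) ↔ NFAPath A q w r := by
    intro q w r
    constructor
    · rintro ⟨p⟩
      induction p with
      | nil => exact NFAPath.nil _
      | cons _ _ _ _ _ h _ ih => exact NFAPath.cons h ih
    · intro p
      induction p with
      | nil => exact ⟨NFA.Path.nil _⟩
      | cons h _ ih => exact ih.elim fun p => ⟨NFA.Path.cons _ _ _ _ _ h p⟩
  simp only [h]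
  rfl

theorem nfaAut_sound {A : NFACode} {p r : ℕ} {w : List ℕ} {z : ℕ → ℕ}
    (h : WRun (nfaAut A).2.2 p w z r) (hr : r = 1) :
    (p = 1 → w = []) ∧ (∀ q, p = q + 2 → ∃ f ∈ A.final, NFAPath A q w f) ∧
    (p = 0 → ∃ s ∈ A.start, ∃ f ∈ A.final, NFAPath A s w f) := by
  induction h with
  | nil => exact ⟨fun _ => rfl, fun q h => by omega, fun h => by omega⟩
  | cons ht _ ih =>
    obtain ⟨ih1, ih2, ih3⟩ := ih hr
    rcases mem_nfaAut.1 ht with ⟨i, hi, he⟩ | ⟨j, hj, he⟩ | ⟨q, a, q', ht', he⟩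
    all_goals
      simp only [Prod.mk.injEq] at he
      obtain ⟨rfl, rfl, rfl, rfl⟩ := he
    · exact ⟨fun h => by omega, fun q h => by omega, fun _ => ⟨i, hi, ih2 i rfl⟩⟩
    · refine ⟨fun h => by omega, fun q h => ?_, fun h => by omega⟩
      obtain rfl : j = q := by omega
      obtain rfl := ih1 rfl
      exact ⟨j, hj, NFAPath.nil _⟩
    · refine ⟨fun h => by omega, fun q₀ h => ?_, fun h => by omega⟩
      obtain rfl : q = q₀ := by omega
      obtain ⟨f, hf, hp⟩ := ih2 q' rfl
      exact ⟨f, hf, NFAPath.cons ht' hp⟩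

theorem nfaAut_complete {A : NFACode} {q f : ℕ} {w : List ℕ} (h : NFAPath A q w f)
    (hf : f ∈ A.final) : WRun (nfaAut A).2.2 (q + 2) w 0 1 := by
  induction h with
  | nil q =>
    simpa using WRun.step (mem_nfaAut.2 (Or.inr (Or.inl ⟨q, hf, rfl⟩))) (WRun.nil 1)
  | cons h _ ih =>
    simpa using WRun.read (mem_nfaAut.2 (Or.inr (Or.inr ⟨_, _, _, h, rfl⟩))) (ih hf)

/-- With no equations to satisfy, balanced languages include the regular ones, so intersection with
them needs no separate treatment. -/
theorem balancedLanguage_nfaAut (A : NFACode) : balancedLanguage 0 (nfaAut A) = A.language := by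
  ext w
  rw [mem_nfa_language]
  constructor
  · rintro ⟨u, hr, -⟩
    exact (nfaAut_sound hr rfl).2.2 rfl
  · rintro ⟨s, hs, f, hf, h⟩
    refine ⟨_, WRun.step (mem_nfaAut.2 (Or.inl ⟨s, hs, rfl⟩)) (nfaAut_complete h hf), ?_⟩
    simp

@[fun_prop] theorem PrimrecComp.nfaAut {α : Type*} [Primcodable α] {f : α → NFACode}
    (hf : Primrec f) : Primrec (fun x => nfaAut (f x)) := by
  unfold LangFam.nfaAut; fun_prop

theorem exists_interReg_code : ∃ G : NFACode × Code → Code, Primrec G ∧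
    ∀ A c L d, Represents L d c → Represents (L ⊓ A.language) d (G (A, c)) := by
  obtain ⟨G, hG, h⟩ := exists_balanced_code
  refine ⟨fun p => G ((0, nfaAut p.1), p.2), by fun_prop, fun A c L d hc => ?_⟩
  rw [← balancedLanguage_nfaAut]
  exact h 0 (nfaAut A) c L d hc

/-! ### One reversal-bounded counter as a balanced language -/

/-- The stages of a simulation of a counter: the counter is zero, it is positive and was last
incremented, it is positive and was last decremented, it is positive and will be incremented
next, it will not be used any more, the end. -/
inductive Stage
  | zero | up | down | turn | drain | done

/-- The state of the simulation in a given stage after `p` changes from decreasing to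
increasing. -/
def Stage.code : Stage → ℕ → ℕ
  | zero, p => 6 * p
  | up, p => 6 * p + 1
  | down, p => 6 * p + 2
  | turn, p => 6 * p + 3
  | drain, p => 6 * p + 4
  | done, p => 6 * p + 5

theorem Stage.code_inj {k k' : Stage} {p p' : ℕ} (h : k.code p = k'.code p') :
    k = k' ∧ p = p' := by
  cases k <;> cases k' <;> simp only [Stage.code] at h <;>
    first
    | exact ⟨rfl, by omega⟩
    | omega

/-- Coordinates `2 * m` with `m ≥ p` count increments. -/
def incWeight (K p : ℕ) : List ℕ :=
  (List.range (2 * K)).map fun i => if i % 2 = 0 then if p ≤ i / 2 then 1 else 0 else 0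

/-- Coordinates `2 * m + 1` with `m ≥ p` count decrements. -/
def decWeight (K p : ℕ) : List ℕ :=
  (List.range (2 * K)).map fun i => if i % 2 = 1 then if p ≤ i / 2 then 1 else 0 else 0

/-- One unit of coordinate `2 * p + 1`. -/
def slackWeight (K p : ℕ) : List ℕ :=
  (List.range (2 * K)).map fun i => if i = 2 * p + 1 then 1 else 0

theorem vec_map_range {n : ℕ} {f : ℕ → ℕ} {i : ℕ} (h : i < n) :
    vec ((List.range n).map f) i = f i := by
  rw [vec, List.getD_eq_getElem _ _ (by simpa using h)]
  simp

theorem incWeight_even {K p m : ℕ} (h : m < K) :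
    vec (incWeight K p) (2 * m) = if p ≤ m then 1 else 0 := by
  rw [incWeight, vec_map_range (by omega), if_pos (by omega), show 2 * m / 2 = m by omega]

theorem incWeight_odd {K p m : ℕ} (h : m < K) : vec (incWeight K p) (2 * m + 1) = 0 := by
  rw [incWeight, vec_map_range (by omega), if_neg (by omega)]

theorem decWeight_even {K p m : ℕ} (h : m < K) : vec (decWeight K p) (2 * m) = 0 := by
  rw [decWeight, vec_map_range (by omega), if_neg (by omega)]

theorem decWeight_odd {K p m : ℕ} (h : m < K) :
    vec (decWeight K p) (2 * m + 1) = if p ≤ m then 1 else 0 := by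
  rw [decWeight, vec_map_range (by omega), if_pos (by omega),
    show (2 * m + 1) / 2 = m by omega]

theorem slackWeight_even {K p m : ℕ} (h : m < K) : vec (slackWeight K p) (2 * m) = 0 := by
  rw [slackWeight, vec_map_range (by omega), if_neg (by omega)]

theorem slackWeight_odd {K p m : ℕ} (h : m < K) :
    vec (slackWeight K p) (2 * m + 1) = if m = p then 1 else 0 := by
  rw [slackWeight, vec_map_range (by omega)]
  split_ifs <;> omega

/-- Actions of the letters on a counter. -/
abbrev ActionTable := List (Option (Bool × Option Bool))

/-- Moves of the simulation. -/
inductive StageEdge (K : ℕ) (acts : ActionTable) :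
    Stage → ℕ → Option ℕ → List ℕ → Stage → ℕ → Prop
  | zero_keep {p t : ℕ} (ht : acts[t]? = some (some (false, none))) :
      StageEdge K acts .zero p (some t) [] .zero p
  | zero_inc {p t : ℕ} (ht : acts[t]? = some (some (false, some true))) :
      StageEdge K acts .zero p (some t) (incWeight K p) .up p
  | up_keep {p t : ℕ} (ht : acts[t]? = some (some (true, none))) :
      StageEdge K acts .up p (some t) [] .up p
  | down_keep {p t : ℕ} (ht : acts[t]? = some (some (true, none))) :
      StageEdge K acts .down p (some t) [] .down p
  | up_inc {p t : ℕ} (ht : acts[t]? = some (some (true, some true))) :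
      StageEdge K acts .up p (some t) (incWeight K p) .up p
  | turn_inc {p t : ℕ} (ht : acts[t]? = some (some (true, some true))) :
      StageEdge K acts .turn p (some t) (incWeight K (p + 1)) .up (p + 1)
  | up_dec {p t : ℕ} (ht : acts[t]? = some (some (true, some false))) :
      StageEdge K acts .up p (some t) (decWeight K p) .down p
  | up_dec_zero {p t : ℕ} (ht : acts[t]? = some (some (true, some false))) :
      StageEdge K acts .up p (some t) (decWeight K p) .zero (p + 1)
  | down_dec {p t : ℕ} (ht : acts[t]? = some (some (true, some false))) :
      StageEdge K acts .down p (some t) (decWeight K p) .down p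
  | down_dec_zero {p t : ℕ} (ht : acts[t]? = some (some (true, some false))) :
      StageEdge K acts .down p (some t) (decWeight K p) .zero (p + 1)
  | down_turn {p : ℕ} : StageEdge K acts .down p none (slackWeight K p) .turn p
  | turn_turn {p : ℕ} : StageEdge K acts .turn p none (slackWeight K p) .turn p
  | zero_drain {p : ℕ} : StageEdge K acts .zero p none [] .drain p
  | up_drain {p : ℕ} : StageEdge K acts .up p none [] .drain p
  | down_drain {p : ℕ} : StageEdge K acts .down p none (decWeight K p) .drain p
  | drain_drain {p : ℕ} : StageEdge K acts .drain p none (decWeight K p) .drain p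
  | drain_done {p : ℕ} : StageEdge K acts .drain p none [] .done 0

/-- The moves that do not read a letter. -/
def lambdaEdges (K p : ℕ) : WTrans :=
  [(Stage.code .down p, none, slackWeight K p, Stage.code .turn p),
    (Stage.code .turn p, none, slackWeight K p, Stage.code .turn p),
    (Stage.code .zero p, none, [], Stage.code .drain p),
    (Stage.code .up p, none, [], Stage.code .drain p),
    (Stage.code .down p, none, decWeight K p, Stage.code .drain p),
    (Stage.code .drain p, none, decWeight K p, Stage.code .drain p),
    (Stage.code .drain p, none, [], Stage.code .done 0)]

/-- The moves that read the letter `t` with action `b`. -/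
def letterEdges (K p t : ℕ) (b : Bool × Option Bool) : WTrans :=
  b.2.elim
    (bif b.1 then
      [(Stage.code .up p, some t, [], Stage.code .up p),
        (Stage.code .down p, some t, [], Stage.code .down p)]
      else [(Stage.code .zero p, some t, [], Stage.code .zero p)])
    fun o => bif o then
      bif b.1 then
        [(Stage.code .up p, some t, incWeight K p, Stage.code .up p),
          (Stage.code .turn p, some t, incWeight K (p + 1), Stage.code .up (p + 1))]
        else [(Stage.code .zero p, some t, incWeight K p, Stage.code .up p)]
      else bif b.1 then
        [(Stage.code .up p, some t, decWeight K p, Stage.code .down p),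
          (Stage.code .up p, some t, decWeight K p, Stage.code .zero (p + 1)),
          (Stage.code .down p, some t, decWeight K p, Stage.code .down p),
          (Stage.code .down p, some t, decWeight K p, Stage.code .zero (p + 1))]
        else []

/-- The weighted automaton simulating a counter. -/
def counterAut (K : ℕ) (acts : ActionTable) : WAut :=
  (Stage.code .zero 0, Stage.code .done 0, (List.range K).flatMap fun p => lambdaEdges K p ++
    (List.range acts.length).flatMap fun t => (acts.getD t none).elim [] (letterEdges K p t))

theorem mem_counterAut {K : ℕ} {acts : ActionTable} {e : ℕ × Option ℕ × List ℕ × ℕ} :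
    e ∈ (counterAut K acts).2.2 ↔ ∃ k p a u k' p', p < K ∧ StageEdge K acts k p a u k' p' ∧
      e = (k.code p, a, u, k'.code p') := by
  simp only [counterAut, List.mem_flatMap, List.mem_range, List.mem_append]
  constructor
  · rintro ⟨p, hp, h | ⟨t, ht, h⟩⟩
    · simp only [lambdaEdges, List.mem_cons, List.not_mem_nil, or_false] at h
      rcases h with rfl | rfl | rfl | rfl | rfl | rfl | rfl
      exacts [⟨_, _, _, _, _, _, hp, .down_turn, rfl⟩, ⟨_, _, _, _, _, _, hp, .turn_turn, rfl⟩,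
        ⟨_, _, _, _, _, _, hp, .zero_drain, rfl⟩, ⟨_, _, _, _, _, _, hp, .up_drain, rfl⟩,
        ⟨_, _, _, _, _, _, hp, .down_drain, rfl⟩, ⟨_, _, _, _, _, _, hp, .drain_drain, rfl⟩,
        ⟨_, _, _, _, _, _, hp, .drain_done, rfl⟩]
    · rcases hb : acts.getD t none with _ | ⟨b, o⟩
      · rw [hb] at h
        simp at h
      have hact : acts[t]? = some (some (b, o)) := by
        rw [List.getD_eq_getElem _ _ ht] at hb
        rw [List.getElem?_eq_getElem ht, hb]
      rw [hb] at h
      rcases b with _ | _ <;> rcases o with _ | _ | _ <;>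
        simp only [letterEdges, Option.elim_some, Option.elim_none, cond_true, cond_false,
          List.mem_cons, List.not_mem_nil, or_false] at h
      · subst h
        exact ⟨_, _, _, _, _, _, hp, .zero_keep hact, rfl⟩
      · subst h
        exact ⟨_, _, _, _, _, _, hp, .zero_inc hact, rfl⟩
      · rcases h with rfl | rfl
        exacts [⟨_, _, _, _, _, _, hp, .up_keep hact, rfl⟩,
          ⟨_, _, _, _, _, _, hp, .down_keep hact, rfl⟩]
      · rcases h with rfl | rfl | rfl | rfl
        exacts [⟨_, _, _, _, _, _, hp, .up_dec hact, rfl⟩,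
          ⟨_, _, _, _, _, _, hp, .up_dec_zero hact, rfl⟩,
          ⟨_, _, _, _, _, _, hp, .down_dec hact, rfl⟩,
          ⟨_, _, _, _, _, _, hp, .down_dec_zero hact, rfl⟩]
      · rcases h with rfl | rfl
        exacts [⟨_, _, _, _, _, _, hp, .up_inc hact, rfl⟩,
          ⟨_, _, _, _, _, _, hp, .turn_inc hact, rfl⟩]
  · rintro ⟨k, p, a, u, k', p', hp, h, rfl⟩
    refine ⟨p, hp, ?_⟩
    have hact : ∀ {t b}, acts[t]? = some (some b) → t < acts.length ∧
        acts.getD t none = some b := by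
      intro t b h
      exact ⟨(List.getElem?_eq_some_iff.1 h).1, by rw [List.getD_eq_getElem?_getD, h]; rfl⟩
    cases h
    case down_turn | turn_turn | zero_drain | up_drain | down_drain | drain_drain | drain_done =>
      exact Or.inl (by simp [lambdaEdges])
    all_goals
      rename_i ht
      exact Or.inr ⟨_, (hact ht).1, by rw [(hact ht).2]; simp [letterEdges]⟩

/-- Runs of a single counter. -/
inductive CounterRun (acts : ActionTable) : ℕ → List ℕ → ℕ → Prop
  | nil (x : ℕ) : CounterRun acts x [] x
  | cons {t : ℕ} {a : Bool × Option Bool} {x y z : ℕ} {w : List ℕ}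
      (ht : acts[t]? = some (some a)) (hs : CounterStep a x y) (hr : CounterRun acts y w z) :
      CounterRun acts x (t :: w) z

/-- The increments and decrements along a word. -/
def directions (acts : ActionTable) (w : List ℕ) : List Bool :=
  w.filterMap fun t => (acts.getD t none).bind fun a => a.2

theorem WRun.eq_of_done {K : ℕ} {acts : ActionTable} {q r : ℕ} {w : List ℕ} {u : ℕ → ℕ}
    (h : WRun (counterAut K acts).2.2 q w u r) {p : ℕ} (hq : q = Stage.code .done p) :
    w = [] ∧ u = 0 := by
  cases h with
  | nil q => exact ⟨rfl, rfl⟩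
  | cons ht _ =>
    obtain ⟨k₁, p₁, a, u, k₂, p₂, hp, hedge, he⟩ := mem_counterAut.1 ht
    simp only [Prod.mk.injEq] at he
    obtain ⟨rfl, rfl⟩ := Stage.code_inj (he.1.symm.trans hq)
    cases hedge

/-- Moves in phase p touch only coordinates of phases m ≥ p, and phases never decrease before the
end; so the equation of a phase is settled once the phase is left. In stage `down` no increment of
phase p can follow, but a decrement, slack or drain must, and this will prove the counter positive.
-/
theorem stage_support {K : ℕ} {acts : ActionTable} {q r : ℕ} {w : List ℕ} {u : ℕ → ℕ}
    (h : WRun (counterAut K acts).2.2 q w u r) (hr : r = Stage.code .done 0) {k : Stage} {p : ℕ}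
    (hq : q = k.code p) :
    (∀ m < p, m < K → u (2 * m) = 0 ∧ u (2 * m + 1) = 0) ∧
    (k ≠ .zero → k ≠ .up → p < K → u (2 * p) = 0) ∧
    (k = .down → p < K → 1 ≤ u (2 * p + 1)) := by
  induction h generalizing k p with
  | nil q =>
    subst hr
    obtain ⟨rfl, rfl⟩ := Stage.code_inj hq
    simp
  | cons ht hrun ih =>
    obtain ⟨k₁, p₁, a, u, k₂, p₂, hp, hedge, he⟩ := mem_counterAut.1 ht
    simp only [Prod.mk.injEq] at he
    obtain ⟨rfl, rfl, rfl, rfl⟩ := he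
    obtain ⟨rfl, rfl⟩ := Stage.code_inj hq
    obtain ⟨ih1, ih2, ih3⟩ := ih hr rfl
    clear ih
    refine ⟨fun m hm hmK => ?_, fun h1 h2 hpK => ?_, fun h1 hpK => ?_⟩
    · cases hedge
      -- The final state has phase 0, so the induction hypothesis says nothing about m < p; instead,
      -- no move leaves the final state.
      case drain_done =>
        rw [(hrun.eq_of_done rfl).2]
        simp [vec_nil]
      all_goals
        have := ih1 m (by omega) hmK
        simp only [Pi.add_apply, incWeight_even hmK, incWeight_odd hmK, decWeight_even hmK,
          decWeight_odd hmK, slackWeight_even hmK, slackWeight_odd hmK, vec_nil, Pi.zero_apply]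
        first
        | omega
        | (split_ifs <;> omega)
    · cases hedge
      case drain_done =>
        rw [(hrun.eq_of_done rfl).2]
        simp [vec_nil]
      all_goals
        first
        | exact absurd rfl h1
        | exact absurd rfl h2
        | (simp only [Pi.add_apply, incWeight_even hpK, decWeight_even hpK,
            slackWeight_even hpK, vec_nil, Pi.zero_apply]
           first
           | (have := ih2 (by simp) (by simp) hpK; omega)
           | (have := (ih1 _ (Nat.lt_succ_self _) hpK).1; simp [this]))
    · subst h1
      cases hedge
      all_goals
        simp only [Pi.add_apply, decWeight_odd hpK, slackWeight_odd hpK, vec_nil, Pi.zero_apply]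
        first
        | (have := ih3 rfl hpK; omega)
        | (simp only [le_refl, if_true]; omega)

/-- The contents `v` and the changes from phase `p` on sum up to zero at the end. -/
def BalancedFrom (K p v : ℕ) (u : ℕ → ℕ) : Prop :=
  ∀ m, p ≤ m → m < K → v + u (2 * m) = u (2 * m + 1)

/-- The relation of the contents `v` of a counter to the rest of a run. -/
def Stage.Inv (K : ℕ) (u : ℕ → ℕ) : Stage → ℕ → ℕ → Prop
  | .zero, p, v => v = 0 ∧ BalancedFrom K p v u
  | .up, p, v => 1 ≤ v ∧ BalancedFrom K p v u
  | .down, p, v => BalancedFrom K p v u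
  | .turn, p, v => 1 ≤ v ∧ BalancedFrom K (p + 1) v u
  | _, _, _ => True

/-- Read backwards, the equations determine the contents: the contents plus later increments equal
later decrements in every open phase. Guesses such as reaching zero or starting to increase are
thereby checked at the end of the path. -/
theorem exists_counterRun {K : ℕ} {acts : ActionTable} {q r : ℕ} {w : List ℕ} {u : ℕ → ℕ}
    (h : WRun (counterAut K acts).2.2 q w u r) (hr : r = Stage.code .done 0) {k : Stage}
    {p v : ℕ} (hq : q = k.code p) (hinv : k.Inv K u p v) : ∃ y, CounterRun acts v w y := by
  induction h generalizing k p v with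
  | nil q => exact ⟨v, .nil v⟩
  | @cons q a u q' w z r ht hrun ih =>
    have hsupp₀ := (stage_support (WRun.cons ht hrun) hr hq).2
    obtain ⟨k₁, p₁, a, u, k₂, p₂, hp, hedge, he⟩ := mem_counterAut.1 ht
    simp only [Prod.mk.injEq] at he
    obtain ⟨rfl, rfl, rfl, rfl⟩ := he
    obtain ⟨rfl, rfl⟩ := Stage.code_inj hq.symm
    have hsupp := (stage_support hrun hr rfl).1
    have ih' := fun v => ih (v := v) hr rfl
    clear ih
    -- Positivity is not visible locally in stage `down`: the equation of phase p reduces to v = u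
    -- (2p + 1), which is at least 1.
    have hpos : k = .down → k.Inv K (vec u + z) p v → 1 ≤ v := by
      rintro rfl h
      have h1 := hsupp₀.1 (by simp) (by simp) hp
      have h2 := hsupp₀.2 rfl hp
      have h3 := h p le_rfl hp
      omega
    have hcons : ∀ {t b} (v'), acts[t]? = some (some b) → CounterStep b v v' →
        k₂.Inv K z p₂ v' → ∃ y, CounterRun acts v (t :: w) y := by
      intro t b v' ht hs hi
      obtain ⟨y, hy⟩ := ih' v' hi
      exact ⟨y, .cons ht hs hy⟩
    have hbal : ∀ {n v v'}, BalancedFrom K n v (vec u + z) → n ≤ p₂ →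
        (∀ m, p₂ ≤ m → m < K → v + vec u (2 * m) + z (2 * m) =
          vec u (2 * m + 1) + z (2 * m + 1) → v' + z (2 * m) = z (2 * m + 1)) →
        BalancedFrom K p₂ v' z := by
      intro n v v' h hn h' m hm hmK
      refine h' m hm hmK ?_
      have := h m (hn.trans hm) hmK
      simp only [Pi.add_apply] at this
      omega
    clear hsupp₀ ht
    cases hedge
    case zero_keep ht =>
      obtain ⟨rfl, hb⟩ := hinv
      refine hcons 0 ht (by simp [CounterStep]) ⟨rfl, hbal hb le_rfl fun m hm hmK => ?_⟩
      simp [vec_nil]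
    case zero_inc ht =>
      obtain ⟨rfl, hb⟩ := hinv
      refine hcons 1 ht (by simp [CounterStep]) ⟨le_rfl, hbal hb le_rfl fun m hm hmK => ?_⟩
      rw [incWeight_even hmK, incWeight_odd hmK, if_pos hm]
      omega
    case up_keep ht =>
      obtain ⟨hv, hb⟩ := hinv
      refine hcons v ht (by simp [CounterStep]; omega)
        ⟨hv, hbal hb le_rfl fun m hm hmK => ?_⟩
      simp [vec_nil]
    case down_keep ht =>
      have hv := hpos rfl hinv
      refine hcons v ht (by simp [CounterStep]; omega) (hbal hinv le_rfl fun m hm hmK => ?_)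
      simp [vec_nil]
    case up_inc ht =>
      obtain ⟨hv, hb⟩ := hinv
      refine hcons (v + 1) ht (by simp [CounterStep]; omega)
        ⟨by omega, hbal hb le_rfl fun m hm hmK => ?_⟩
      rw [incWeight_even hmK, incWeight_odd hmK, if_pos hm]
      omega
    case turn_inc ht =>
      obtain ⟨hv, hb⟩ := hinv
      refine hcons (v + 1) ht (by simp [CounterStep]; omega)
        ⟨by omega, hbal hb le_rfl fun m hm hmK => ?_⟩
      rw [incWeight_even hmK, incWeight_odd hmK, if_pos hm]
      omega
    case up_dec ht =>
      obtain ⟨hv, hb⟩ := hinv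
      refine hcons (v - 1) ht (by simp [CounterStep]; omega)
        (hbal hb le_rfl fun m hm hmK => ?_)
      rw [decWeight_even hmK, decWeight_odd hmK, if_pos hm]
      omega
    case down_dec ht =>
      have hv := hpos rfl hinv
      refine hcons (v - 1) ht (by simp [CounterStep]; omega)
        (hbal hinv le_rfl fun m hm hmK => ?_)
      rw [decWeight_even hmK, decWeight_odd hmK, if_pos hm]
      omega
    case up_dec_zero ht =>
      obtain ⟨hv, hb⟩ := hinv
      -- Phase p is left here, so its equation has only this decrement to balance `v`; hence v = 1
      -- and the guessed zero is correct.
      have h1 := hsupp p (by omega) hp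
      have h2 := hb p le_rfl hp
      simp only [Pi.add_apply, decWeight_even hp, decWeight_odd hp, le_refl, if_true] at h2
      refine hcons 0 ht (by simp [CounterStep]; omega)
        ⟨rfl, hbal hb (by omega) fun m hm hmK => ?_⟩
      rw [decWeight_even hmK, decWeight_odd hmK, if_pos (by omega)]
      omega
    case down_dec_zero ht =>
      have hv := hpos rfl hinv
      have h1 := hsupp p (by omega) hp
      have h2 := hinv p le_rfl hp
      simp only [Pi.add_apply, decWeight_even hp, decWeight_odd hp, le_refl, if_true] at h2
      refine hcons 0 ht (by simp [CounterStep]; omega)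
        ⟨rfl, hbal hinv (by omega) fun m hm hmK => ?_⟩
      rw [decWeight_even hmK, decWeight_odd hmK, if_pos (by omega)]
      omega
    case down_turn =>
      have hv := hpos rfl hinv
      refine ih' v ⟨hv, fun m hm hmK => ?_⟩
      have := hinv m (by omega) hmK
      simp only [Pi.add_apply, slackWeight_even hmK, slackWeight_odd hmK] at this
      rw [if_neg (by omega)] at this
      omega
    case turn_turn =>
      obtain ⟨hv, hb⟩ := hinv
      refine ih' v ⟨hv, fun m hm hmK => ?_⟩
      have := hb m hm hmK
      simp only [Pi.add_apply, slackWeight_even hmK, slackWeight_odd hmK] at this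
      rw [if_neg (by omega)] at this
      omega
    -- Once draining has begun no letter is read, so nothing remains to be checked about the
    -- counter.
    all_goals exact ih' v trivial

theorem WRun.loop {T : WTrans} {q r : ℕ} {u : List ℕ} {w : List ℕ} {z : ℕ → ℕ}
    (h : (q, none, u, q) ∈ T) (n : ℕ) (hr : WRun T q w z r) : WRun T q w (n • vec u + z) r := by
  induction n with
  | zero => simpa using hr
  | succ n ih =>
    rw [succ_nsmul', add_assoc]
    exact WRun.step h ih

/-- The number of the phase plus the direction changes to come stays bounded. Stage `zero` has one
unit more to spend, because reaching zero opens a new phase in advance, while the change to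
increasing that pays for it comes later. So p ≤ l + 1 always, which is why K = l + 2 phases suffice.
-/
theorem CounterRun.exists_run {l : ℕ} {acts : ActionTable} {v y : ℕ} {w : List ℕ}
    (h : CounterRun acts v w y) {K : ℕ} (hK : K = l + 2) (p : ℕ) :
    (v = 0 → p + alternations (false :: directions acts w) ≤ l + 1 →
      ∃ u, WRun (counterAut K acts).2.2 (Stage.code .zero p) w u (Stage.code .done 0) ∧
        BalancedFrom K p v u) ∧
    (v ≠ 0 → p + alternations (true :: directions acts w) ≤ l →
      ∃ u, WRun (counterAut K acts).2.2 (Stage.code .up p) w u (Stage.code .done 0) ∧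
        BalancedFrom K p v u) ∧
    (v ≠ 0 → p + alternations (false :: directions acts w) ≤ l →
      ∃ u, WRun (counterAut K acts).2.2 (Stage.code .down p) w u (Stage.code .done 0) ∧
        BalancedFrom K p v u) := by
  have edge : ∀ {k p a u k' p'}, StageEdge K acts k p a u k' p' → p < K →
      (k.code p, a, u, k'.code p') ∈ (counterAut K acts).2.2 :=
    fun h hp => mem_counterAut.2 ⟨_, _, _, _, _, _, hp, h, rfl⟩
  induction h generalizing p with
  | nil x =>
    have hfin : p < K → ∀ n, WRun (counterAut K acts).2.2 (Stage.code .drain p) []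
        (n • vec (decWeight K p) + (vec [] + 0)) (Stage.code .done 0) := fun hp n =>
      WRun.loop (edge .drain_drain hp) n (WRun.step (edge .drain_done hp) (WRun.nil _))
    refine ⟨?_, ?_, ?_⟩
    · rintro rfl h
      refine ⟨_, WRun.step (edge .zero_drain (by omega)) (hfin (by omega) 0), ?_⟩
      intro m _ _
      simp [vec_nil]
    · intro hx h
      refine ⟨_, WRun.step (edge .up_drain (by omega)) (hfin (by omega) x), ?_⟩
      intro m hm hmK
      simp [vec_nil, decWeight_even hmK, decWeight_odd hmK, hm]
    · intro hx h
      -- The move into the drain already removes one unit of the contents `x`.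
      refine ⟨_, WRun.step (edge .down_drain (by omega)) (hfin (by omega) (x - 1)), ?_⟩
      intro m hm hmK
      simp [vec_nil, decWeight_even hmK, decWeight_odd hmK, hm]
      omega
  | @cons t a x y z w ht hs hr ih =>
    have hdir : directions acts (t :: w) = a.2.toList ++ directions acts w := by
      have : acts.getD t none = some a := by rw [List.getD_eq_getElem?_getD, ht]; rfl
      rw [directions, List.filterMap_cons, this]
      rcases a with ⟨b, _ | o⟩ <;> rfl
    rw [hdir]
    obtain ⟨b, o⟩ := a
    obtain ⟨hb, hs⟩ := hs
    have hsum : ∀ {n p₂ v v' z u}, BalancedFrom K n v' z → p₂ ≤ n →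
        (∀ m, p₂ ≤ m → m < K → (n ≤ m → v' + z (2 * m) = z (2 * m + 1)) →
          v + (vec u (2 * m) + z (2 * m)) = vec u (2 * m + 1) + z (2 * m + 1)) →
        BalancedFrom K p₂ v (vec u + z) :=
      fun h _ h' m hm hmK => h' m hm hmK fun hn => h m hn hmK
    -- After a phase is left the rest of the path adds nothing to its pair of coordinates.
    have hleave : ∀ {q u k' p'}, WRun (counterAut K acts).2.2 q w u (Stage.code .done 0) →
        q = Stage.code k' p' → ∀ m < p', m < K → u (2 * m) = 0 ∧ u (2 * m + 1) = 0 :=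
      fun h hq => (stage_support h rfl hq).1
    rcases o with _ | _ | _
    · obtain rfl : y = x := hs
      refine ⟨fun hx h => ?_, fun hx h => ?_, fun hx h => ?_⟩
      · obtain ⟨u, hu, hbal⟩ := (ih p).1 hx h
        obtain rfl : b = false := by simpa [hx] using hb
        exact ⟨_, WRun.read (edge (.zero_keep ht) (by omega)) hu,
          by simpa [vec_nil] using hbal⟩
      · obtain ⟨u, hu, hbal⟩ := (ih p).2.1 hx h
        obtain rfl : b = true := by simpa [hx] using hb
        exact ⟨_, WRun.read (edge (.up_keep ht) (by omega)) hu,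
          by simpa [vec_nil] using hbal⟩
      · obtain ⟨u, hu, hbal⟩ := (ih p).2.2 hx h
        obtain rfl : b = true := by simpa [hx] using hb
        exact ⟨_, WRun.read (edge (.down_keep ht) (by omega)) hu,
          by simpa [vec_nil] using hbal⟩
    · have hxy : x = y + 1 := hs
      obtain rfl : b = true := hb.2 (by omega)
      refine ⟨fun hx h => by omega, fun hx h => ?_, fun hx h => ?_⟩
      all_goals
        simp only [Option.toList_some, List.singleton_append, alternations, if_true,
          Bool.true_eq_false, if_false] at h
        rcases eq_or_ne y 0 with hy | hy
      · obtain ⟨u, hu, hbal⟩ := (ih (p + 1)).1 hy (by omega)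
        refine ⟨_, WRun.read (edge (.up_dec_zero ht) (by omega)) hu, ?_⟩
        refine hsum hbal (by omega) fun m hm hmK h' => ?_
        rw [decWeight_even hmK, decWeight_odd hmK, if_pos hm]
        rcases hm.eq_or_lt with rfl | hlt
        · have := hleave hu rfl p (by omega) hmK
          omega
        · have := h' hlt
          omega
      · obtain ⟨u, hu, hbal⟩ := (ih p).2.2 hy (by omega)
        refine ⟨_, WRun.read (edge (.up_dec ht) (by omega)) hu, ?_⟩
        refine hsum hbal le_rfl fun m hm hmK h' => ?_
        rw [decWeight_even hmK, decWeight_odd hmK, if_pos hm]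
        have := h' hm
        omega
      · obtain ⟨u, hu, hbal⟩ := (ih (p + 1)).1 hy (by omega)
        refine ⟨_, WRun.read (edge (.down_dec_zero ht) (by omega)) hu, ?_⟩
        refine hsum hbal (by omega) fun m hm hmK h' => ?_
        rw [decWeight_even hmK, decWeight_odd hmK, if_pos hm]
        rcases hm.eq_or_lt with rfl | hlt
        · have := hleave hu rfl p (by omega) hmK
          omega
        · have := h' hlt
          omega
      · obtain ⟨u, hu, hbal⟩ := (ih p).2.2 hy (by omega)
        refine ⟨_, WRun.read (edge (.down_dec ht) (by omega)) hu, ?_⟩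
        refine hsum hbal le_rfl fun m hm hmK h' => ?_
        rw [decWeight_even hmK, decWeight_odd hmK, if_pos hm]
        have := h' hm
        omega
    · have hxy : y = x + 1 := hs
      refine ⟨fun hx h => ?_, fun hx h => ?_, fun hx h => ?_⟩
      all_goals
        simp only [Option.toList_some, List.singleton_append, alternations, if_true,
          Bool.false_eq_true, if_false] at h
      · obtain ⟨u, hu, hbal⟩ := (ih p).2.1 (by omega) (by omega)
        obtain rfl : b = false := by simpa [hx] using hb
        refine ⟨_, WRun.read (edge (.zero_inc ht) (by omega)) hu, ?_⟩
        refine hsum hbal le_rfl fun m hm hmK h' => ?_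
        rw [incWeight_even hmK, incWeight_odd hmK, if_pos hm]
        have := h' hm
        omega
      · obtain ⟨u, hu, hbal⟩ := (ih p).2.1 (by omega) (by omega)
        obtain rfl : b = true := by simpa [hx] using hb
        refine ⟨_, WRun.read (edge (.up_inc ht) (by omega)) hu, ?_⟩
        refine hsum hbal le_rfl fun m hm hmK h' => ?_
        rw [incWeight_even hmK, incWeight_odd hmK, if_pos hm]
        have := h' hm
        omega
      · obtain ⟨u, hu, hbal⟩ := (ih (p + 1)).2.1 (by omega) (by omega)
        obtain rfl : b = true := by simpa [hx] using hb
        -- The slack of phase p must equal the contents `x`: one unit on turning and x − 1 units in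
        -- the loop.
        refine ⟨_, WRun.step (edge .down_turn (by omega)) (WRun.loop (edge .turn_turn (by omega))
          (x - 1) (WRun.read (edge (.turn_inc ht) (by omega)) hu)), ?_⟩
        intro m hm hmK
        simp only [Pi.add_apply, Pi.smul_apply, slackWeight_even hmK, slackWeight_odd hmK,
          incWeight_even hmK, incWeight_odd hmK, smul_eq_mul]
        rcases hm.eq_or_lt with rfl | hlt
        · have := hleave hu rfl p (by omega) hmK
          simp
          omega
        · have := hbal m hlt hmK
          rw [if_pos (Nat.succ_le_of_lt hlt), if_neg hlt.ne']
          omega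

theorem mem_balanced_counterAut {l : ℕ} {acts : ActionTable} {w : List ℕ} {y : ℕ}
    (h : CounterRun acts 0 w y) (hl : alternations (directions acts w) ≤ l) :
    w ∈ balancedLanguage (l + 2) (counterAut (l + 2) acts) := by
  -- The simulation starts as if the counter had just been decremented, which costs at most one
  -- further change of direction.
  have hle : ∀ ds : List Bool, alternations (false :: ds) ≤ alternations ds + 1 := by
    rintro (_ | ⟨d, ds⟩)
    · simp [alternations]
    · rw [alternations]
      split_ifs <;> omega
  have := hle (directions acts w)
  obtain ⟨u, hu, hb⟩ := (h.exists_run (l := l) rfl 0).1 rfl (by omega)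
  exact ⟨u, hu, fun j hj => by simpa using hb j (Nat.zero_le _) hj⟩

/-- Soundness holds for every K; the number of reversals matters only for completeness. -/
theorem exists_counterRun_of_mem_balanced {K : ℕ} {acts : ActionTable} {w : List ℕ}
    (h : w ∈ balancedLanguage K (counterAut K acts)) : ∃ y, CounterRun acts 0 w y := by
  obtain ⟨u, hu, hb⟩ := h
  exact exists_counterRun hu rfl (k := .zero) (p := 0) rfl
    ⟨rfl, fun m _ hm => by simpa using hb m hm⟩

/-! ### Multicounter machines -/

/-- The actions of the transitions on counter `i`. -/
def CounterMachine.actions (M : CounterMachine) (i : ℕ) : ActionTable :=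
  M.trans.map fun t => t.acts[i]?

theorem CounterMachine.getElem?_actions {M : CounterMachine} {i j : ℕ}
    {a : Bool × Option Bool} :
    (M.actions i)[j]? = some (some a) ↔ ∃ t, M.trans[j]? = some t ∧ t.acts[i]? = some a := by
  rw [actions, List.getElem?_map]
  cases M.trans[j]? <;> simp

/-- The automaton reading sequences of numbers of transitions that agree in their states. -/
def CounterMachine.pathNFA (M : CounterMachine) : NFACode :=
  ⟨[M.start], M.final, (List.range M.trans.length).flatMap fun j =>
    (M.trans[j]?).elim [] fun t => [(t.src, j, t.tgt)]⟩

theorem CounterMachine.mem_pathNFA {M : CounterMachine} {q j q' : ℕ} :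
    (q, j, q') ∈ M.pathNFA.trans ↔ ∃ t, M.trans[j]? = some t ∧ q = t.src ∧ q' = t.tgt := by
  simp only [pathNFA, List.mem_flatMap, List.mem_range]
  constructor
  · rintro ⟨j', hj', h⟩
    rw [List.getElem?_eq_getElem hj', Option.elim_some, List.mem_singleton] at h
    simp only [Prod.mk.injEq] at h
    obtain ⟨rfl, rfl, rfl⟩ := h
    exact ⟨_, List.getElem?_eq_getElem hj', rfl, rfl⟩
  · rintro ⟨t, ht, rfl, rfl⟩
    exact ⟨j, (List.getElem?_eq_some_iff.1 ht).1, by simp [ht]⟩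

/-- The homomorphism sending the number of a transition to its label. -/
def CounterMachine.labelHom (M : CounterMachine) : HomCode :=
  (List.range M.trans.length).flatMap fun j =>
    (M.trans[j]?).elim [] fun t => [(j, t.label.toList)]

theorem CounterMachine.mem_labelHom {M : CounterMachine} {j : ℕ} {v : List ℕ} :
    (j, v) ∈ M.labelHom ↔ ∃ t, M.trans[j]? = some t ∧ v = t.label.toList := by
  simp only [labelHom, List.mem_flatMap, List.mem_range]
  constructor
  · rintro ⟨j', hj', h⟩
    rw [List.getElem?_eq_getElem hj', Option.elim_some, List.mem_singleton] at h
    simp only [Prod.mk.injEq] at h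
    obtain ⟨rfl, rfl⟩ := h
    exact ⟨_, List.getElem?_eq_getElem hj', rfl⟩
  · rintro ⟨t, ht, rfl⟩
    exact ⟨j, (List.getElem?_eq_some_iff.1 ht).1, by simp [ht]⟩

theorem CounterMachine.labelHom_fn {M : CounterMachine} {j : ℕ} {t : CounterTrans}
    (h : M.trans[j]? = some t) : j ∈ M.labelHom.dom ∧ M.labelHom.fn j = t.label.toList := by
  have hm : (j, t.label.toList) ∈ M.labelHom := mem_labelHom.2 ⟨t, h, rfl⟩
  have hd : j ∈ M.labelHom.dom := by
    rw [HomCode.dom, List.mem_toFinset]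
    exact List.mem_map_of_mem hm
  refine ⟨hd, ?_⟩
  obtain ⟨v, hv⟩ := mem_dom_iff.1 hd
  obtain ⟨t', ht', rfl⟩ := mem_labelHom.1 (lookup_eq_some_mem hv)
  rw [HomCode.fn, hv]
  rw [h] at ht'
  cases ht'
  rfl

theorem CounterMachine.Run.exists_path {M : CounterMachine} {q q' : ℕ}
    {c c' : Fin M.counters → ℕ} {w : List ℕ} {ts : List CounterTrans}
    (h : M.Run q c w ts q' c') :
    ∃ s, NFAPath M.pathNFA q s q' ∧ (∀ a ∈ s, a ∈ M.labelHom.dom) ∧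
      s.flatMap M.labelHom.fn = w ∧
      ∀ i : Fin M.counters, CounterRun (M.actions i) (c i) s (c' i) ∧
        alternations (directions (M.actions i) s) = reversals i ts := by
  -- Equality of the lists of directions passes through the induction directly, unlike equality of
  -- numbers of alternations.
  suffices ∃ s, NFAPath M.pathNFA q s q' ∧ (∀ a ∈ s, a ∈ M.labelHom.dom) ∧
      s.flatMap M.labelHom.fn = w ∧
      ∀ i : Fin M.counters, CounterRun (M.actions i) (c i) s (c' i) ∧
        directions (M.actions i) s =
          ts.filterMap fun t => (t.acts[(i : ℕ)]?).bind fun a => a.2 by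
    obtain ⟨s, h1, h2, h3, h4⟩ := this
    exact ⟨s, h1, h2, h3, fun i => ⟨(h4 i).1, congrArg _ (h4 i).2⟩⟩
  induction h with
  | nil q c => exact ⟨[], .nil q, by simp, rfl, fun i => ⟨.nil _, rfl⟩⟩
  | cons t c c₁ c₂ w ts q ht hstep _ ih =>
    obtain ⟨s, h1, h2, h3, h4⟩ := ih
    obtain ⟨j, hj⟩ := List.getElem?_of_mem ht
    obtain ⟨hd, hfn⟩ := labelHom_fn hj
    refine ⟨j :: s, .cons (mem_pathNFA.2 ⟨t, hj, rfl, rfl⟩) h1, ?_, ?_, fun i => ?_⟩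
    · simpa using ⟨hd, h2⟩
    · rw [List.flatMap_cons, hfn, h3]
    · obtain ⟨a, ha, hs⟩ := hstep i
      have hact : (M.actions i)[j]? = some (some a) := getElem?_actions.2 ⟨t, hj, ha⟩
      refine ⟨.cons hact hs (h4 i).1, ?_⟩
      rw [directions, List.filterMap_cons, List.filterMap_cons, ← (h4 i).2,
        List.getD_eq_getElem?_getD, hact, ha]
      rfl

/-- Once the sequence of transitions is fixed the counters do not interact, so separate runs of the
counters combine into a run of the machine. -/
theorem NFAPath.exists_run {M : CounterMachine} {q q' : ℕ} {s : List ℕ}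
    (h : NFAPath M.pathNFA q s q') (c : Fin M.counters → ℕ)
    (hc : ∀ i : Fin M.counters, ∃ y, CounterRun (M.actions i) (c i) s y) :
    ∃ ts c', M.Run q c (s.flatMap M.labelHom.fn) ts q' c' := by
  induction h generalizing c with
  | nil q => exact ⟨[], c, .nil q c⟩
  | @cons q j q' r s h hr ih =>
    obtain ⟨t, ht, rfl, rfl⟩ := CounterMachine.mem_pathNFA.1 h
    have hstep : ∀ i : Fin M.counters, ∃ x, (∃ a, t.acts[(i : ℕ)]? = some a ∧
        CounterStep a (c i) x) ∧ ∃ y, CounterRun (M.actions i) x s y := by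
      intro i
      obtain ⟨y, hy⟩ := hc i
      cases hy with
      | cons hact hs hrun =>
        obtain ⟨t', ht', ha⟩ := CounterMachine.getElem?_actions.1 hact
        rw [ht] at ht'
        cases ht'
        exact ⟨_, ⟨_, ha, hs⟩, _, hrun⟩
    choose c₁ hc₁ hc₁' using hstep
    obtain ⟨ts, c', hrun⟩ := ih c₁ hc₁'
    refine ⟨t :: ts, c', ?_⟩
    rw [List.flatMap_cons, (CounterMachine.labelHom_fn ht).2]
    exact .cons t c c₁ c' _ ts _ (List.mem_of_getElem? ht) hc₁ hrun

theorem mem_foldl_inf {f : ℕ → Language ℕ} {l : List ℕ} {L : Language ℕ} {w : List ℕ} :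
    w ∈ l.foldl (fun K i => K ⊓ f i) L ↔ w ∈ L ∧ ∀ i ∈ l, w ∈ f i := by
  induction l generalizing L with
  | nil => simp
  | cons i l ih =>
    rw [List.foldl_cons, ih, List.forall_mem_cons, ← and_assoc]
    exact Iff.rfl

/-- A word of the intersection is the label of a sequence of transitions subject to a regular
condition on states and one condition per counter. The reversal bound is used only to show that
every accepting computation is captured. -/
theorem inter_counterMachine {M : CounterMachine} {l : ℕ} (hl : M.IsReversalBounded l)
    (L : Language ℕ) :
    L ⊓ M.language = homImage M.labelHom.fn ((List.range M.counters).foldl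
      (fun K i => K ⊓ balancedLanguage (l + 2) (counterAut (l + 2) (M.actions i)))
      (homPreimage M.labelHom.dom M.labelHom.fn L ⊓ M.pathNFA.language)) := by
  ext w
  constructor
  · rintro ⟨hw, ts, q, c, hrun, hq⟩
    obtain ⟨s, h1, h2, h3, h4⟩ := hrun.exists_path
    refine ⟨s, mem_foldl_inf.2 ⟨⟨⟨h2, h3.symm ▸ hw⟩, ?_⟩, fun i hi => ?_⟩, h3.symm⟩
    · exact mem_nfa_language.2 ⟨_, List.mem_singleton_self _, q, hq, h1⟩
    · have hi' := List.mem_range.1 hi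
      obtain ⟨hr, ha⟩ := h4 ⟨i, hi'⟩
      exact mem_balanced_counterAut hr (ha.trans_le (hl w ts ⟨q, c, hrun, hq⟩ i hi'))
  · rintro ⟨s, hs, rfl⟩
    obtain ⟨⟨⟨-, hL⟩, hN⟩, hbal⟩ := mem_foldl_inf.1 hs
    obtain ⟨q₀, hq₀, f, hf, hp⟩ := mem_nfa_language.1 hN
    obtain rfl := List.mem_singleton.1 hq₀
    obtain ⟨ts, c', hrun⟩ := hp.exists_run (fun _ => 0) fun i =>
      exists_counterRun_of_mem_balanced (hbal i (List.mem_range.2 i.2))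
    exact ⟨hL, ts, f, c', hrun, hf⟩

/-! ### Intersection with reversal-bounded machines as a program -/

@[fun_prop] theorem PrimrecComp.actions {α : Type*} [Primcodable α] {f : α → CounterMachine}
    {g : α → ℕ} (hf : Primrec f) (hg : Primrec g) : Primrec (fun x => (f x).actions (g x)) := by
  unfold CounterMachine.actions; fun_prop

@[fun_prop] theorem PrimrecComp.pathNFA {α : Type*} [Primcodable α] {f : α → CounterMachine}
    (hf : Primrec f) : Primrec (fun x => (f x).pathNFA) := by
  unfold CounterMachine.pathNFA; fun_prop

@[fun_prop] theorem PrimrecComp.labelHom {α : Type*} [Primcodable α] {f : α → CounterMachine}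
    (hf : Primrec f) : Primrec (fun x => (f x).labelHom) := by
  unfold CounterMachine.labelHom; fun_prop

@[fun_prop] theorem PrimrecComp.incWeight {α : Type*} [Primcodable α] {f g : α → ℕ}
    (hf : Primrec f) (hg : Primrec g) : Primrec (fun x => incWeight (f x) (g x)) := by
  unfold LangFam.incWeight; fun_prop

@[fun_prop] theorem PrimrecComp.decWeight {α : Type*} [Primcodable α] {f g : α → ℕ}
    (hf : Primrec f) (hg : Primrec g) : Primrec (fun x => decWeight (f x) (g x)) := by
  unfold LangFam.decWeight; fun_prop

@[fun_prop] theorem PrimrecComp.slackWeight {α : Type*} [Primcodable α] {f g : α → ℕ}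
    (hf : Primrec f) (hg : Primrec g) : Primrec (fun x => slackWeight (f x) (g x)) := by
  unfold LangFam.slackWeight; fun_prop

@[fun_prop] theorem PrimrecComp.lambdaEdges {α : Type*} [Primcodable α] {f g : α → ℕ}
    (hf : Primrec f) (hg : Primrec g) : Primrec (fun x => lambdaEdges (f x) (g x)) := by
  unfold LangFam.lambdaEdges Stage.code; fun_prop

@[fun_prop] theorem PrimrecComp.letterEdges {α : Type*} [Primcodable α] {f g h : α → ℕ}
    {b : α → Bool × Option Bool} (hf : Primrec f) (hg : Primrec g) (hh : Primrec h)
    (hb : Primrec b) : Primrec (fun x => letterEdges (f x) (g x) (h x) (b x)) := by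
  unfold LangFam.letterEdges Stage.code; fun_prop

@[fun_prop] theorem PrimrecComp.counterAut {α : Type*} [Primcodable α] {f : α → ℕ}
    {g : α → ActionTable} (hf : Primrec f) (hg : Primrec g) :
    Primrec (fun x => counterAut (f x) (g x)) := by
  unfold LangFam.counterAut Stage.code; fun_prop

/-- Each counter needs l + 2 equations, hence 2(l + 2) further coordinates. -/
theorem exists_ncm_code : ∃ G : (CounterMachine × ℕ) × Code → Code, Primrec G ∧
    ∀ M l, M.IsReversalBounded l → ∀ c L d, Represents L (d + M.counters * (2 * (l + 2))) c →
      Represents (L ⊓ M.language) d (G ((M, l), c)) := by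
  obtain ⟨H, hH, hHc⟩ := exists_hom_code
  obtain ⟨I, hI, hIc⟩ := exists_invHom_code
  obtain ⟨R, hR, hRc⟩ := exists_interReg_code
  obtain ⟨B, hB, hBc⟩ := exists_balanced_code
  refine ⟨fun p => H (p.1.1.labelHom, (List.range p.1.1.counters).foldl
    (fun c i => B ((p.1.2 + 2, counterAut (p.1.2 + 2) (p.1.1.actions i)), c))
    (R (p.1.1.pathNFA, I (p.1.1.labelHom, p.2)))), by fun_prop, fun M l hl c L d hc => ?_⟩
  rw [inter_counterMachine hl]
  refine hHc _ _ _ _ ?_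
  have hfold : ∀ (is : List ℕ) (K : Language ℕ) (c : Code) (e : ℕ),
      Represents K (e + is.length * (2 * (l + 2))) c →
      Represents (is.foldl
        (fun K i => K ⊓ balancedLanguage (l + 2) (counterAut (l + 2) (M.actions i))) K) e
        (is.foldl (fun c i => B ((l + 2, counterAut (l + 2) (M.actions i)), c)) c) := by
    intro is
    induction is with
    | nil => intro K c e h; simpa using h
    | cons i is ih =>
      intro K c e h
      refine ih _ _ _ (hBc _ _ _ _ _ ?_)
      rw [List.length_cons, Nat.succ_mul, ← add_assoc] at h
      exact h
  refine hfold _ _ _ _ ?_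
  rw [List.length_range]
  exact hRc _ _ _ _ (hIc _ _ _ _ hc)

/-! ### Spelling transitions as words -/

/-- The word, without its first letter `2`, that spells a transition with the given label and
weight: the letter `3 * a` stands for the label `a`, the letter `3 * i + 1` for a unit of
coordinate `i`. -/
def spelling (a : Option ℕ) (u : List ℕ) : List ℕ :=
  (a.toList.map fun x => 3 * x) ++
    (List.range u.length).flatMap fun i => (List.range (u.getD i 0)).map fun _ => 3 * i + 1

/-- The label spelled by a letter. -/
def labelOf (x : ℕ) : List ℕ := if x % 3 = 0 then [x / 3] else []

/-- The weight spelled by a word with the given Parikh vector. -/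
def weightHom : (ℕ → ℕ) →+ (ℕ → ℕ) where
  toFun v i := v (3 * i + 1)
  map_zero' := rfl
  map_add' _ _ := rfl

/-- As 3i + 1 ≥ i, the image of a list needs no more coordinates than the list has. -/
theorem vec_weight (l : List ℕ) :
    vec ((List.range l.length).map fun i => l.getD (3 * i + 1) 0) = weightHom (vec l) := by
  funext i
  change _ = vec l (3 * i + 1)
  by_cases h : i < l.length
  · rw [vec_map_range h]
    rfl
  · rw [vec, vec, List.getD_eq_default _ _ (by simpa using h),
      List.getD_eq_default _ _ (by omega)]

theorem parikh_append (w₁ w₂ : List ℕ) : parikh (w₁ ++ w₂) = parikh w₁ + parikh w₂ := by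
  funext i
  simp [parikh]

theorem flatMap_labelOf_spelling (a : Option ℕ) (u : List ℕ) :
    (2 :: spelling a u).flatMap labelOf = a.toList := by
  have h1 : labelOf 2 = [] := rfl
  have h2 : ∀ x, labelOf (3 * x) = [x] := fun x => by
    rw [labelOf, if_pos (by omega), show 3 * x / 3 = x by omega]
  have h3 : ((List.range u.length).flatMap fun i =>
      (List.range (u.getD i 0)).map fun _ => 3 * i + 1).flatMap labelOf = [] := by
    simp only [List.flatMap_eq_nil_iff, List.mem_flatMap, List.mem_map]
    rintro _ ⟨i, _, _, _, rfl⟩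
    rw [labelOf, if_neg (by omega)]
  rw [List.flatMap_cons, h1, List.nil_append, spelling, List.flatMap_append, h3,
    List.append_nil]
  cases a <;> simp [h2]

/-- The initial 2 and the label letters, which are multiples of 3, do not interfere with the letters
3i + 1. -/
theorem weightHom_spelling (a : Option ℕ) (u : List ℕ) :
    weightHom (parikh (2 :: spelling a u)) = vec u := by
  funext i
  change List.count (3 * i + 1) (2 :: spelling a u) = u.getD i 0
  rw [List.count_cons_of_ne (by omega), spelling, List.count_append]
  have h1 : List.count (3 * i + 1) (a.toList.map fun x => 3 * x) = 0 := by
    rw [List.count_eq_zero]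
    simp only [List.mem_map, not_exists, not_and]
    intro x _
    omega
  rw [h1, zero_add, List.count_flatMap]
  have h2 : (List.count (3 * i + 1) ∘ fun j => (List.range (u.getD j 0)).map fun _ => 3 * j + 1) =
      fun j => if j = i then u.getD i 0 else 0 := by
    funext j
    simp only [Function.comp_apply, List.map_const', List.length_range, List.count_replicate]
    by_cases h : j = i
    · simp [h]
    · rw [if_neg h, if_neg (by simpa using h)]
  rw [h2]
  by_cases h : i < u.length
  · rw [← List.sum_toFinset _ List.nodup_range]
    simp [h]
  · rw [List.getD_eq_default _ _ (by omega)]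
    simp

theorem mem_spelling {a : Option ℕ} {u : List ℕ} {x : ℕ} (h : x ∈ spelling a u) :
    (∃ b, x = 3 * b) ∨ ∃ i < u.length, x = 3 * i + 1 := by
  simp only [spelling, List.mem_append, List.mem_map, List.mem_flatMap, List.mem_range] at h
  rcases h with ⟨b, _, rfl⟩ | ⟨i, hi, _, _, rfl⟩
  exacts [Or.inl ⟨b, rfl⟩, Or.inr ⟨i, hi, rfl⟩]

/-- The finite automaton that accepts the spellings of the accepting paths of `A`. -/
def spellNFA (A : WAut) : NFACode :=
  ⟨[pairState A.1 []], [pairState A.2.1 []], A.2.2.flatMap fun t =>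
    (pairState t.1 [], 2, pairState t.2.2.2 (spelling t.2.1 t.2.2.1)) ::
      (suffixList [spelling t.2.1 t.2.2.1]).flatMap fun u =>
        u.head?.elim [] fun x => [(pairState t.2.2.2 u, x, pairState t.2.2.2 u.tail)]⟩

theorem mem_spellNFA {A : WAut} {p x p' : ℕ} : (p, x, p') ∈ (spellNFA A).trans ↔
    ∃ q a wt q', (q, a, wt, q') ∈ A.2.2 ∧
      ((p = pairState q [] ∧ x = 2 ∧ p' = pairState q' (spelling a wt)) ∨
      ∃ u, x :: u ∈ suffixList [spelling a wt] ∧ p = pairState q' (x :: u) ∧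
        p' = pairState q' u) := by
  simp only [spellNFA, List.mem_flatMap, List.mem_cons, Prod.mk.injEq, Prod.exists]
  refine exists₄_congr fun q a wt q' => and_congr_right fun _ => or_congr_right ?_
  constructor
  · rintro ⟨_ | ⟨y, u⟩, hu, h⟩
    · simp at h
    · simp only [List.head?_cons, Option.elim_some, List.tail_cons, List.mem_singleton,
        Prod.mk.injEq] at h
      obtain ⟨rfl, rfl, rfl⟩ := h
      exact ⟨u, hu, rfl, rfl⟩
  · rintro ⟨u, hu, rfl, rfl⟩
    exact ⟨x :: u, hu, by simp⟩

/-- A state carries the part of the current spelling still to be read; only with nothing left may a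
new transition be started by the letter 2. -/
theorem spellNFA_sound {A : WAut} {p p' : ℕ} {w : List ℕ} (h : NFAPath (spellNFA A) p w p')
    {q f : ℕ} {u : List ℕ} (hp : p = pairState q u) (hp' : p' = pairState f []) :
    ∃ w', w = u ++ w' ∧ WRun A.2.2 q (w'.flatMap labelOf) (weightHom (parikh w')) f := by
  induction h generalizing q u with
  | nil =>
    subst hp
    obtain ⟨rfl, rfl⟩ := pairState_inj.1 hp'
    exact ⟨[], rfl, WRun.nil _⟩
  | cons ht _ ih =>
    obtain ⟨q₀, a, wt, q', hmem, ⟨rfl, rfl, rfl⟩ | ⟨v, _, rfl, rfl⟩⟩ := mem_spellNFA.1 ht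
    · obtain ⟨rfl, rfl⟩ := pairState_inj.1 hp
      obtain ⟨w', rfl, hr⟩ := ih rfl hp'
      refine ⟨_, rfl, ?_⟩
      rw [← List.cons_append, List.flatMap_append, flatMap_labelOf_spelling, parikh_append,
        map_add, weightHom_spelling]
      exact WRun.cons hmem hr
    · obtain ⟨rfl, rfl⟩ := pairState_inj.1 hp
      obtain ⟨w', rfl, hr⟩ := ih rfl hp'
      exact ⟨w', rfl, hr⟩

theorem spellNFA_complete {A : WAut} {q f : ℕ} {v : List ℕ} {z : ℕ → ℕ}
    (h : WRun A.2.2 q v z f) :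
    ∃ w, NFAPath (spellNFA A) (pairState q []) w (pairState f []) ∧ w.flatMap labelOf = v ∧
      weightHom (parikh w) = z := by
  induction h with
  | nil q => exact ⟨[], .nil _, rfl, rfl⟩
  | @cons q a wt q' v z f ht _ ih =>
    obtain ⟨w, hw, rfl, rfl⟩ := ih
    refine ⟨2 :: spelling a wt ++ w, ?_, ?_, ?_⟩
    · refine .cons (mem_spellNFA.2 ⟨q, a, wt, q', ht, Or.inl ⟨rfl, rfl, rfl⟩⟩) ?_
      have : ∀ u, u ∈ suffixList [spelling a wt] →
          NFAPath (spellNFA A) (pairState q' u) (u ++ w) (pairState f []) := by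
        intro u
        induction u with
        | nil => exact fun _ => hw
        | cons x u ih =>
          exact fun hu => .cons (mem_spellNFA.2 ⟨q, a, wt, q', ht, Or.inr ⟨u, hu, rfl, rfl⟩⟩)
            (ih (suffixList_tail hu))
      exact this _ (mem_suffixList.2 (Or.inr ⟨_, List.mem_singleton_self _, List.suffix_rfl⟩))
    · rw [List.flatMap_append, flatMap_labelOf_spelling]
    · rw [parikh_append, map_add, weightHom_spelling]

theorem NFAPath.mem_letters {A : NFACode} {q r : ℕ} {w : List ℕ} (h : NFAPath A q w r) {x : ℕ}
    (hx : x ∈ w) : ∃ p p', (p, x, p') ∈ A.trans := by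
  induction h with
  | nil => simp at hx
  | cons ht _ ih =>
    rcases List.mem_cons.1 hx with rfl | hx
    exacts [⟨_, _, ht⟩, ih hx]

/-- Spelling turns weights into numbers of occurrences, so a query becomes a Parikh image. The
alphabet S is left open: it may be built from `A`, or fixed in advance so as to suffice for all
automata of a given dimension. -/
theorem values_eq_image {A : WAut} {L : Language ℕ} {S : Finset ℕ} {g : ℕ → List ℕ}
    (hg : ∀ x ∈ S, g x = labelOf x)
    (hS : ∀ p x p' v, (p, x, p') ∈ (spellNFA A).trans → v ∈ L → labelOf x ⊆ v → x ∈ S) :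
    values A L = weightHom '' parikhImage (homPreimage S g L ⊓ (spellNFA A).language) := by
  have hflat : ∀ w : List ℕ, (∀ a ∈ w, a ∈ S) → w.flatMap g = w.flatMap labelOf :=
    fun w hw => List.flatMap_congr fun x hx => hg x (hw x hx)
  ext z
  constructor
  · rintro ⟨v, hv, hr⟩
    obtain ⟨w, hw, rfl, rfl⟩ := spellNFA_complete hr
    have hwS : ∀ a ∈ w, a ∈ S := fun a ha => by
      obtain ⟨p, p', h⟩ := hw.mem_letters ha
      exact hS p a p' _ h hv fun b hb => List.mem_flatMap.2 ⟨a, ha, hb⟩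
    refine ⟨_, ⟨w, ⟨⟨hwS, ?_⟩, ?_⟩, rfl⟩, rfl⟩
    · rw [hflat w hwS]
      exact hv
    · exact mem_nfa_language.2
        ⟨_, List.mem_singleton_self _, _, List.mem_singleton_self _, hw⟩
  · rintro ⟨_, ⟨w, ⟨⟨hwS, hL⟩, hN⟩, rfl⟩, rfl⟩
    obtain ⟨s, hs, f, hf, hp⟩ := mem_nfa_language.1 hN
    obtain rfl := List.mem_singleton.1 hs
    obtain rfl := List.mem_singleton.1 hf
    obtain ⟨_, rfl, hr⟩ := spellNFA_sound hp rfl rfl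
    rw [hflat _ hwS] at hL
    exact ⟨_, hL, hr⟩

/-! ### Programs for the languages of the original family -/

@[fun_prop] theorem PrimrecComp.spelling {α : Type*} [Primcodable α] {f : α → Option ℕ}
    {g : α → List ℕ} (hf : Primrec f) (hg : Primrec g) :
    Primrec (fun x => spelling (f x) (g x)) := by
  unfold LangFam.spelling; fun_prop

@[fun_prop] theorem PrimrecComp.labelOf {α : Type*} [Primcodable α] {f : α → ℕ}
    (hf : Primrec f) : Primrec (fun x => labelOf (f x)) := by
  unfold LangFam.labelOf; fun_prop

@[fun_prop] theorem PrimrecComp.spellNFA {α : Type*} [Primcodable α] {f : α → WAut}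
    (hf : Primrec f) : Primrec (fun x => spellNFA (f x)) := by
  unfold LangFam.spellNFA; fun_prop

/-- The table of the labels of the letters that occur in spellings of paths of `A`. -/
def labelTable (A : WAut) : HomCode := (spellNFA A).trans.map fun t => (t.2.1, labelOf t.2.1)

@[fun_prop] theorem PrimrecComp.labelTable {α : Type*} [Primcodable α] {f : α → WAut}
    (hf : Primrec f) : Primrec (fun x => labelTable (f x)) := by
  unfold LangFam.labelTable; fun_prop

theorem values_labelTable (A : WAut) (L : Language ℕ) : values A L = weightHom ''
    parikhImage (homPreimage (labelTable A).dom (labelTable A).fn L ⊓ (spellNFA A).language) := by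
  refine values_eq_image (fun x hx => ?_) fun p x p' v h _ _ => ?_
  · obtain ⟨u, hu⟩ := mem_dom_iff.1 hx
    obtain ⟨t, _, h⟩ := List.mem_map.1 (lookup_eq_some_mem hu)
    simp only [Prod.mk.injEq] at h
    obtain ⟨rfl, rfl⟩ := h
    rw [HomCode.fn, hu]
    rfl
  · rw [HomCode.dom, List.mem_toFinset, labelTable, List.map_map]
    exact List.mem_map.2 ⟨_, h, rfl⟩

/-- A bound for the coordinates that occur in a semilinear set. -/
def coordBound (s : SemilinearCode) : ℕ := (s.flatMap fun p => p.1 ++ p.2.flatten).length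

@[fun_prop] theorem PrimrecComp.coordBound {α : Type*} [Primcodable α] {f : α → SemilinearCode}
    (hf : Primrec f) : Primrec (fun x => coordBound (f x)) := by
  unfold LangFam.coordBound; fun_prop

theorem eq_zero_of_coordBound_le {s : SemilinearCode} {v : ℕ → ℕ} (hv : v ∈ s.toSet) {i : ℕ}
    (hi : coordBound s ≤ i) : v i = 0 := by
  obtain ⟨p, hp, u, hu, rfl⟩ := mem_toSet.1 hv
  have hle : ∀ l : List ℕ, l.length ≤ (p.1 ++ p.2.flatten).length → vec l i = 0 := by
    intro l hl
    rw [vec, List.getD_eq_default]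
    refine hl.trans (le_trans ?_ hi)
    rw [coordBound, List.length_flatMap]
    exact List.single_le_sum (by simp) _ (List.mem_map.2 ⟨p, hp, rfl⟩)
  have hper : u i = 0 := by
    clear hv
    induction hu using AddSubmonoid.closure_induction with
    | mem x hx =>
      obtain ⟨q, hq, rfl⟩ := hx
      refine hle q ?_
      have := List.single_le_sum (l := p.2.map List.length) (by simp) _
        (List.mem_map.2 ⟨q, hq, rfl⟩)
      rw [List.length_append, List.length_flatten]
      omega
    | zero => rfl
    | add x y _ _ hx hy => simp [hx, hy]
  rw [Pi.add_apply, hper, hle p.1 (by simp)]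

/-- A letter that occurs gives a nonzero Parikh coordinate, so the code of the Parikh image also
bounds the alphabet. -/
theorem lt_coordBound {s : SemilinearCode} {L : Language ℕ} (h : parikhImage L = s.toSet)
    {w : List ℕ} (hw : w ∈ L) {a : ℕ} (ha : a ∈ w) : a < coordBound s := by
  by_contra hn
  have hm : parikh w ∈ s.toSet := by
    rw [← h]
    exact ⟨w, hw, rfl⟩
  have := eq_zero_of_coordBound_le hm (not_lt.1 hn)
  exact (List.count_pos_iff.2 ha).ne' this

/-- Image of the code of a semilinear set under `weightHom`. -/
def weightCode (s : SemilinearCode) : SemilinearCode :=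
  mapCode (fun l => (List.range l.length).map fun i => l.getD (3 * i + 1) 0) s

@[fun_prop] theorem PrimrecComp.weightCode {α : Type*} [Primcodable α] {f : α → SemilinearCode}
    (hf : Primrec f) : Primrec (fun x => weightCode (f x)) := by
  unfold LangFam.weightCode; fun_prop

theorem toSet_weightCode (s : SemilinearCode) : (weightCode s).toSet = weightHom '' s.toSet :=
  toSet_mapCode vec_weight s

section Base

variable {C : Type*} [Primcodable C] {D : Set C} {ν : C → Language ℕ}

/-- The alphabet of the inverse homomorphism is computed from each query, so one program handles all
dimensions and depends effectively on the description. -/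
theorem exists_base_code (hsl : EffectivelySemilinear D ν) (hreg : EffectiveInterRegular D ν)
    (hinv : EffectiveInvHom D ν) : ∃ G : C → Code, Primrec G ∧
      ∀ c ∈ D, ∀ d, Represents (ν c) d (G c) := by
  obtain ⟨f, hf, hfc⟩ := hsl
  obtain ⟨g, hg, hgc⟩ := hreg
  obtain ⟨h, hh, hhc⟩ := hinv
  have hpart : Partrec fun p : C × WAut => (f p.1).bind fun s =>
      (h (p.1, labelTable p.2)).bind fun c₁ => (g (c₁, spellNFA p.2)).bind fun c₂ =>
        (f c₂).map fun s₂ => ((List.range (coordBound s), weightCode s₂) : Answer) := by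
    refine Partrec.bind (hf.comp (by exact Primrec.to_comp (by fun_prop))) ?_
    refine Partrec.bind (hh.comp (by exact Primrec.to_comp (by fun_prop))) ?_
    refine Partrec.bind (hg.comp (by exact Primrec.to_comp (by fun_prop))) ?_
    refine Partrec.map (hf.comp (by exact Primrec.to_comp (by fun_prop))) ?_
    exact Primrec.to_comp (by fun_prop)
  obtain ⟨G, hG, hGq⟩ := exists_code hpart
  refine ⟨G, hG, fun c hc d A _ => ?_⟩
  obtain ⟨s, hs, hsL⟩ := hfc c hc
  obtain ⟨c₁, h₁, hD₁, hν₁⟩ := hhc c hc (labelTable A)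
  obtain ⟨c₂, h₂, hD₂, hν₂⟩ := hgc c₁ hD₁ (spellNFA A)
  obtain ⟨s₂, hs₂, hsL₂⟩ := hfc c₂ hD₂
  refine ⟨(List.range (coordBound s), weightCode s₂), ?_, ?_, ?_⟩
  · rw [hGq]
    exact Part.mem_bind hs (Part.mem_bind h₁ (Part.mem_bind h₂ (Part.mem_map _ hs₂)))
  · exact fun w hw a ha => List.mem_range.2 (lt_coordBound hsL hw ha)
  · rw [toSet_weightCode, ← hsL₂, hν₂, hν₁, values_labelTable]

/-- The full trio contains the inverse image under one homomorphism on a sufficiently large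
alphabet; a description of it is built into the program without having been computed. Only
intersection and Parikh images are then computed for each query. -/
theorem exists_base_code_of_mem {F : Set (Language ℕ)} (hF : F = {L | ∃ c ∈ D, ν c = L})
    (htrio : IsFullTrio F) (hsl : EffectivelySemilinear D ν)
    (hreg : EffectiveInterRegular D ν) {c : C} (hc : c ∈ D) (d : ℕ) :
    ∃ k : Code, Represents (ν c) d k := by
  obtain ⟨f, hf, hfc⟩ := hsl
  obtain ⟨g, hg, hgc⟩ := hreg
  have hmem : ν c ∈ F := hF ▸ ⟨c, hc, rfl⟩
  obtain ⟨s, hs, hsL⟩ := hfc c hc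
  -- This contains 2, the letters 3b for labels b that occur in the language, and the letters 3i + 1
  -- for coordinates i < d. Labels of `A` outside the alphabet of the language may be left out.
  set S := Finset.range (3 * (coordBound s + d) + 3) with hS
  have hinv := htrio.invHom _ hmem S labelOf
  rw [hF] at hinv
  obtain ⟨c₀, hc₀, hν₀⟩ := hinv
  have hpart : Partrec fun p : Unit × WAut => (g (c₀, spellNFA p.2)).bind fun c₂ =>
      (f c₂).map fun s₂ => ((List.range (coordBound s), weightCode s₂) : Answer) := by
    refine Partrec.bind (hg.comp (by exact Primrec.to_comp (by fun_prop))) ?_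
    refine Partrec.map (hf.comp (by exact Primrec.to_comp (by fun_prop))) ?_
    exact Primrec.to_comp (by fun_prop)
  obtain ⟨G, -, hGq⟩ := exists_code hpart
  refine ⟨G (), fun A hA => ?_⟩
  obtain ⟨c₂, h₂, hD₂, hν₂⟩ := hgc c₀ hc₀ (spellNFA A)
  obtain ⟨s₂, hs₂, hsL₂⟩ := hfc c₂ hD₂
  refine ⟨(List.range (coordBound s), weightCode s₂), ?_, ?_, ?_⟩
  · rw [hGq]
    exact Part.mem_bind h₂ (Part.mem_map _ hs₂)
  · exact fun w hw a ha => List.mem_range.2 (lt_coordBound hsL hw ha)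
  · rw [toSet_weightCode, ← hsL₂, hν₂, hν₀]
    refine (values_eq_image (fun _ _ => rfl) fun p x p' v h hv hx => ?_).symm
    rw [hS, Finset.mem_range]
    have hx' : x = 2 ∨ (∃ b, x = 3 * b) ∨ ∃ i < d, x = 3 * i + 1 := by
      obtain ⟨q, a, wt, q', ht, ⟨-, rfl, -⟩ | ⟨u, hu, -, -⟩⟩ := mem_spellNFA.1 h
      · exact Or.inl rfl
      · rcases mem_suffixList.1 hu with hu | ⟨y, hy, hu⟩
        · simp at hu
        · obtain rfl := List.mem_singleton.1 hy
          rcases mem_spelling (hu.subset List.mem_cons_self) with h | ⟨i, hi, rfl⟩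
          · exact Or.inr (Or.inl h)
          · exact Or.inr (Or.inr ⟨i, hi.trans_le (hA _ ht), rfl⟩)
    rcases hx' with rfl | ⟨b, rfl⟩ | ⟨i, hi, rfl⟩
    · omega
    · have : b ∈ v := hx (by rw [labelOf, if_pos (by omega)]; simp)
      have := lt_coordBound hsL hv this
      omega
    · omega

end Base

/-! ### Programs for expressions -/

section Expressions

variable {C : Type*} {D : Set C} {ν : C → Language ℕ}

theorem exists_expr_code (hbase : ∀ c ∈ D, ∀ d, ∃ k : Code, Represents (ν c) d k)
    (e : Expr C) (he : e.Valid D) (d : ℕ) : ∃ k : Code, Represents (e.eval ν) d k := by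
  induction e generalizing d with
  | base c => exact hbase c he d
  | hom h e ih =>
    obtain ⟨k, hk⟩ := ih he d
    obtain ⟨G, -, hG⟩ := exists_hom_code
    exact ⟨_, hG h k _ d hk⟩
  | invHom h e ih =>
    obtain ⟨k, hk⟩ := ih he d
    obtain ⟨G, -, hG⟩ := exists_invHom_code
    exact ⟨_, hG h k _ d hk⟩
  | interReg A e ih =>
    obtain ⟨k, hk⟩ := ih he d
    obtain ⟨G, -, hG⟩ := exists_interReg_code
    exact ⟨_, hG A k _ d hk⟩
  | interNCM M l e ih =>
    obtain ⟨G, -, hG⟩ := exists_ncm_code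
    obtain ⟨k, hk⟩ := ih he.2 (d + M.counters * (2 * (l + 2)))
    exact ⟨_, hG M l he.1 k _ d hk⟩
  | union e₁ e₂ ih₁ ih₂ =>
    obtain ⟨k₁, hk₁⟩ := ih₁ he.1 d
    obtain ⟨k₂, hk₂⟩ := ih₂ he.2 d
    obtain ⟨G, -, hG⟩ := exists_union_code
    exact ⟨_, hG k₁ k₂ _ _ d hk₁ hk₂⟩
  | concat e₁ e₂ ih₁ ih₂ =>
    obtain ⟨k₁, hk₁⟩ := ih₁ he.1 (d + 2)
    obtain ⟨k₂, hk₂⟩ := ih₂ he.2 (d + 2)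
    obtain ⟨G, -, hG⟩ := exists_concat_code
    exact ⟨_, hG k₁ k₂ _ _ d hk₁ hk₂⟩
  | star e ih =>
    obtain ⟨k, hk⟩ := ih he (d + 2)
    obtain ⟨G, -, hG⟩ := exists_star_code
    exact ⟨_, hG k _ d hk⟩

/-- The postfix form is evaluated on a stack of programs, each token applying the matching
combinator to the top entries. -/
theorem exists_tokens_code [Primcodable C] {B : C → Code} (hB : Primrec B)
    (hbase : ∀ c ∈ D, ∀ d, Represents (ν c) d (B c)) :
    ∃ G : List (Token C) → Code, Primrec G ∧
      ∀ e : Expr C, e.Valid D → ∀ d, Represents (e.eval ν) d (G e.tokens) := by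
  obtain ⟨H, hH, hHc⟩ := exists_hom_code
  obtain ⟨I, hI, hIc⟩ := exists_invHom_code
  obtain ⟨R, hR, hRc⟩ := exists_interReg_code
  obtain ⟨N, hN, hNc⟩ := exists_ncm_code
  obtain ⟨U, hU, hUc⟩ := exists_union_code
  obtain ⟨K, hK, hKc⟩ := exists_concat_code
  obtain ⟨S, hS, hSc⟩ := exists_star_code
  let z : Code := Code.zero
  -- The first operand was pushed earlier, so it is at position 1. The default program is never
  -- reached on the postfix form of an expression.
  obtain ⟨last, hlast, hlast'⟩ : ∃ f : List Code × Fin 3 → List Code, Primrec f ∧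
      ∀ st i, f (st, i) =
        if i = 0 then U (st.getD 1 z, st.getD 0 z) :: st.tail.tail
        else if i = 1 then K (st.getD 1 z, st.getD 0 z) :: st.tail.tail
        else S (st.getD 0 z) :: st.tail :=
    ⟨fun p => if p.2 = 0 then U (p.1.getD 1 z, p.1.getD 0 z) :: p.1.tail.tail
      else if p.2 = 1 then K (p.1.getD 1 z, p.1.getD 0 z) :: p.1.tail.tail
      else S (p.1.getD 0 z) :: p.1.tail,
      PrimrecComp.ite_eq (by fun_prop) (by fun_prop) (by fun_prop)
        (PrimrecComp.ite_eq (by fun_prop) (by fun_prop) (by fun_prop) (by fun_prop)),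
      fun _ _ => rfl⟩
  let step : List Code → Token C → List Code := fun st t =>
    t.elim (fun c => B c :: st) fun t =>
    t.elim (fun h => H (h, st.getD 0 z) :: st.tail) fun t =>
    t.elim (fun h => I (h, st.getD 0 z) :: st.tail) fun t =>
    t.elim (fun A => R (A, st.getD 0 z) :: st.tail) fun t =>
    t.elim (fun M => N (M, st.getD 0 z) :: st.tail) fun i => last (st, i)
  have hstep : Primrec fun p : List (Token C) × List Code × Token C => step p.2.1 p.2.2 := by
    refine PrimrecComp.sumElim (by fun_prop) (by fun_prop) ?_
    refine PrimrecComp.sumElim (by fun_prop) (by fun_prop) ?_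
    refine PrimrecComp.sumElim (by fun_prop) (by fun_prop) ?_
    refine PrimrecComp.sumElim (by fun_prop) (by fun_prop) ?_
    refine PrimrecComp.sumElim (by fun_prop) (by fun_prop) ?_
    exact hlast.comp (by fun_prop)
  refine ⟨fun ts => (ts.foldl step []).getD 0 z, by fun_prop, fun e he => ?_⟩
  -- The program must serve all dimensions at once, because subexpressions are asked in higher
  -- dimensions than the whole.
  have key : ∀ e : Expr C, e.Valid D → ∃ k, (∀ d, Represents (e.eval ν) d k) ∧
      ∀ st, e.tokens.foldl step st = k :: st := by
    intro e
    induction e with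
    | base c => exact fun he => ⟨_, hbase c he, fun st => rfl⟩
    | hom h e ih =>
      intro he
      obtain ⟨k, hk, hst⟩ := ih he
      refine ⟨_, fun d => hHc h k _ d (hk d), fun st => ?_⟩
      rw [Expr.tokens, List.foldl_append, hst]
      rfl
    | invHom h e ih =>
      intro he
      obtain ⟨k, hk, hst⟩ := ih he
      refine ⟨_, fun d => hIc h k _ d (hk d), fun st => ?_⟩
      rw [Expr.tokens, List.foldl_append, hst]
      rfl
    | interReg A e ih =>
      intro he
      obtain ⟨k, hk, hst⟩ := ih he
      refine ⟨_, fun d => hRc A k _ d (hk d), fun st => ?_⟩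
      rw [Expr.tokens, List.foldl_append, hst]
      rfl
    | interNCM M l e ih =>
      intro he
      obtain ⟨k, hk, hst⟩ := ih he.2
      refine ⟨_, fun d => hNc M l he.1 k _ d (hk _), fun st => ?_⟩
      rw [Expr.tokens, List.foldl_append, hst]
      rfl
    | union e₁ e₂ ih₁ ih₂ =>
      intro he
      obtain ⟨k₁, hk₁, hst₁⟩ := ih₁ he.1
      obtain ⟨k₂, hk₂, hst₂⟩ := ih₂ he.2
      refine ⟨_, fun d => hUc k₁ k₂ _ _ d (hk₁ d) (hk₂ d), fun st => ?_⟩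
      rw [Expr.tokens, List.foldl_append, List.foldl_append, hst₁, hst₂]
      exact hlast' _ _
    | concat e₁ e₂ ih₁ ih₂ =>
      intro he
      obtain ⟨k₁, hk₁, hst₁⟩ := ih₁ he.1
      obtain ⟨k₂, hk₂, hst₂⟩ := ih₂ he.2
      refine ⟨_, fun d => hKc k₁ k₂ _ _ d (hk₁ _) (hk₂ _), fun st => ?_⟩
      rw [Expr.tokens, List.foldl_append, List.foldl_append, hst₁, hst₂]
      exact hlast' _ _
    | star e ih =>
      intro he
      obtain ⟨k, hk, hst⟩ := ih he
      refine ⟨_, fun d => hSc k _ d (hk _), fun st => ?_⟩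
      rw [Expr.tokens, List.foldl_append, hst]
      exact hlast' _ _
  obtain ⟨k, hk, hst⟩ := key e he
  intro d
  simp only [hst, List.getD_cons_zero]
  exact hk d

end Expressions

/-! ### Decision problems -/

/-- The automaton that accepts only `w`. -/
def wordAut (w : List ℕ) : WAut :=
  (0, w.length, (List.range w.length).flatMap fun i =>
    (w[i]?).elim [] fun x => [(i, some x, [], i + 1)])

theorem mem_wordAut {w : List ℕ} {e : ℕ × Option ℕ × List ℕ × ℕ} :
    e ∈ (wordAut w).2.2 ↔ ∃ i x, w[i]? = some x ∧ e = (i, some x, [], i + 1) := by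
  simp only [wordAut, List.mem_flatMap, List.mem_range]
  constructor
  · rintro ⟨i, hi, h⟩
    rw [List.getElem?_eq_getElem hi, Option.elim_some, List.mem_singleton] at h
    exact ⟨i, _, List.getElem?_eq_getElem hi, h⟩
  · rintro ⟨i, x, hx, rfl⟩
    exact ⟨i, (List.getElem?_eq_some_iff.1 hx).1, by simp [hx]⟩

theorem wordAut_sound {w v : List ℕ} {p r : ℕ} {z : ℕ → ℕ}
    (h : WRun (wordAut w).2.2 p v z r) (hr : r = w.length) : v = w.drop p := by
  induction h with
  | nil => rw [hr, List.drop_length]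
  | cons ht _ ih =>
    obtain ⟨i, x, hx, he⟩ := mem_wordAut.1 ht
    simp only [Prod.mk.injEq] at he
    obtain ⟨rfl, rfl, rfl, rfl⟩ := he
    obtain ⟨hi, rfl⟩ := List.getElem?_eq_some_iff.1 hx
    rw [ih hr, List.drop_eq_getElem_cons hi]
    rfl

theorem wordAut_complete {w : List ℕ} (v : List ℕ) (p : ℕ) (hv : v = w.drop p)
    (hp : p ≤ w.length) : WRun (wordAut w).2.2 p v 0 w.length := by
  induction v generalizing p with
  | nil =>
    have := List.drop_eq_nil_iff.1 hv.symm
    obtain rfl : p = w.length := by omega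
    exact WRun.nil _
  | cons x v ih =>
    have hlt : p < w.length := by
      by_contra hn
      rw [List.drop_eq_nil_of_le (not_lt.1 hn)] at hv
      cases hv
    rw [List.drop_eq_getElem_cons hlt] at hv
    obtain ⟨rfl, hv'⟩ := List.cons.inj hv
    have := WRun.read (mem_wordAut.2 ⟨p, w[p], List.getElem?_eq_getElem hlt, rfl⟩)
      (ih (p + 1) hv' hlt)
    simpa using this

theorem values_wordAut_nonempty {w : List ℕ} {L : Language ℕ} :
    (values (wordAut w) L).Nonempty ↔ w ∈ L := by
  constructor
  · rintro ⟨z, v, hv, hr⟩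
    have := wordAut_sound hr rfl
    rw [show (wordAut w).1 = 0 from rfl, List.drop_zero] at this
    rwa [this] at hv
  · exact fun h => ⟨0, w, h, wordAut_complete w 0 rfl (Nat.zero_le _)⟩

/-- The automaton with one state that accepts all words over `S`, each letter having
weight `u`. -/
def loopAut (u S : List ℕ) : WAut := (0, 0, S.map fun a => (0, some a, u, 0))

theorem loopAut_run {u S w : List ℕ} (h : ∀ a ∈ w, a ∈ S) :
    WRun (loopAut u S).2.2 0 w (w.length • vec u) 0 := by
  induction w with
  | nil => simpa using WRun.nil _
  | cons a w ih =>
    have hm : (0, some a, u, 0) ∈ (loopAut u S).2.2 :=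
      List.mem_map.2 ⟨a, h a (by simp), rfl⟩
    rw [List.length_cons, succ_nsmul']
    exact WRun.read hm (ih fun b hb => h b (by simp [hb]))

theorem WRun.eq_of_loopAut {u S w : List ℕ} {p r : ℕ} {z : ℕ → ℕ}
    (h : WRun (loopAut u S).2.2 p w z r) : z = w.length • vec u := by
  induction h with
  | nil => simp
  | cons ht _ ih =>
    obtain ⟨a, _, he⟩ := List.mem_map.1 ht
    simp only [Prod.mk.injEq] at he
    obtain ⟨rfl, rfl, rfl, rfl⟩ := he
    rw [ih, Option.toList_some, List.singleton_append, List.length_cons, succ_nsmul']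

theorem mem_values_loopAut {u S : List ℕ} {L : Language ℕ} (hS : ∀ w ∈ L, ∀ a ∈ w, a ∈ S)
    {v : ℕ → ℕ} : v ∈ values (loopAut u S) L ↔ ∃ w ∈ L, v = w.length • vec u := by
  constructor
  · rintro ⟨w, hw, hr⟩
    exact ⟨w, hw, hr.eq_of_loopAut⟩
  · rintro ⟨w, hw, rfl⟩
    exact ⟨w, hw, loopAut_run (hS w hw)⟩

theorem exists_length_eq {S : List ℕ} {L : Language ℕ} (hS : ∀ w ∈ L, ∀ a ∈ w, a ∈ S)
    {s : SemilinearCode} (hs : s.toSet = values (loopAut [1] S) L) {p : LinearCode} (hp : p ∈ s)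
    {q : List ℕ} (hq : q ∈ p.2) (n : ℕ) :
    ∃ w ∈ L, w.length = p.1.getD 0 0 + n * q.getD 0 0 := by
  have hmem : vec p.1 + n • vec q ∈ s.toSet :=
    mem_toSet.2 ⟨p, hp, _, nsmul_mem (vec_mem_periodSpan hq) n, rfl⟩
  rw [hs, mem_values_loopAut hS] at hmem
  obtain ⟨w, hw, h⟩ := hmem
  refine ⟨w, hw, ?_⟩
  have := congrFun h 0
  simpa [vec, eq_comm] using this

/-- Otherwise every length equals one of finitely many constants, and there are only finitely many
words of bounded length over a finite alphabet. -/
theorem exists_period_of_infinite {S : List ℕ} {L : Language ℕ}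
    (hS : ∀ w ∈ L, ∀ a ∈ w, a ∈ S) {s : SemilinearCode}
    (hs : s.toSet = values (loopAut [1] S) L) (hL : Set.Infinite {w : List ℕ | w ∈ L}) :
    ∃ p ∈ s, ∃ q ∈ p.2, q.getD 0 0 ≠ 0 := by
  by_contra! hn
  refine hL ?_
  have hlen : ∀ w ∈ L, w.length ≤ (s.map fun p => p.1.getD 0 0).sum := by
    intro w hw
    have hmem : w.length • vec [1] ∈ s.toSet := by
      rw [hs, mem_values_loopAut hS]
      exact ⟨w, hw, rfl⟩
    obtain ⟨p, hp, u, hu, h⟩ := mem_toSet.1 hmem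
    have hu0 : u 0 = 0 := by
      clear h
      induction hu using AddSubmonoid.closure_induction with
      | mem x hx =>
        obtain ⟨q, hq, rfl⟩ := hx
        exact hn p hp q hq
      | zero => rfl
      | add x y _ _ hx hy => simp [hx, hy]
    have h0 := congrFun h 0
    have : w.length = p.1.getD 0 0 := by simpa [vec, hu0] using h0
    rw [this]
    exact List.single_le_sum (by simp) _ (List.mem_map.2 ⟨p, hp, rfl⟩)
  refine ((List.finite_length_le {a // a ∈ S} (s.map fun p => p.1.getD 0 0).sum).image
    (List.map Subtype.val)).subset fun w hw => ?_
  refine ⟨w.attachWith _ (hS w hw), ?_, by simp⟩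
  simpa using hlen w hw

theorem infinite_iff_exists_period {S : List ℕ} {L : Language ℕ}
    (hS : ∀ w ∈ L, ∀ a ∈ w, a ∈ S) {s : SemilinearCode}
    (hs : s.toSet = values (loopAut [1] S) L) :
    Set.Infinite {w : List ℕ | w ∈ L} ↔ ∃ p ∈ s, ∃ q ∈ p.2, q.getD 0 0 ≠ 0 := by
  refine ⟨exists_period_of_infinite hS hs, ?_⟩
  rintro ⟨p, hp, q, hq, h0⟩
  choose f hf hlen using exists_length_eq hS hs hp hq
  refine Set.infinite_of_injective_forall_mem (f := f) (fun m n hmn => ?_) hf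
  have h := (hlen m).symm.trans ((congrArg _ hmn).trans (hlen n))
  exact Nat.eq_of_mul_eq_mul_right (Nat.pos_of_ne_zero h0) (by omega)

@[fun_prop] theorem PrimrecComp.wordAut {α : Type*} [Primcodable α] {f : α → List ℕ}
    (hf : Primrec f) : Primrec (fun x => wordAut (f x)) := by
  unfold LangFam.wordAut; fun_prop

@[fun_prop] theorem PrimrecComp.loopAut {α : Type*} [Primcodable α] {f g : α → List ℕ}
    (hf : Primrec f) (hg : Primrec g) : Primrec (fun x => loopAut (f x) (g x)) := by
  unfold LangFam.loopAut; fun_prop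

/-- The program for the membership problem. -/
def decideMem (p : Code × List ℕ) : Part Bool :=
  (query p.1 (wordAut p.2)).map fun r => if r.2 = [] then false else true

theorem partrec_decideMem : Partrec decideMem := by
  refine Partrec.map (partrec_query.comp (by exact Primrec.to_comp (by fun_prop))
    (by exact Primrec.to_comp (by fun_prop))) ?_
  exact Primrec.to_comp (by fun_prop)

theorem decideMem_spec {L : Language ℕ} {c : Code} (hc : Represents L 0 c) (w : List ℕ) :
    ∃ b ∈ decideMem (c, w), (b = true ↔ w ∈ L) := by
  obtain ⟨r, hr, -, hs⟩ := hc (wordAut w) (by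
    rintro ⟨_, _, _, _⟩ ht
    obtain ⟨i, x, _, he⟩ := mem_wordAut.1 ht
    simp only [Prod.mk.injEq] at he
    simp [he.2.2.1])
  refine ⟨_, Part.mem_map _ hr, ?_⟩
  rw [← values_wordAut_nonempty, ← hs, Set.nonempty_iff_ne_empty, Ne, toSet_eq_empty]
  split_ifs with h <;> simp [h]

/-- Asks for an alphabet first and then for the weights of all words. -/
def loopQuery (u : List ℕ) (c : Code) : Part SemilinearCode :=
  (query c (0, 0, [])).bind fun r => (query c (loopAut u r.1)).map fun r => r.2

theorem partrec_loopQuery (u : List ℕ) : Partrec (loopQuery u) := by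
  refine Partrec.bind (partrec_query.comp (by exact Primrec.to_comp (by fun_prop))
    (by exact Primrec.to_comp (by fun_prop))) ?_
  refine Partrec.map (partrec_query.comp (by exact Primrec.to_comp (by fun_prop))
    (by exact Primrec.to_comp (by fun_prop))) ?_
  exact Primrec.to_comp (by fun_prop)

/-- The first query, with an automaton without transitions, only reveals an alphabet; the loops of
the second are labelled by it. -/
theorem loopQuery_spec {L : Language ℕ} {c : Code} {u : List ℕ}
    (hc : Represents L u.length c) : ∃ s ∈ loopQuery u c, ∃ S : List ℕ,
      (∀ w ∈ L, ∀ a ∈ w, a ∈ S) ∧ s.toSet = values (loopAut u S) L := by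
  obtain ⟨r₀, h₀, hS, -⟩ := hc (0, 0, []) (by simp)
  obtain ⟨r, hr, -, hs⟩ := hc (loopAut u r₀.1) (by
    intro t ht
    obtain ⟨a, _, rfl⟩ := List.mem_map.1 ht
    exact le_rfl)
  exact ⟨r.2, Part.mem_bind h₀ (Part.mem_map _ hr), r₀.1, hS, hs⟩

section Decidability

variable {C : Type*} [Primcodable C] {D : Set C} {ν : C → Language ℕ}
  {G : List (Token C) → Code}

theorem membershipDecidable (hG : Primrec G)
    (h : ∀ e : Expr C, e.Valid D → ∀ d, Represents (e.eval ν) d (G e.tokens)) :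
    MembershipDecidable D ν := by
  refine ⟨fun p => decideMem (G p.1, p.2), ?_, fun e he w => decideMem_spec (h e he 0) w⟩
  exact partrec_decideMem.comp (by exact Primrec.to_comp (by fun_prop))

theorem emptinessDecidable (hG : Primrec G)
    (h : ∀ e : Expr C, e.Valid D → ∀ d, Represents (e.eval ν) d (G e.tokens)) :
    EmptinessDecidable D ν := by
  refine ⟨fun ts => (loopQuery [] (G ts)).map fun s => if s = [] then true else false, ?_,
    fun e he => ?_⟩
  · refine Partrec.map ((partrec_loopQuery []).comp (by exact Primrec.to_comp (by fun_prop))) ?_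
    exact Primrec.to_comp (by fun_prop)
  · obtain ⟨s, hs, S, hS, hv⟩ := loopQuery_spec (h e he (List.length []))
    refine ⟨_, Part.mem_map _ hs, ?_⟩
    have : s = [] ↔ ∀ w : List ℕ, w ∉ e.eval ν := by
      rw [← toSet_eq_empty, hv, Set.eq_empty_iff_forall_notMem]
      refine ⟨fun H w hw => H _ ((mem_values_loopAut hS).2 ⟨w, hw, rfl⟩), fun H v hv => ?_⟩
      obtain ⟨w, hw, -⟩ := (mem_values_loopAut hS).1 hv
      exact H w hw
    rw [← this]
    split_ifs with hs' <;> simp [hs']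

theorem infinitenessDecidable (hG : Primrec G)
    (h : ∀ e : Expr C, e.Valid D → ∀ d, Represents (e.eval ν) d (G e.tokens)) :
    InfinitenessDecidable D ν := by
  -- The inner list gets one entry for each period with nonzero length, so its emptiness is a
  -- computable test for the absence of such periods.
  refine ⟨fun ts => (loopQuery [1] (G ts)).map fun s =>
    if (s.flatMap fun p => p.2.flatMap fun q => if q.getD 0 0 = 0 then [] else [0]) = []
      then false else true, ?_, fun e he => ?_⟩
  · refine Partrec.map ((partrec_loopQuery [1]).comp (by exact Primrec.to_comp (by fun_prop))) ?_
    exact Primrec.to_comp (by fun_prop)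
  · obtain ⟨s, hs, S, hS, hv⟩ := loopQuery_spec (h e he (List.length [1]))
    refine ⟨_, Part.mem_map _ hs, ?_⟩
    rw [infinite_iff_exists_period hS hv]
    have : (s.flatMap fun p => p.2.flatMap fun q => if q.getD 0 0 = 0 then [] else [0]) = [] ↔
        ¬ ∃ p ∈ s, ∃ q ∈ p.2, q.getD 0 0 ≠ 0 := by
      simp only [List.flatMap_eq_nil_iff, ite_eq_left_iff, List.cons_ne_nil, imp_false,
        not_not, not_exists, not_and]
    split_ifs with hs'
    · simpa using this.1 hs'
    · simpa using (not_iff_not.2 this).1 hs'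

end Decidability

/-! ### Recursive languages -/

/-- The program halts on every word, so it computes the characteristic function; the alphabet in its
answers supplies the finite alphabet. -/
theorem mem_recursiveLanguages {L : Language ℕ} {c : Code} (hc : Represents L 0 c) :
    L ∈ recursiveLanguages := by
  classical
  refine ⟨?_, ComputablePred.computable_iff.2 ⟨fun w => decide (w ∈ L), ?_, by simp⟩⟩
  · obtain ⟨r, -, hS, -⟩ := hc (0, 0, []) (by simp)
    exact ⟨r.1.toFinset, fun w hw a ha => List.mem_toFinset.2 (hS w hw a ha)⟩
  · have h : Partrec fun w => decideMem (c, w) :=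
      partrec_decideMem.comp (Primrec.to_comp (by fun_prop))
    refine h.of_eq fun w => ?_
    obtain ⟨b, hb, hbL⟩ := decideMem_spec hc w
    rw [Part.eq_some_iff.2 hb]
    change Part.some b = Part.some _
    congr 1
    rw [Bool.eq_iff_iff, hbL]
    exact (decide_eq_true_iff).symm

/-- The language of all words `0 ^ (n * n)`. -/
def squares : Language ℕ := {w | ∃ n, w = List.replicate (n * n) 0}

theorem squares_mem_recursiveLanguages : squares ∈ recursiveLanguages := by
  refine ⟨⟨{0}, ?_⟩, ComputablePred.computable_iff.2 ⟨fun w =>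
    if w = ((List.range w.length).map fun _ => 0) then
      if ((List.range (w.length + 1)).flatMap fun n => if n * n = w.length then [0] else []) = []
        then false else true
    else false, Primrec.to_comp (by fun_prop), ?_⟩⟩
  · rintro w ⟨n, rfl⟩ a ha
    simpa using List.eq_of_mem_replicate ha
  · funext w
    simp only [List.map_const', List.length_range, eq_iff_iff]
    split_ifs with h1 h2
    · simp only [iff_false]
      rintro ⟨n, rfl⟩
      rw [List.flatMap_eq_nil_iff] at h2
      have := h2 n (List.mem_range.2 (by rw [List.length_replicate]; nlinarith))
      simp at this
    · simp only [iff_true]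
      obtain ⟨_, hm⟩ := List.exists_mem_of_ne_nil _ h2
      obtain ⟨n, -, hn⟩ := List.mem_flatMap.1 hm
      split_ifs at hn with hn'
      · refine ⟨n, ?_⟩
        rw [hn']
        exact h1
      · simp at hn
    · simp only [iff_false]
      rintro ⟨n, rfl⟩
      simp at h1

/-- A nonzero period would give an infinite arithmetic progression of squares, although the gaps
between squares grow. -/
theorem not_represents_squares (c : Code) : ¬ Represents squares 1 c := by
  intro hc
  obtain ⟨s, -, S, hS, hv⟩ := loopQuery_spec (u := [1]) hc
  have hinf : Set.Infinite {w : List ℕ | w ∈ squares} := by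
    refine Set.infinite_of_injective_forall_mem (f := fun n => List.replicate (n * n) 0)
      (fun m n h => ?_) fun n => ⟨n, rfl⟩
    have := congrArg List.length h
    simp only [List.length_replicate] at this
    exact Nat.mul_self_inj.1 this
  obtain ⟨p, hp, q, hq, h0⟩ := exists_period_of_infinite hS hv hinf
  set a := p.1.getD 0 0
  set m := q.getD 0 0
  have key : ∀ n, ∃ x, x * x = a + n * m := by
    intro n
    obtain ⟨w, ⟨x, rfl⟩, hw⟩ := exists_length_eq hS hv hp hq n
    rw [List.length_replicate] at hw
    exact ⟨x, hw⟩
  -- The term x² = a + m² has x ≥ m, so the next term x² + m lies strictly between x² and (x + 1)².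
  obtain ⟨x, hx⟩ := key m
  obtain ⟨y, hy⟩ := key (m + 1)
  have h1 : m ≤ x := Nat.mul_self_le_mul_self_iff.1 (by omega)
  have h2 : y * y = x * x + m := by rw [hx, hy]; ring
  have h3 : x < y := Nat.mul_self_lt_mul_self_iff.1 (by omega)
  have h4 : (x + 1) * (x + 1) ≤ y * y := Nat.mul_self_le_mul_self h3
  have h5 : (x + 1) * (x + 1) = x * x + 2 * x + 1 := by ring
  omega

/-! ### The languages of expressions form the smallest family -/

theorem NFAPath.append_iff {A : NFACode} {q r : ℕ} {w v : List ℕ} :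
    NFAPath A q (w ++ v) r ↔ ∃ p, NFAPath A q w p ∧ NFAPath A p v r := by
  induction w generalizing q with
  | nil =>
    refine ⟨fun h => ⟨q, .nil q, h⟩, ?_⟩
    rintro ⟨p, h, h'⟩
    cases h
    exact h'
  | cons a w ih =>
    constructor
    · intro h
      cases h with
      | cons ht hr =>
        obtain ⟨p, h1, h2⟩ := ih.1 hr
        exact ⟨p, .cons ht h1, h2⟩
    · rintro ⟨p, h, h'⟩
      cases h with
      | cons ht hr => exact .cons ht (ih.2 ⟨p, hr, h'⟩)

theorem NFAPath.mem_targets {A : NFACode} {q r : ℕ} {w : List ℕ} (h : NFAPath A q w r) :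
    r = q ∨ r ∈ A.trans.map fun t => t.2.2 := by
  induction h with
  | nil => exact Or.inl rfl
  | cons ht _ ih =>
    rcases ih with rfl | h
    · exact Or.inr (List.mem_map.2 ⟨_, ht, rfl⟩)
    · exact Or.inr h

/-- The states are arbitrary numbers, so left quotients are counted instead of states: each is
determined by the set of states reached, a subset of a finite set. -/
theorem NFACode.isRegular_language (A : NFACode) : A.language.IsRegular := by
  rw [Language.isRegular_iff_finite_range_leftQuotient]
  let R : List ℕ → Set ℕ := fun w => {q | ∃ s ∈ A.start, NFAPath A s w q}
  let g : Set ℕ → Language ℕ := fun Q => {v | ∃ q ∈ Q, ∃ f ∈ A.final, NFAPath A q v f}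
  have hR : ∀ w, R w ⊆ {q | q ∈ A.start ++ A.trans.map fun t => t.2.2} := by
    rintro w q ⟨s, hs, h⟩
    rcases h.mem_targets with rfl | h
    · exact List.mem_append_left _ hs
    · exact List.mem_append_right _ h
  refine ((List.finite_toSet (A.start ++ A.trans.map fun t => t.2.2)).finite_subsets.image
    g).subset ?_
  rintro _ ⟨w, rfl⟩
  refine ⟨R w, hR w, ?_⟩
  ext v
  change _ ↔ w ++ v ∈ A.language
  rw [mem_nfa_language]
  simp only [NFAPath.append_iff]
  constructor
  · rintro ⟨q, ⟨s, hs, h⟩, f, hf, h'⟩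
    exact ⟨s, hs, f, hf, q, h, h'⟩
  · rintro ⟨s, hs, f, hf, q, h, h'⟩
    exact ⟨q, ⟨s, hs, h⟩, f, hf, h'⟩

/-- The table of a homomorphism on a finite alphabet. -/
noncomputable def homTable (S : Finset ℕ) (f : ℕ → List ℕ) : HomCode := S.toList.map fun a => (a, f a)

theorem dom_homTable (S : Finset ℕ) (f : ℕ → List ℕ) : (homTable S f).dom = S := by
  ext a
  simp [homTable, HomCode.dom]

theorem homTable_fn {S : Finset ℕ} {f : ℕ → List ℕ} {a : ℕ} (h : a ∈ S) :
    (homTable S f).fn a = f a := by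
  rw [← dom_homTable S f] at h
  obtain ⟨u, hu⟩ := mem_dom_iff.1 h
  obtain ⟨b, _, hb⟩ := List.mem_map.1 (lookup_eq_some_mem hu)
  simp only [Prod.mk.injEq] at hb
  obtain ⟨rfl, rfl⟩ := hb
  rw [HomCode.fn, hu]
  rfl

theorem homTable_flatMap {S : Finset ℕ} {f : ℕ → List ℕ} {w : List ℕ} (h : ∀ a ∈ w, a ∈ S) :
    w.flatMap (homTable S f).fn = w.flatMap f :=
  List.flatMap_congr fun a ha => homTable_fn (h a ha)

/-- The given automaton has a move for every natural number; only those with letters in S fit into a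
finite table, hence agreement on words over S only. -/
theorem exists_nfaCode {R : Language ℕ} (hR : R.IsRegular) (S : Finset ℕ) :
    ∃ A : NFACode, ∀ w : List ℕ, (∀ a ∈ w, a ∈ S) → (w ∈ A.language ↔ w ∈ R) := by
  classical
  obtain ⟨σ, _, M, rfl⟩ := hR
  let e := Fintype.equivFin σ
  let A : NFACode := ⟨[e M.start], (Finset.univ.filter (· ∈ M.accept)).toList.map fun q => (e q : ℕ),
    Finset.univ.toList.flatMap fun q => S.toList.map fun a => ((e q : ℕ), a, (e (M.step q a) : ℕ))⟩
  have htrans : ∀ q a r, ((e q : ℕ), a, r) ∈ A.trans ↔ a ∈ S ∧ r = e (M.step q a) := by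
    intro q a r
    simp only [A, List.mem_flatMap, List.mem_map, Finset.mem_toList, Finset.mem_univ, true_and,
      Prod.mk.injEq]
    constructor
    · rintro ⟨q', b, hb, hq, rfl, rfl⟩
      obtain rfl := e.injective (Fin.ext hq)
      exact ⟨hb, rfl⟩
    · rintro ⟨ha, rfl⟩
      exact ⟨q, a, ha, rfl, rfl, rfl⟩
  have hpath : ∀ (w : List ℕ), (∀ a ∈ w, a ∈ S) → ∀ q r,
      NFAPath A (e q) w r ↔ r = e (M.evalFrom q w) := by
    intro w
    induction w with
    | nil =>
      intro _ q r
      refine ⟨fun h => ?_, ?_⟩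
      · cases h
        rfl
      · rintro rfl
        exact .nil _
    | cons a w ih =>
      intro hw q r
      have ih' := ih (fun b hb => hw b (by simp [hb])) (M.step q a) r
      rw [DFA.evalFrom_cons, ← ih']
      refine ⟨fun h => ?_, fun h => .cons ((htrans _ _ _).2 ⟨hw a (by simp), rfl⟩) h⟩
      cases h with
      | cons ht hr =>
        obtain ⟨-, rfl⟩ := (htrans _ _ _).1 ht
        exact hr
  refine ⟨A, fun w hw => ?_⟩
  rw [mem_nfa_language, DFA.mem_accepts, DFA.eval]
  constructor
  · rintro ⟨s, hs, f, hf, h⟩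
    obtain rfl := List.mem_singleton.1 hs
    obtain ⟨q, hq, rfl⟩ := List.mem_map.1 hf
    have := e.injective (Fin.ext ((hpath w hw _ _).1 h))
    rw [← this]
    simpa using hq
  · intro h
    exact ⟨_, List.mem_singleton_self _, _, List.mem_map.2 ⟨_, by simpa using h, rfl⟩,
      (hpath w hw _ _).2 rfl⟩

variable {C : Type*} {D : Set C} {ν : C → Language ℕ}

theorem Expr.eval_mem {F : Set (Language ℕ)} (hF : F = {L | ∃ c ∈ D, ν c = L}) (e : Expr C)
    (he : e.Valid D) : e.eval ν ∈ fullAFLNCM F := by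
  rintro G ⟨hG, hFG, hNCM⟩
  induction e with
  | base c => exact hFG (hF ▸ ⟨c, he, rfl⟩)
  | hom h e ih => exact hG.hom _ (ih he) _
  | invHom h e ih => exact hG.invHom _ (ih he) _ _
  | interReg A e ih => exact hG.inter_regular _ (ih he) _ A.isRegular_language
  | interNCM M l e ih => exact hNCM _ (ih he.2) _ ⟨M, l, he.1, rfl⟩
  | union e₁ e₂ ih₁ ih₂ => exact hG.union _ (ih₁ he.1) _ (ih₂ he.2)
  | concat e₁ e₂ ih₁ ih₂ => exact hG.concat _ (ih₁ he.1) _ (ih₂ he.2)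
  | star e ih => exact hG.star _ (ih he)

/-- Expressions contain only finite tables and automata. The finite alphabet of each language lets
these stand for arbitrary homomorphisms and regular languages. -/
theorem isFullAFL_exprs (hD : ∀ e : Expr C, e.Valid D → HasFiniteAlphabet (e.eval ν)) :
    IsFullAFL {L | ∃ e : Expr C, e.Valid D ∧ e.eval ν = L} where
  finite_alphabet := by
    rintro _ ⟨e, he, rfl⟩
    exact hD e he
  hom := by
    rintro _ ⟨e, he, rfl⟩ f
    obtain ⟨S, hS⟩ := hD e he
    refine ⟨.hom (homTable S f) e, he, ?_⟩
    ext v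
    exact exists_congr fun w => and_congr_right fun hw => by rw [homTable_flatMap (hS w hw)]
  invHom := by
    rintro _ ⟨e, he, rfl⟩ S f
    refine ⟨.invHom (homTable S f) e, he, ?_⟩
    ext w
    rw [Expr.eval, dom_homTable]
    exact and_congr_right fun hw => by rw [homTable_flatMap hw]
  inter_regular := by
    rintro _ ⟨e, he, rfl⟩ R hR
    obtain ⟨S, hS⟩ := hD e he
    obtain ⟨A, hA⟩ := exists_nfaCode hR S
    refine ⟨.interReg A e, he, ?_⟩
    ext w
    exact and_congr_right fun hw => hA w (hS w hw)
  union := by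
    rintro _ ⟨e₁, he₁, rfl⟩ _ ⟨e₂, he₂, rfl⟩
    exact ⟨.union e₁ e₂, ⟨he₁, he₂⟩, rfl⟩
  concat := by
    rintro _ ⟨e₁, he₁, rfl⟩ _ ⟨e₂, he₂, rfl⟩
    exact ⟨.concat e₁ e₂, ⟨he₁, he₂⟩, rfl⟩
  star := by
    rintro _ ⟨e, he, rfl⟩
    exact ⟨.star e, he, rfl⟩

theorem fullAFLNCM_eq {F : Set (Language ℕ)} (hF : F = {L | ∃ c ∈ D, ν c = L})
    (hD : ∀ e : Expr C, e.Valid D → HasFiniteAlphabet (e.eval ν)) :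
    fullAFLNCM F = {L | ∃ e : Expr C, e.Valid D ∧ e.eval ν = L} := by
  refine Set.Subset.antisymm (Set.sInter_subset_of_mem ⟨isFullAFL_exprs hD, ?_, ?_⟩) ?_
  · rw [hF]
    rintro _ ⟨c, hc, rfl⟩
    exact ⟨.base c, hc, rfl⟩
  · rintro _ ⟨e, he, rfl⟩ _ ⟨M, l, hl, rfl⟩
    exact ⟨.interNCM M l e, ⟨hl, he⟩, rfl⟩
  · rintro _ ⟨e, he, rfl⟩
    exact e.eval_mem hF he

end LangFam

/-! ### The main theorem -/

theorem mainTheorem4 {C : Type*} [Primcodable C] (D : Set C) (ν : C → Language ℕ)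
    (F : Set (Language ℕ)) (hF : F = {L | ∃ c ∈ D, ν c = L})
    (htrio : LangFam.IsFullTrio F)
    (hsemilinear : LangFam.EffectivelySemilinear D ν)
    (hregular : LangFam.EffectiveInterRegular D ν) :
    LangFam.fullAFLNCM F = {L | ∃ e : LangFam.Expr C, e.Valid D ∧ e.eval ν = L} ∧
    (LangFam.EffectiveInvHom D ν →
      LangFam.MembershipDecidable D ν ∧
      LangFam.EmptinessDecidable D ν ∧
      LangFam.InfinitenessDecidable D ν) ∧
    LangFam.fullAFLNCM F ⊂ LangFam.recursiveLanguages := by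
  have hcode : ∀ e : LangFam.Expr C, e.Valid D → ∀ d, ∃ k, LangFam.Represents (e.eval ν) d k :=
    LangFam.exists_expr_code fun c hc d =>
      LangFam.exists_base_code_of_mem hF htrio hsemilinear hregular hc d
  have hrec : ∀ e : LangFam.Expr C, e.Valid D → e.eval ν ∈ LangFam.recursiveLanguages :=
    fun e he => LangFam.mem_recursiveLanguages (hcode e he 0).choose_spec
  -- The finite alphabets needed for the closure properties come from the programs, through
  -- recursiveness.
  have heq := LangFam.fullAFLNCM_eq hF fun e he => (hrec e he).1
  refine ⟨heq, fun hinv => ?_, ?_⟩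
  · obtain ⟨B, hB, hbase⟩ := LangFam.exists_base_code hsemilinear hregular hinv
    obtain ⟨G, hG, h⟩ := LangFam.exists_tokens_code hB hbase
    exact ⟨LangFam.membershipDecidable hG h, LangFam.emptinessDecidable hG h,
      LangFam.infinitenessDecidable hG h⟩
  · rw [heq]
    refine ⟨?_, fun h => ?_⟩
    · rintro _ ⟨e, he, rfl⟩
      exact hrec e he
    · obtain ⟨e, he, hsq⟩ := h LangFam.squares_mem_recursiveLanguages
      -- Dimension 1 is what is needed to ask for the set of lengths.
      obtain ⟨k, hk⟩ := hcode e he 1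
      exact LangFam.not_represents_squares k (hsq ▸ hk)
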